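/- Let $\tau:E\to M$ be a (smooth, real, finite-rank) Lie algebroid over a (Hausdorff, finite-dimensional) manifold $M$, with anchor $\rho:E\to TM$ and bracket $[\ ,\ ]$ on sections. For $k\ge 1$ let $E^k\subset T^{k-1}E$ be the manifold of $(k-1)$-jets $[a]^{k-1}$ at $0$ of admissible curves $a$ (smooth curves in $E$ with $\frac{d}{dt}(\tau\circ a)=\rho\circ a$), and let $E^0=M$. Let $\tau_{k,l}:E^k\to E^l$ ($k\ge l\ge 0$) be the projections. The $E$-tangent bundle $\mathcal T^EE^k\to E^k$ has fibre $\{(b,v)\in E_{\tau_{k,0}(A)}\times T_AE^k:\rho(b)=T\tau_{k,0}(v)\}$ at $A$; it is a Lie algebroid with anchor $(b,v)\mapsto v$ and with bracket determined by $[(\eta\circ\tau_{k,0},V),(\zeta\circ\tau_{k,0},W)]=([\eta,\zeta]\circ\tau_{k,0},[V,W])$ on projectable sections; $d$ denotes its exterior differential. Set $\mathcal T\tau_{k,l}(b,v)=(b,T\tau_{k,l}(v))$. In particular $\mathcal T^EE^0=E$. Let $\mathbf T([a]^k)=\bigl([a]^{k-1},a(0),\tfrac{d}{dt}[s\mapsto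 a(t+s)]^{k-1}\big|_{t=0}\bigr)$ be the canonical section of $\mathcal T^EE^k$ along $\tau_{k+1,k}$ (for $k=0$: $\mathbf T(a)=a$). For a section $\lambda$ of $(\mathcal T^EE^k)^*$ let $d_{\mathbf T}\lambda=d(i_{\mathbf T}\lambda)+i_{\mathbf T}d\lambda$, i.e. for $Z\in\mathcal T^EE^{k+1}$ over $A\in E^{k+1}$ with vector part $v\in T_AE^{k+1}$, $$\langle d_{\mathbf T}\lambda,Z\rangle=v\bigl(\langle\lambda,\mathbf T\rangle\bigr)+d\lambda\bigl(\mathbf T(A),\mathcal T\tau_{k+1,k}(Z)\bigr).$$ The vertical endomorphism $S$ of $\mathcal T^EE^k$ is the smooth $(1,1)$ tensor field whose dual action on sections of $(\mathcal T^EE^k)^*$, again denoted $S$, satisfies, for every section $\theta$ of $E^*$ (all forms being pulled back to $E^k$ by the maps $\mathcal T\tau_{k,l}$), $$S(\theta)=0,\qquad S(d_{\mathbf T}^r\theta)=r\,d_{\mathbf T}^{r-1}\theta\quad(1\le r\le k).$$ Then, for every $k\ge 0$, there is exactly one such $S$ on $\mathcal T^EE^k$. Moreover, for every $k\ge 1$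 and every smooth section $\lambda$ of $(\mathcal T^EE^{k-1})^*$, $d_{\mathbf T}\lambda$ is a smooth section of $(\mathcal T^EE^{k})^*$ and $$S(d_{\mathbf T}\lambda)-d_{\mathbf T}(S\lambda)=\lambda,$$ where on the right $\lambda$ is pulled back to $E^k$ by $\mathcal T\tau_{k,k-1}$, and the two $S$ on the left are the vertical endomorphisms of $\mathcal T^EE^k$ and $\mathcal T^EE^{k-1}$, respectively. -/

import Mathlib

open Set Filter Bundle Topology
open scoped Manifold ContDiff Bundle

set_option linter.unusedSectionVars false

/-- The derivative `v f` of a real function `f` on a manifold along a tangent vector `v`. -/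
noncomputable def dirDeriv {B : Type*} [NormedAddCommGroup B] [NormedSpace ℝ B]
    {N : Type*} [TopologicalSpace N] [ChartedSpace B N] (f : N → ℝ) {x : N}
    (v : TangentSpace 𝓘(ℝ, B) x) : ℝ :=
  mfderiv 𝓘(ℝ, B) 𝓘(ℝ, ℝ) f x v

/-- A (finite-dimensional, real, smooth) Lie algebroid structure on the smooth vector bundle
`E → M` with typical fibre `F`, over a manifold `M` modelled on `B`: a smooth anchor
`ρ : E → TM` over the identity and a Lie bracket on the smooth sections of `E` satisfying the
Leibniz rule `[σ, f η] = (ρ(σ) f) η + f [σ, η]`. -/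
structure LieAlgebroid (B : Type*) [NormedAddCommGroup B] [NormedSpace ℝ B]
    {M : Type*} [TopologicalSpace M] [ChartedSpace B M] [IsManifold 𝓘(ℝ, B) ∞ M]
    (F : Type*) [NormedAddCommGroup F] [NormedSpace ℝ F]
    (E : M → Type*) [∀ x, AddCommGroup (E x)] [∀ x, Module ℝ (E x)]
    [∀ x, TopologicalSpace (E x)] [TopologicalSpace (TotalSpace F E)]
    [FiberBundle F E] [VectorBundle ℝ F E] [ContMDiffVectorBundle ∞ F E 𝓘(ℝ, B)] where
  /-- The anchor. -/
  anchor : ∀ x : M, E x →ₗ[ℝ] TangentSpace 𝓘(ℝ, B) x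
  contMDiff_anchor : ContMDiff (𝓘(ℝ, B).prod 𝓘(ℝ, F)) 𝓘(ℝ, B).tangent ∞
    (fun p : TotalSpace F E => (⟨p.1, anchor p.1 p.2⟩ : TangentBundle 𝓘(ℝ, B) M))
  /-- The bracket of smooth sections. -/
  bracket : Cₛ^∞⟮𝓘(ℝ, B); F, E⟯ → Cₛ^∞⟮𝓘(ℝ, B); F, E⟯ → Cₛ^∞⟮𝓘(ℝ, B); F, E⟯
  bracket_add : ∀ σ η ζ, bracket σ (η + ζ) = bracket σ η + bracket σ ζ
  bracket_smul : ∀ (c : ℝ) (σ η), bracket σ (c • η) = c • bracket σ η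
  bracket_skew : ∀ σ η, bracket σ η = - bracket η σ
  jacobi : ∀ σ η ζ,
    bracket σ (bracket η ζ) = bracket (bracket σ η) ζ + bracket η (bracket σ ζ)
  leibniz : ∀ (f : M → ℝ), ContMDiff 𝓘(ℝ, B) 𝓘(ℝ, ℝ) ∞ f →
    ∀ σ η fη : Cₛ^∞⟮𝓘(ℝ, B); F, E⟯, (∀ x, fη x = f x • η x) → ∀ x,
      bracket σ fη x =
        dirDeriv f (anchor x (σ x)) • η x + f x • bracket σ η x

namespace LieAlgebroid

section Jets

variable {B : Type*} [NormedAddCommGroup B] [NormedSpace ℝ B]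
  {M : Type*} [TopologicalSpace M] [ChartedSpace B M] [IsManifold 𝓘(ℝ, B) ∞ M]
  {F : Type*} [NormedAddCommGroup F] [NormedSpace ℝ F]
  {E : M → Type*} [∀ x, AddCommGroup (E x)] [∀ x, Module ℝ (E x)]
  [∀ x, TopologicalSpace (E x)] [TopologicalSpace (TotalSpace F E)]
  [FiberBundle F E] [VectorBundle ℝ F E] [ContMDiffVectorBundle ∞ F E 𝓘(ℝ, B)]
  (L : LieAlgebroid B F E)

/-- `a : ℝ → E` is smooth and admissible on `s`: the velocity of its base curve is `ρ(a(t))`. -/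
def IsAdmissibleOn (a : ℝ → TotalSpace F E) (s : Set ℝ) : Prop :=
  ContMDiffOn 𝓘(ℝ, ℝ) (𝓘(ℝ, B).prod 𝓘(ℝ, F)) ∞ a s ∧
    ∀ t ∈ s, mfderiv 𝓘(ℝ, ℝ) 𝓘(ℝ, B) (fun u => (a u).proj) t (1 : ℝ) =
      L.anchor (a t).proj (a t).snd

/-- An admissible curve through the fibre over `x` at time `0`, defined (i.e. smooth and
admissible) on some open interval around `0`. -/
structure AdmissibleCurve (x : M) where
  /-- The underlying map; only its germ at `0` matters. -/
  toFun : ℝ → TotalSpace F E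
  proj_zero : (toFun 0).proj = x
  admissible : ∃ ε > 0, L.IsAdmissibleOn toFun (Ioo (-ε) ε)

variable (B F E) in
/-- The natural chart of (the total space of) `E` around the fibre over `x₀`, built from the
preferred chart of `M` at `x₀` and the preferred local trivialization of `E` at `x₀`. -/
noncomputable def bundleChart (x₀ : M) : PartialEquiv (TotalSpace F E) (B × F) :=
  extChartAt (𝓘(ℝ, B).prod 𝓘(ℝ, F)) (⟨x₀, 0⟩ : TotalSpace F E)

/-- Two admissible curves through `E_x` have the same `(k-1)`-jet at `0`: in the natural chart
around `E_x`, their derivatives of order `< k` at `0` coincide. For `k = 0` there is no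
condition besides the common base point `x`. -/
def jetSetoid (k : ℕ) (x : M) : Setoid (L.AdmissibleCurve x) where
  r a b := ∀ j < k, iteratedDeriv j (fun t : ℝ => bundleChart B F E x (a.toFun t)) 0 =
    iteratedDeriv j (fun t : ℝ => bundleChart B F E x (b.toFun t)) 0
  iseqv := ⟨fun _ _ _ => rfl, fun h j hj => (h j hj).symm,
    fun h h' j hj => (h j hj).trans (h' j hj)⟩

/-- The space `E^k` of `(k-1)`-jets (at `0`) of admissible curves in `E`, fibred over `M`.
For `k = 0` this is a copy of `M`. -/
@[ext] structure Jet (k : ℕ) where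
  /-- The projection `E^k → M`. -/
  base : M
  /-- The jet. -/
  jet : Quotient (L.jetSetoid k base)

variable {L}

/-- The `(k-1)`-jet of an admissible curve. -/
def AdmissibleCurve.toJet {x : M} (a : L.AdmissibleCurve x) (k : ℕ) : L.Jet k :=
  ⟨x, Quotient.mk _ a⟩

/-- The natural projection `τ_{k,l} : E^k → E^l`. -/
def Jet.truncate {k l : ℕ} (h : l ≤ k) (A : L.Jet k) : L.Jet l :=
  ⟨A.base, Quotient.map id (fun _ _ (hab : ∀ j < k, _) j hj => hab j (hj.trans_le h)) A.jet⟩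

variable (B F E) in
/-- The domain in `M` of the natural chart at `x₀`. -/
def chartDom (x₀ : M) : Set M :=
  (chartAt B x₀).source ∩ (trivializationAt F E x₀).baseSet

variable (B F E) in
/-- The image in `B` of `chartDom`. -/
def chartRan (x₀ : M) : Set B :=
  (chartAt B x₀).target ∩ (chartAt B x₀).symm ⁻¹' (trivializationAt F E x₀).baseSet

/-- The coordinates `(x, y₁, …, y_k)` on `E^k`: `x` is the base point in the chart at `x₀` and
`y_{j+1}` is the `j`-th derivative at `0` of the fibre coordinates of the curve. -/
noncomputable def Jet.coord (k : ℕ) (x₀ : M) (A : L.Jet k) : B × (Fin k → F) :=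
  (chartAt B x₀ A.base,
    fun j => iteratedDeriv j (fun t : ℝ => (bundleChart B F E x₀ (A.jet.out.toFun t)).2) 0)

/-! ### The smooth structure of `E^k` -/

theorem isOpen_chartDom (x₀ : M) : IsOpen (chartDom B F E x₀) :=
  (chartAt B x₀).open_source.inter (trivializationAt F E x₀).open_baseSet

theorem isOpen_chartRan (x₀ : M) : IsOpen (chartRan B F E x₀) :=
  (chartAt B x₀).isOpen_inter_preimage_symm (trivializationAt F E x₀).open_baseSet

theorem mem_chartDom_self (x₀ : M) : x₀ ∈ chartDom B F E x₀ :=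
  ⟨mem_chart_source B x₀, mem_baseSet_trivializationAt F E x₀⟩

theorem chartAt_mem_chartRan {x₀ x : M} (h : x ∈ chartDom B F E x₀) :
    chartAt B x₀ x ∈ chartRan B F E x₀ :=
  ⟨(chartAt B x₀).map_source h.1, by
    rw [mem_preimage, (chartAt B x₀).left_inv h.1]; exact h.2⟩

theorem symm_mem_chartDom {x₀ : M} {u : B} (h : u ∈ chartRan B F E x₀) :
    (chartAt B x₀).symm u ∈ chartDom B F E x₀ :=
  ⟨(chartAt B x₀).map_target h.1, h.2⟩

theorem bundleChart_source (x₀ : M) :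
    (bundleChart B F E x₀).source = TotalSpace.proj ⁻¹' chartDom B F E x₀ := by
  ext p
  rw [bundleChart, FiberBundle.extChartAt]
  simp only [chartDom, mfld_simps, Trivialization.mem_source]
  constructor
  · rintro ⟨h1, h2⟩
    refine ⟨?_, h1⟩
    rwa [Trivialization.coe_fst' _ h1] at h2
  · rintro ⟨h1, h2⟩
    refine ⟨h2, ?_⟩
    rwa [Trivialization.coe_fst' _ h2]

theorem bundleChart_target (x₀ : M) :
    (bundleChart B F E x₀).target = chartRan B F E x₀ ×ˢ univ := by
  rw [bundleChart, FiberBundle.extChartAt_target]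
  simp [chartRan, extChartAt]

theorem bundleChart_fst {x₀ : M} {p : TotalSpace F E} (h : p.proj ∈ chartDom B F E x₀) :
    (bundleChart B F E x₀ p).1 = chartAt B x₀ p.proj := by
  rw [bundleChart, FiberBundle.extChartAt]
  simp only [mfld_simps]
  rw [Trivialization.coe_fst' _ h.2]

theorem bundleChart_symm_proj {x₀ : M} {q : B × F} (h : q.1 ∈ chartRan B F E x₀) :
    ((bundleChart B F E x₀).symm q).proj = (chartAt B x₀).symm q.1 := by
  have hq : q ∈ (bundleChart B F E x₀).target := by
    rw [bundleChart_target]; exact ⟨h, mem_univ _⟩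
  have h1 := (bundleChart B F E x₀).map_target hq
  rw [bundleChart_source] at h1
  have h2 := bundleChart_fst h1
  rw [(bundleChart B F E x₀).right_inv hq] at h2
  rw [h2, (chartAt B x₀).left_inv h1.1]

/-- The anchor in natural coordinates. -/
noncomputable def localAnchor (L : LieAlgebroid B F E) (x₀ : M) (q : B × F) : B :=
  (extChartAt 𝓘(ℝ, B).tangent (⟨x₀, 0⟩ : TangentBundle 𝓘(ℝ, B) M)
    (⟨((bundleChart B F E x₀).symm q).proj,
      L.anchor _ ((bundleChart B F E x₀).symm q).snd⟩ : TangentBundle 𝓘(ℝ, B) M)).2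

theorem contDiffOn_localAnchor (x₀ : M) :
    ContDiffOn ℝ ∞ (localAnchor L x₀) (chartRan B F E x₀ ×ˢ univ) := by
  have h := (contMDiff_iff.1 L.contMDiff_anchor).2 (⟨x₀, 0⟩ : TotalSpace F E)
    (⟨x₀, 0⟩ : TangentBundle 𝓘(ℝ, B) M)
  have h2 := contDiff_snd.comp_contDiffOn h
  refine h2.mono ?_
  rintro q ⟨hq, -⟩
  have hq' : q ∈ (bundleChart B F E x₀).target := by
    rw [bundleChart_target]; exact ⟨hq, mem_univ _⟩
  refine ⟨hq', ?_⟩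
  rw [mem_preimage, mem_preimage, extChartAt_source]
  rw [TangentBundle.mem_chart_source_iff]
  exact ((bundleChart_source (B := B) (F := F) (E := E) x₀) ▸
    (bundleChart B F E x₀).map_target hq').1

/-- In the tangent chart at `x₀`, the fibre coordinate of a tangent vector is its image under the
derivative of the chart. -/
theorem tangentChart_snd {x₀ : M} {x : M} (h : x ∈ (chartAt B x₀).source)
    (v : TangentSpace 𝓘(ℝ, B) x) :
    (extChartAt 𝓘(ℝ, B).tangent (⟨x₀, 0⟩ : TangentBundle 𝓘(ℝ, B) M)
      (⟨x, v⟩ : TangentBundle 𝓘(ℝ, B) M)).2 = mfderiv 𝓘(ℝ, B) 𝓘(ℝ, B) (chartAt B x₀) x v := by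
  have h1 := congrArg (fun T : B →L[ℝ] B => T v)
    (TangentBundle.continuousLinearMapAt_trivializationAt (I := 𝓘(ℝ, B)) h)
  have h2 : (chartAt B x₀ : M → B) = extChartAt 𝓘(ℝ, B) x₀ := by simp
  rw [h2]
  refine Eq.trans ?_ h1
  refine Eq.trans ?_ (congrFun (Trivialization.continuousLinearMapAt_apply ℝ
    (trivializationAt B (TangentSpace 𝓘(ℝ, B)) x₀) x) v).symm
  rw [Trivialization.coe_linearMapAt_of_mem _ h]
  rfl

theorem mfderiv_chart_injective {x₀ : M} {x : M} (h : x ∈ (chartAt B x₀).source)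
    {v w : TangentSpace 𝓘(ℝ, B) x}
    (hvw : mfderiv 𝓘(ℝ, B) 𝓘(ℝ, B) (chartAt B x₀) x v =
      mfderiv 𝓘(ℝ, B) 𝓘(ℝ, B) (chartAt B x₀) x w) : v = w := by
  have h2 : (chartAt B x₀ : M → B) = extChartAt 𝓘(ℝ, B) x₀ := by simp
  rw [h2] at hvw
  exact (isInvertible_mfderiv_extChartAt (I := 𝓘(ℝ, B)) (by simpa using h)).injective hvw

theorem localAnchor_bundleChart {x₀ : M} {p : TotalSpace F E}
    (h : p.proj ∈ chartDom B F E x₀) :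
    localAnchor L x₀ (bundleChart B F E x₀ p) =
      mfderiv 𝓘(ℝ, B) 𝓘(ℝ, B) (chartAt B x₀) p.proj (L.anchor _ p.snd) := by
  have hp : p ∈ (bundleChart B F E x₀).source := by rw [bundleChart_source]; exact h
  rw [localAnchor, (bundleChart B F E x₀).left_inv hp, tangentChart_snd h.1]

theorem _root_.ContDiffAt.iteratedDeriv_infty {G : Type*} [NormedAddCommGroup G]
    [NormedSpace ℝ G] {f : ℝ → G} {t : ℝ} (h : ContDiffAt ℝ ∞ f t) (j : ℕ) :
    ContDiffAt ℝ ∞ (iteratedDeriv j f) t := by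
  have h1 : ContDiffAt ℝ ∞ (iteratedFDeriv ℝ j f) t :=
    h.iteratedFDeriv_right (by exact_mod_cast (le_top : (⊤ + j : ℕ∞) ≤ ⊤))
  rw [iteratedDeriv_eq_equiv_comp]
  exact (LinearIsometryEquiv.contDiff _).contDiffAt.comp t h1

/-- Admissibility of a curve in natural coordinates, at time `t`. -/
def IsLocalAdm (L : LieAlgebroid B F E) (x₀ : M) (c : ℝ → B × F) (t : ℝ) : Prop :=
  (c t).1 ∈ chartRan B F E x₀ ∧ ContDiffAt ℝ ∞ c t ∧
    HasDerivAt (fun u => (c u).1) (localAnchor L x₀ (c t)) t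

theorem hasDerivAt_chart_comp {φ : M → B} {γ : ℝ → M} {t : ℝ}
    (hφ : MDifferentiableAt 𝓘(ℝ, B) 𝓘(ℝ, B) φ (γ t))
    (hγ : MDifferentiableAt 𝓘(ℝ, ℝ) 𝓘(ℝ, B) γ t) :
    HasDerivAt (F := B) (fun u => φ (γ u))
      (show B from mfderiv 𝓘(ℝ, B) 𝓘(ℝ, B) φ (γ t)
        (mfderiv 𝓘(ℝ, ℝ) 𝓘(ℝ, B) γ t (1 : ℝ))) t := by
  have h := hφ.hasMFDerivAt.comp t hγ.hasMFDerivAt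
  obtain ⟨T, hT⟩ : ∃ T : ℝ →L[ℝ] B, T = (mfderiv 𝓘(ℝ, B) 𝓘(ℝ, B) φ (γ t)).comp
    (mfderiv 𝓘(ℝ, ℝ) 𝓘(ℝ, B) γ t) := ⟨_, rfl⟩
  have h2 : HasFDerivAt (fun u => φ (γ u)) T t := by
    rw [hT]; exact hasMFDerivAt_iff_hasFDerivAt.1 h
  have h3 := h2.hasDerivAt
  rwa [hT] at h3

theorem IsAdmissibleOn.isLocalAdm {x₀ : M} {a : ℝ → TotalSpace F E} {s : Set ℝ}
    (h : L.IsAdmissibleOn a s) (hs : IsOpen s) {t : ℝ} (ht : t ∈ s)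
    (hx : (a t).proj ∈ chartDom B F E x₀) :
    IsLocalAdm L x₀ (fun u => bundleChart B F E x₀ (a u)) t := by
  have hsrc : a t ∈ (bundleChart B F E x₀).source := by rw [bundleChart_source]; exact hx
  have ha : ContMDiffAt 𝓘(ℝ, ℝ) (𝓘(ℝ, B).prod 𝓘(ℝ, F)) ∞ a t :=
    (h.1 t ht).contMDiffAt (hs.mem_nhds ht)
  have hchart : ContMDiffAt (𝓘(ℝ, B).prod 𝓘(ℝ, F)) 𝓘(ℝ, B × F) ∞
      (bundleChart B F E x₀) (a t) :=
    contMDiffAt_extChartAt' (by simpa only [bundleChart, extChartAt_source] using hsrc)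
  have hc : ContDiffAt ℝ ∞ (fun u => bundleChart B F E x₀ (a u)) t :=
    (hchart.comp t ha).contDiffAt
  have hproj : ContMDiffAt 𝓘(ℝ, ℝ) 𝓘(ℝ, B) ∞ (fun u => (a u).proj) t :=
    (contMDiffAt_proj E).comp t ha
  refine ⟨?_, hc, ?_⟩
  · rw [bundleChart_fst hx]; exact chartAt_mem_chartRan hx
  · have hev : (fun u => (bundleChart B F E x₀ (a u)).1) =ᶠ[𝓝 t]
        fun u => chartAt B x₀ (a u).proj := by
      filter_upwards [hproj.continuousAt.eventually
        ((isOpen_chartDom x₀).mem_nhds hx)] with u hu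
      exact bundleChart_fst hu
    have hd : MDifferentiableAt 𝓘(ℝ, ℝ) 𝓘(ℝ, B) (fun u => (a u).proj) t :=
      hproj.mdifferentiableAt (by simp)
    have hch : MDifferentiableAt 𝓘(ℝ, B) 𝓘(ℝ, B) (chartAt B x₀) (a t).proj :=
      mdifferentiableAt_atlas (chart_mem_atlas B x₀) hx.1
    have hcomp := hasDerivAt_chart_comp hch hd
    rw [localAnchor_bundleChart hx, ← h.2 t ht]
    exact HasDerivAt.congr_of_eventuallyEq hcomp hev

theorem IsAdmissibleOn.eventually_isLocalAdm {x₀ : M} {a : ℝ → TotalSpace F E} {s : Set ℝ}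
    (h : L.IsAdmissibleOn a s) (hs : IsOpen s) {t : ℝ} (ht : t ∈ s)
    (hx : (a t).proj ∈ chartDom B F E x₀) :
    ∀ᶠ t in 𝓝 t, (a t).proj ∈ chartDom B F E x₀ ∧
      IsLocalAdm L x₀ (fun u => bundleChart B F E x₀ (a u)) t := by
  have hproj : ContinuousAt (fun u => (a u).proj) t :=
    (FiberBundle.continuous_proj F E).continuousAt.comp
      ((h.1 t ht).contMDiffAt (hs.mem_nhds ht)).continuousAt
  filter_upwards [hproj.eventually ((isOpen_chartDom x₀).mem_nhds hx), hs.mem_nhds ht]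
    with u hu hus
  exact ⟨hu, h.isLocalAdm hs hus hu⟩

theorem isAdmissibleOn_of_isLocalAdm {x₀ : M} {c : ℝ → B × F} {s : Set ℝ} (hs : IsOpen s)
    (h : ∀ t ∈ s, IsLocalAdm L x₀ c t) :
    L.IsAdmissibleOn (fun t => (bundleChart B F E x₀).symm (c t)) s := by
  have hsm : ∀ t ∈ s, ContMDiffAt 𝓘(ℝ, ℝ) (𝓘(ℝ, B).prod 𝓘(ℝ, F)) ∞
      (fun t => (bundleChart B F E x₀).symm (c t)) t := by
    intro t ht
    have htar : c t ∈ (bundleChart B F E x₀).target := by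
      rw [bundleChart_target]; exact ⟨(h t ht).1, mem_univ _⟩
    have h1 : ContMDiffOn 𝓘(ℝ, B × F) (𝓘(ℝ, B).prod 𝓘(ℝ, F)) ∞
      (bundleChart B F E x₀).symm (bundleChart B F E x₀).target :=
      contMDiffOn_extChartAt_symm _
    have hopen : IsOpen (bundleChart B F E x₀).target := by
      rw [bundleChart_target]; exact (isOpen_chartRan x₀).prod isOpen_univ
    exact (h1.contMDiffAt (hopen.mem_nhds htar)).comp t (h t ht).2.1.contMDiffAt
  refine ⟨fun t ht => (hsm t ht).contMDiffWithinAt, fun t ht => ?_⟩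
  have htar : c t ∈ (bundleChart B F E x₀).target := by
    rw [bundleChart_target]; exact ⟨(h t ht).1, mem_univ _⟩
  have hx : ((bundleChart B F E x₀).symm (c t)).proj ∈ chartDom B F E x₀ := by
    rw [bundleChart_symm_proj (h t ht).1]; exact symm_mem_chartDom (h t ht).1
  apply mfderiv_chart_injective hx.1
  rw [← localAnchor_bundleChart hx, (bundleChart B F E x₀).right_inv htar]
  have hproj : ContMDiffAt 𝓘(ℝ, ℝ) 𝓘(ℝ, B) ∞
      (fun u => ((bundleChart B F E x₀).symm (c u)).proj) t :=
    (contMDiffAt_proj E).comp t (hsm t ht)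
  have hd := hproj.mdifferentiableAt (by simp)
  have hch : MDifferentiableAt 𝓘(ℝ, B) 𝓘(ℝ, B) (chartAt B x₀)
      ((bundleChart B F E x₀).symm (c t)).proj :=
    mdifferentiableAt_atlas (chart_mem_atlas B x₀) hx.1
  have hcomp := hasDerivAt_chart_comp hch hd
  refine HasDerivAt.unique (F := B) hcomp ((h t ht).2.2.congr_of_eventuallyEq ?_)
  filter_upwards [hs.mem_nhds ht] with u hu
  have hutar : c u ∈ (bundleChart B F E x₀).target := by
    rw [bundleChart_target]; exact ⟨(h u hu).1, mem_univ _⟩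
  have hux : ((bundleChart B F E x₀).symm (c u)).proj ∈ chartDom B F E x₀ := by
    rw [bundleChart_symm_proj (h u hu).1]; exact symm_mem_chartDom (h u hu).1
  change chartAt B x₀ ((bundleChart B F E x₀).symm (c u)).proj = _
  rw [← bundleChart_fst hux, (bundleChart B F E x₀).right_inv hutar]

/-- Total derivatives along admissible curves: the `r`-th derivative of a smooth function along an
admissible curve is a smooth function of `x` and of the derivatives of `y` of order `≤ r`. -/
theorem exists_totalDeriv (L : LieAlgebroid B F E) (x₀ : M) {G : Type*} [NormedAddCommGroup G]
    [NormedSpace ℝ G] {Ψ : B × F → G} {Ω : Set B} (hΩ : IsOpen Ω)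
    (hsub : Ω ⊆ chartRan B F E x₀) (hΨ : ContDiffOn ℝ ∞ Ψ (Ω ×ˢ univ)) (r : ℕ) :
    ∃ Θ : B × (Fin (r + 1) → F) → G, ContDiffOn ℝ ∞ Θ (Ω ×ˢ univ) ∧
      ∀ (c : ℝ → B × F) (t : ℝ), (c t).1 ∈ Ω → (∀ᶠ u in 𝓝 t, IsLocalAdm L x₀ c u) →
        iteratedDeriv r (fun u => Ψ (c u)) t =
          Θ ((c t).1, fun j => iteratedDeriv j (fun u => (c u).2) t) := by
  induction r with
  | zero =>
    refine ⟨fun p => Ψ (p.1, p.2 0), ?_, ?_⟩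
    · refine hΨ.comp (ContDiff.contDiffOn (by fun_prop)) ?_
      rintro p ⟨hp, -⟩
      exact ⟨hp, mem_univ _⟩
    · intro c t _ _
      simp
  | succ r ih =>
    obtain ⟨Θ, hΘ, hc⟩ := ih
    have hopen : IsOpen (Ω ×ˢ (univ : Set (Fin (r + 1) → F))) := hΩ.prod isOpen_univ
    refine ⟨fun p => fderiv ℝ Θ (p.1, fun j => p.2 j.castSucc)
      (localAnchor L x₀ (p.1, p.2 0), fun j => p.2 j.succ), ?_, ?_⟩
    · have h1 : ContDiffOn ℝ ∞ (fderiv ℝ Θ) (Ω ×ˢ univ) :=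
        hΘ.fderiv_of_isOpen hopen (by simp)
      have h2 : ContDiffOn ℝ ∞ (fun p : B × (Fin (r + 1 + 1) → F) =>
          fderiv ℝ Θ (p.1, fun j : Fin (r + 1) => p.2 j.castSucc)) (Ω ×ˢ univ) := by
        refine h1.comp (ContDiff.contDiffOn (by fun_prop)) ?_
        rintro p ⟨hp, -⟩
        exact ⟨hp, mem_univ _⟩
      have h3 : ContDiffOn ℝ ∞ (fun p : B × (Fin (r + 1 + 1) → F) =>
          localAnchor L x₀ (p.1, p.2 0)) (Ω ×ˢ univ) := by
        refine (contDiffOn_localAnchor x₀).comp (ContDiff.contDiffOn (by fun_prop)) ?_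
        rintro p ⟨hp, -⟩
        exact ⟨hsub hp, mem_univ _⟩
      have h4 : ContDiffOn ℝ ∞ (fun p : B × (Fin (r + 1 + 1) → F) =>
          fun j : Fin (r + 1) => p.2 j.succ) (Ω ×ˢ univ) :=
        ContDiff.contDiffOn (by fun_prop)
      exact h2.clm_apply (h3.prodMk h4)
    · intro c t ht hadm
      have hct := hadm.self_of_nhds
      have hev : (fun u => iteratedDeriv r (fun u => Ψ (c u)) u) =ᶠ[𝓝 t]
          fun u => Θ ((c u).1, fun j => iteratedDeriv j (fun u => (c u).2) u) := by
        have hcont : ContinuousAt (fun u => (c u).1) t := hct.2.2.continuousAt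
        filter_upwards [hadm.eventually_nhds, hcont.eventually (hΩ.mem_nhds ht)] with u hu hu2
        exact hc c u hu2 hu
      have hy : ContDiffAt ℝ ∞ (fun u => (c u).2) t := contDiff_snd.contDiffAt.comp t hct.2.1
      have hyd : ∀ j : ℕ, HasDerivAt (iteratedDeriv j (fun u => (c u).2))
          (iteratedDeriv (j + 1) (fun u => (c u).2) t) t := by
        intro j
        rw [iteratedDeriv_succ]
        exact (hy.iteratedDeriv_infty j).differentiableAt (by simp) |>.hasDerivAt
      have hcurve : HasDerivAt (fun u => ((c u).1,
          fun j : Fin (r + 1) => iteratedDeriv j (fun u => (c u).2) u))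
          (localAnchor L x₀ (c t),
            fun j : Fin (r + 1) => iteratedDeriv (j + 1) (fun u => (c u).2) t) t :=
        hct.2.2.prodMk (hasDerivAt_pi.2 fun j => hyd j)
      have hΘd : DifferentiableAt ℝ Θ
          ((c t).1, fun j : Fin (r + 1) => iteratedDeriv j (fun u => (c u).2) t) :=
        (hΘ.contDiffAt (hopen.mem_nhds ⟨ht, mem_univ _⟩)).differentiableAt (by simp)
      rw [iteratedDeriv_succ, hev.deriv_eq]
      have := (hΘd.hasFDerivAt.comp_hasDerivAt t hcurve).deriv
      rw [Function.comp_def] at this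
      rw [this]
      simp

/-- A smooth curve with prescribed derivatives at `0`. -/
theorem exists_curve_iteratedDeriv [CompleteSpace F] (k : ℕ) (y : ℕ → F) :
    ∃ f : ℝ → F, ContDiff ℝ ∞ f ∧ ∀ j < k, iteratedDeriv j f 0 = y j := by
  induction k generalizing y with
  | zero => exact ⟨fun _ => 0, contDiff_const, by simp⟩
  | succ k ih =>
    obtain ⟨g, hg, hgy⟩ := ih (fun j => y (j + 1))
    have hder : ∀ t, HasDerivAt (fun t => y 0 + ∫ s in (0 : ℝ)..t, g s) (g t) t := fun t =>
      (intervalIntegral.integral_hasDerivAt_right (hg.continuous.intervalIntegrable _ _)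
        (hg.continuous.stronglyMeasurableAtFilter _ _) hg.continuous.continuousAt).const_add _
    have hd : deriv (fun t => y 0 + ∫ s in (0 : ℝ)..t, g s) = g := funext fun t => (hder t).deriv
    refine ⟨fun t => y 0 + ∫ s in (0 : ℝ)..t, g s, ?_, ?_⟩
    · rw [contDiff_infty_iff_deriv, hd]
      exact ⟨fun t => (hder t).differentiableAt, hg⟩
    · rintro (_ | j) hj
      · simp
      · rw [iteratedDeriv_succ', hd]
        exact hgy j (by omega)

/-- Local existence of admissible curves with prescribed fibre coordinates. -/
theorem exists_localAdm [CompleteSpace B] (L : LieAlgebroid B F E) (x₀ : M) {u₀ : B}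
    (hu₀ : u₀ ∈ chartRan B F E x₀) {f : ℝ → F} (hf : ContDiff ℝ ∞ f) :
    ∃ (x : ℝ → B) (ε : ℝ), 0 < ε ∧ x 0 = u₀ ∧
      ∀ t ∈ Ioo (-ε) ε, IsLocalAdm L x₀ (fun u => (x u, f u)) t := by
  let V : B × ℝ → B × ℝ := fun p => (localAnchor L x₀ (p.1, f p.2), 1)
  have hopen : IsOpen (chartRan B F E x₀ ×ˢ (univ : Set ℝ)) :=
    (isOpen_chartRan x₀).prod isOpen_univ
  have hV : ContDiffOn ℝ ∞ V (chartRan B F E x₀ ×ˢ univ) := by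
    refine ContDiffOn.prodMk ?_ contDiffOn_const
    refine (contDiffOn_localAnchor x₀).comp (ContDiff.contDiffOn
      (contDiff_fst.prodMk (hf.comp contDiff_snd))) ?_
    rintro p ⟨hp, -⟩
    exact ⟨hp, mem_univ _⟩
  have hV0 : ContDiffAt ℝ 1 V (u₀, 0) :=
    (hV.contDiffAt (hopen.mem_nhds ⟨hu₀, mem_univ _⟩)).of_le (by simp)
  obtain ⟨α, hα0, ε, hε, hα⟩ :=
    hV0.exists_forall_mem_closedBall_exists_eq_forall_mem_Ioo_hasDerivAt₀ 0
  simp only [zero_sub, zero_add] at hα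
  have hcont : ContinuousAt α 0 := (hα 0 ⟨by linarith, hε⟩).continuousAt
  have hnear : ∀ᶠ t in 𝓝 (0 : ℝ), α t ∈ chartRan B F E x₀ ×ˢ (univ : Set ℝ) :=
    hcont.eventually (hopen.mem_nhds (by rw [hα0]; exact ⟨hu₀, mem_univ _⟩))
  obtain ⟨δ, hδ, hδ'⟩ := Metric.eventually_nhds_iff_ball.1 hnear
  set η := min ε δ / 2 with hη
  have hηpos : 0 < η := by positivity
  have hηε : η < ε := by
    have := min_le_left ε δ; have := lt_min hε hδ; linarith
  have hηδ : η < δ := by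
    have := min_le_right ε δ; have := lt_min hε hδ; linarith
  have hIcc : ∀ t ∈ Icc (-η) η, t ∈ Ioo (-ε) ε ∧ t ∈ Metric.ball (0 : ℝ) δ := by
    rintro t ⟨h1, h2⟩
    refine ⟨⟨by linarith, by linarith⟩, ?_⟩
    rw [mem_ball_zero_iff, Real.norm_eq_abs, abs_lt]
    exact ⟨by linarith, by linarith⟩
  have hsm : ContDiffOn ℝ ∞ α (Icc (-η) η) := by
    refine ODE.contDiffOn_enat_Icc_of_hasDerivWithinAt (n := ⊤) (f := fun _ => V)
      (u := chartRan B F E x₀ ×ˢ univ) ?_ ?_ ?_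
    · exact hV.comp contDiffOn_snd (fun p hp => hp.2)
    · exact fun t ht => (hα t (hIcc t ht).1).hasDerivWithinAt
    · exact fun t ht => hδ' t (hIcc t ht).2
  have htime : ∀ t ∈ Ioo (-η) η, (α t).2 = t := by
    intro t ht
    have hc : ∀ s ∈ Ioo (-η) η, HasDerivWithinAt (fun s => (α s).2 - s) 0 (Ioo (-η) η) s := by
      intro s hs
      have h1 : HasDerivAt (fun s => (α s).2) (1 : ℝ) s :=
        (ContinuousLinearMap.snd ℝ B ℝ).hasFDerivAt.comp_hasDerivAt s (hα s (hIcc s (Ioo_subset_Icc_self hs)).1)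
      have h2 := (h1.sub (hasDerivAt_id s)).hasDerivWithinAt (s := Ioo (-η) η)
      rwa [sub_self] at h2
    have := (convex_Ioo (-η) η).is_const_of_fderivWithin_eq_zero (𝕜 := ℝ)
      (f := fun s => (α s).2 - s) (fun s hs => (hc s hs).differentiableWithinAt)
      (fun s hs => by
        have h1 := (hc s hs).hasFDerivWithinAt.fderivWithin
          (isOpen_Ioo.uniqueDiffWithinAt hs)
        rw [h1]; ext; simp) ht (y := 0) ⟨by linarith, hηpos⟩
    simp only [hα0, sub_zero] at this
    linarith
  refine ⟨fun t => (α t).1, η, hηpos, by simp [hα0], fun t ht => ⟨?_, ?_, ?_⟩⟩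
  · exact (hδ' t (hIcc t (Ioo_subset_Icc_self ht)).2).1
  · have h1 : ContDiffAt ℝ ∞ α t := hsm.contDiffAt (Icc_mem_nhds ht.1 ht.2)
    exact (contDiff_fst.contDiffAt.comp t h1).prodMk hf.contDiffAt
  · have h1 : HasDerivAt (fun s => (α s).1) (localAnchor L x₀ ((α t).1, f (α t).2)) t :=
      (ContinuousLinearMap.fst ℝ B ℝ).hasFDerivAt.comp_hasDerivAt t (hα t (hIcc t (Ioo_subset_Icc_self ht)).1)
    rwa [htime t ht] at h1

/-! ### Coordinates on jets -/

variable (B F E) in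
/-- The image in the chart at `x₀` of the common domain of the natural charts at `x₀`, `x₁`. -/
def transDom (x₀ x₁ : M) : Set B :=
  chartRan B F E x₀ ∩ (chartAt B x₀).symm ⁻¹' chartDom B F E x₁

theorem isOpen_transDom (x₀ x₁ : M) : IsOpen (transDom B F E x₀ x₁) := by
  have : transDom B F E x₀ x₁ = (chartAt B x₀).target ∩ (chartAt B x₀).symm ⁻¹'
      ((trivializationAt F E x₀).baseSet ∩ chartDom B F E x₁) := by
    rw [transDom, chartRan, inter_assoc, preimage_inter]
  rw [this]
  exact (chartAt B x₀).isOpen_inter_preimage_symm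
    ((trivializationAt F E x₀).open_baseSet.inter (isOpen_chartDom x₁))

theorem chartAt_mem_transDom {x₀ x₁ x : M} (h₀ : x ∈ chartDom B F E x₀)
    (h₁ : x ∈ chartDom B F E x₁) : chartAt B x₀ x ∈ transDom B F E x₀ x₁ :=
  ⟨chartAt_mem_chartRan h₀, by rw [mem_preimage, (chartAt B x₀).left_inv h₀.1]; exact h₁⟩

theorem contDiffOn_transition (x₀ x₁ : M) :
    ContDiffOn ℝ ∞ (fun q => bundleChart B F E x₁ ((bundleChart B F E x₀).symm q))
      (transDom B F E x₀ x₁ ×ˢ univ) := by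
  have h1 : ContMDiffOn 𝓘(ℝ, B × F) (𝓘(ℝ, B).prod 𝓘(ℝ, F)) ∞
      (bundleChart B F E x₀).symm (bundleChart B F E x₀).target :=
    contMDiffOn_extChartAt_symm _
  have h2 : ContMDiffOn (𝓘(ℝ, B).prod 𝓘(ℝ, F)) 𝓘(ℝ, B × F) ∞
      (bundleChart B F E x₁) (bundleChart B F E x₁).source := by
    have := contMDiffOn_extChartAt (n := ∞) (I := 𝓘(ℝ, B).prod 𝓘(ℝ, F))
      (x := (⟨x₁, 0⟩ : TotalSpace F E))
    rw [← extChartAt_source (𝓘(ℝ, B).prod 𝓘(ℝ, F))] at this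
    exact this
  refine (ContMDiffOn.comp h2 (h1.mono ?_) ?_).contDiffOn
  · rintro q ⟨hq, -⟩
    rw [bundleChart_target]; exact ⟨hq.1, mem_univ _⟩
  · rintro q ⟨hq, -⟩
    rw [mem_preimage, bundleChart_source, mem_preimage, bundleChart_symm_proj hq.1]
    exact hq.2

/-- The jets of an admissible curve in two natural charts are related by smooth maps. -/
theorem exists_jetTransition (L : LieAlgebroid B F E) (x₀ x₁ : M) (r : ℕ) :
    ∃ Θ : B × (Fin (r + 1) → F) → B × F, ContDiffOn ℝ ∞ Θ (transDom B F E x₀ x₁ ×ˢ univ) ∧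
      ∀ (x : M) (a : L.AdmissibleCurve x), x ∈ chartDom B F E x₀ → x ∈ chartDom B F E x₁ →
        iteratedDeriv r (fun t : ℝ => bundleChart B F E x₁ (a.toFun t)) 0 =
          Θ (chartAt B x₀ x,
            fun j => iteratedDeriv j (fun t : ℝ => (bundleChart B F E x₀ (a.toFun t)).2) 0) := by
  obtain ⟨Θ, hΘ, hc⟩ := exists_totalDeriv L x₀ (isOpen_transDom x₀ x₁) inter_subset_left
    (contDiffOn_transition x₀ x₁) r
  refine ⟨Θ, hΘ, fun x a h₀ h₁ => ?_⟩
  obtain ⟨ε, hε, hadm⟩ := a.admissible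
  have h00 : (0 : ℝ) ∈ Ioo (-ε) ε := ⟨by linarith, hε⟩
  have hx : (a.toFun 0).proj ∈ chartDom B F E x₀ := by rw [a.proj_zero]; exact h₀
  have hev := hadm.eventually_isLocalAdm isOpen_Ioo h00 hx
  have hfst : (bundleChart B F E x₀ (a.toFun 0)).1 = chartAt B x₀ x := by
    rw [bundleChart_fst hx, a.proj_zero]
  have := hc (fun t => bundleChart B F E x₀ (a.toFun t)) 0
    (by rw [hfst]; exact chartAt_mem_transDom h₀ h₁) (hev.mono fun _ h => h.2)
  rw [hfst] at this
  rw [← this]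
  refine Filter.EventuallyEq.iteratedDeriv_eq _ (hev.mono fun t ht => ?_)
  have hs : a.toFun t ∈ (bundleChart B F E x₀).source := by
    rw [bundleChart_source]; exact ht.1
  simp only [(bundleChart B F E x₀).left_inv hs]

/-! ### Coordinates on jets -/

/-- If two admissible curves have the same fibre derivatives in one natural chart, they have the
same derivatives in any natural chart. -/
theorem iteratedDeriv_eq_of_snd_eq {k : ℕ} {x x₀ x₁ : M} (hx₀ : x ∈ chartDom B F E x₀)
    (hx₁ : x ∈ chartDom B F E x₁) (a b : L.AdmissibleCurve x)
    (h : ∀ j < k, iteratedDeriv j (fun t : ℝ => (bundleChart B F E x₀ (a.toFun t)).2) 0 =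
      iteratedDeriv j (fun t : ℝ => (bundleChart B F E x₀ (b.toFun t)).2) 0) :
    ∀ j < k, iteratedDeriv j (fun t : ℝ => bundleChart B F E x₁ (a.toFun t)) 0 =
      iteratedDeriv j (fun t : ℝ => bundleChart B F E x₁ (b.toFun t)) 0 := by
  intro j hj
  obtain ⟨Θ, -, hΘ⟩ := exists_jetTransition L x₀ x₁ j
  rw [hΘ x a hx₀ hx₁, hΘ x b hx₀ hx₁]
  congr 2
  funext i
  exact h i (by omega)

theorem iteratedDeriv_snd {c : ℝ → B × F} {t : ℝ} (hc : ContDiffAt ℝ ∞ c t) (j : ℕ) :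
    iteratedDeriv j (fun u => (c u).2) t = (iteratedDeriv j c t).2 := by
  have h := (ContinuousLinearMap.snd ℝ B F).iteratedFDeriv_comp_left
    (hc.of_le (by exact_mod_cast le_top) : ContDiffAt ℝ j c t) (i := j) le_rfl
  simp only [iteratedDeriv]
  have h' := congrArg (fun T => T (fun _ => (1 : ℝ))) h
  exact h'

theorem AdmissibleCurve.contDiffAt {x x₀ : M} (a : L.AdmissibleCurve x)
    (hx : x ∈ chartDom B F E x₀) :
    ContDiffAt ℝ ∞ (fun t : ℝ => bundleChart B F E x₀ (a.toFun t)) 0 := by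
  obtain ⟨ε, hε, hadm⟩ := a.admissible
  exact (hadm.isLocalAdm isOpen_Ioo ⟨by linarith, hε⟩ (by rw [a.proj_zero]; exact hx)).2.1

theorem iteratedDeriv_snd_eq_of_eq {k : ℕ} {x x₀ x₁ : M} (hx₀ : x ∈ chartDom B F E x₀)
    (hx₁ : x ∈ chartDom B F E x₁) (a b : L.AdmissibleCurve x)
    (h : ∀ j < k, iteratedDeriv j (fun t : ℝ => bundleChart B F E x₀ (a.toFun t)) 0 =
      iteratedDeriv j (fun t : ℝ => bundleChart B F E x₀ (b.toFun t)) 0) :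
    ∀ j < k, iteratedDeriv j (fun t : ℝ => (bundleChart B F E x₁ (a.toFun t)).2) 0 =
      iteratedDeriv j (fun t : ℝ => (bundleChart B F E x₁ (b.toFun t)).2) 0 := by
  intro j hj
  rw [iteratedDeriv_snd (a.contDiffAt hx₁), iteratedDeriv_snd (b.contDiffAt hx₁)]
  rw [iteratedDeriv_eq_of_snd_eq hx₀ hx₁ a b (fun i hi => ?_) j hj]
  rw [iteratedDeriv_snd (a.contDiffAt hx₀), iteratedDeriv_snd (b.contDiffAt hx₀), h i hi]

/-- The coordinates of the jet of `a` can be computed from `a`. -/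
theorem coord_toJet {k : ℕ} {x x₀ : M} (hx : x ∈ chartDom B F E x₀) (a : L.AdmissibleCurve x) :
    (a.toJet k).coord k x₀ = (chartAt B x₀ x,
      fun j : Fin k =>
        iteratedDeriv j (fun t : ℝ => (bundleChart B F E x₀ (a.toFun t)).2) 0) := by
  have h : (L.jetSetoid k x).r _ _ := Quotient.mk_out (s := L.jetSetoid k x) a
  refine Prod.ext rfl (funext fun j => ?_)
  exact iteratedDeriv_snd_eq_of_eq (mem_chartDom_self x) hx _ a h j j.2

theorem exists_toJet {k : ℕ} (A : L.Jet k) : ∃ a : L.AdmissibleCurve A.base, a.toJet k = A := by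
  obtain ⟨x, q⟩ := A
  obtain ⟨a, rfl⟩ := Quotient.exists_rep q
  exact ⟨a, rfl⟩

theorem toJet_eq_of_coord {k : ℕ} {x x' x₀ : M} (a : L.AdmissibleCurve x)
    (b : L.AdmissibleCurve x') (hx : x ∈ chartDom B F E x₀) (hx' : x' ∈ chartDom B F E x₀)
    (h : (a.toJet k).coord k x₀ = (b.toJet k).coord k x₀) : a.toJet k = b.toJet k := by
  rw [coord_toJet hx, coord_toJet hx', Prod.mk.injEq] at h
  obtain rfl : x = x' := (chartAt B x₀).injOn hx.1 hx'.1 h.1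
  have : (L.jetSetoid k x).r a b := iteratedDeriv_eq_of_snd_eq hx (mem_chartDom_self x) a b
    (fun j hj => congrFun h.2 ⟨j, hj⟩)
  have h2 : (Quotient.mk (L.jetSetoid k x) a) = Quotient.mk _ b := Quotient.sound this
  exact congrArg (Jet.mk x) h2

/-- Every point in the range of coordinates comes from the jet of an admissible curve. -/
theorem exists_admissibleCurve [CompleteSpace B] [CompleteSpace F] (L : LieAlgebroid B F E)
    (k : ℕ) (x₀ : M) {q : B × (Fin k → F)} (hq : q.1 ∈ chartRan B F E x₀) :
    ∃ a : L.AdmissibleCurve ((chartAt B x₀).symm q.1), (a.toJet k).coord k x₀ = q := by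
  obtain ⟨f, hf, hfy⟩ := exists_curve_iteratedDeriv k
    (fun j => if h : j < k then q.2 ⟨j, h⟩ else 0)
  obtain ⟨x, ε, hε, hx0, hadm⟩ := exists_localAdm L x₀ hq hf
  have h00 : (0 : ℝ) ∈ Ioo (-ε) ε := ⟨by linarith, hε⟩
  let a : L.AdmissibleCurve ((chartAt B x₀).symm q.1) :=
    { toFun := fun t => (bundleChart B F E x₀).symm (x t, f t)
      proj_zero := by
        rw [bundleChart_symm_proj (q := (x 0, f 0)) (hadm 0 h00).1, hx0]
      admissible := ⟨ε, hε, isAdmissibleOn_of_isLocalAdm isOpen_Ioo hadm⟩ }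
  refine ⟨a, ?_⟩
  rw [coord_toJet (symm_mem_chartDom hq), (chartAt B x₀).right_inv hq.1]
  refine Prod.ext rfl (funext fun j => ?_)
  have hev : (fun t : ℝ => (bundleChart B F E x₀ (a.toFun t)).2) =ᶠ[𝓝 0] f := by
    filter_upwards [isOpen_Ioo.mem_nhds h00] with t ht
    have htar : (x t, f t) ∈ (bundleChart B F E x₀).target := by
      rw [bundleChart_target]; exact ⟨(hadm t ht).1, mem_univ _⟩
    simp only [a, (bundleChart B F E x₀).right_inv htar]
  simp only [hev.iteratedDeriv_eq, hfy j j.2, j.2, dif_pos]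

theorem bijOn_coord [CompleteSpace B] [CompleteSpace F] (L : LieAlgebroid B F E) (k : ℕ)
    (x₀ : M) : BijOn (Jet.coord k x₀) {A : L.Jet k | A.base ∈ chartDom B F E x₀}
      (chartRan B F E x₀ ×ˢ univ) := by
  refine ⟨fun A hA => ⟨chartAt_mem_chartRan hA, mem_univ _⟩, fun A hA A' hA' h => ?_, ?_⟩
  · obtain ⟨a, ha⟩ := exists_toJet A
    obtain ⟨a', ha'⟩ := exists_toJet A'
    have := toJet_eq_of_coord (k := k) a a' hA hA' (by rw [ha, ha', h])
    rwa [ha, ha'] at this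
  · rintro q ⟨hq, -⟩
    obtain ⟨a, ha⟩ := exists_admissibleCurve L k x₀ hq
    exact ⟨a.toJet k, symm_mem_chartDom hq, ha⟩

theorem exists_coordTransition (L : LieAlgebroid B F E) (k : ℕ) (x₀ x₁ : M) :
    ∃ Φ : B × (Fin k → F) → B × (Fin k → F),
      ContDiffOn ℝ ∞ Φ (transDom B F E x₀ x₁ ×ˢ univ) ∧
      ∀ A : L.Jet k, A.base ∈ chartDom B F E x₀ → A.base ∈ chartDom B F E x₁ →
        A.coord k x₁ = Φ (A.coord k x₀) := by
  choose Θ hΘ hΘ' using exists_jetTransition L x₀ x₁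
  refine ⟨fun q => ((bundleChart B F E x₁ ((bundleChart B F E x₀).symm (q.1, 0))).1,
    fun j => (Θ j (q.1, fun i => q.2 (i.castLE (by omega)))).2), ?_, ?_⟩
  · refine ContDiffOn.prodMk ?_ (contDiffOn_pi.2 fun j => ?_)
    · refine contDiff_fst.comp_contDiffOn ((contDiffOn_transition x₀ x₁).comp
        (ContDiff.contDiffOn (f := fun q : B × (Fin k → F) => (q.1, (0 : F))) (by fun_prop)) ?_)
      rintro q ⟨hq, -⟩
      exact ⟨hq, mem_univ _⟩
    · refine contDiff_snd.comp_contDiffOn ((hΘ j).comp (ContDiff.contDiffOn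
        (f := fun q : B × (Fin k → F) =>
          (q.1, fun i : Fin (j + 1) => q.2 (i.castLE (by omega)))) (by fun_prop)) ?_)
      rintro q ⟨hq, -⟩
      exact ⟨hq, mem_univ _⟩
  · rintro ⟨x, p⟩ h₀ h₁
    obtain ⟨a, rfl⟩ := Quotient.exists_rep p
    change x ∈ chartDom B F E x₀ at h₀
    change x ∈ chartDom B F E x₁ at h₁
    change (a.toJet k).coord k x₁ = _
    rw [show (⟨x, Quotient.mk _ a⟩ : L.Jet k) = a.toJet k from rfl, coord_toJet h₀,
      coord_toJet h₁]
    refine Prod.ext ?_ (funext fun j => ?_)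
    · have h2 := chartAt_mem_chartRan h₀
      have h3 : ((bundleChart B F E x₀).symm (chartAt B x₀ x, 0)).proj = x := by
        rw [bundleChart_symm_proj h2, (chartAt B x₀).left_inv h₀.1]
      change _ = (bundleChart B F E x₁
        ((bundleChart B F E x₀).symm (chartAt B x₀ x, 0))).1
      rw [bundleChart_fst (by rw [h3]; exact h₁), h3]
    · refine (iteratedDeriv_snd (a.contDiffAt h₁) j).trans ?_
      rw [hΘ' j x a h₀ h₁]
      rfl

end Jets

section Manifold

variable {B : Type*} [NormedAddCommGroup B] [NormedSpace ℝ B] [FiniteDimensional ℝ B]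
  {M : Type*} [TopologicalSpace M] [ChartedSpace B M] [IsManifold 𝓘(ℝ, B) ∞ M]
  {F : Type*} [NormedAddCommGroup F] [NormedSpace ℝ F] [FiniteDimensional ℝ F]
  {E : M → Type*} [∀ x, AddCommGroup (E x)] [∀ x, Module ℝ (E x)]
  [∀ x, TopologicalSpace (E x)] [TopologicalSpace (TotalSpace F E)]
  [FiberBundle F E] [VectorBundle ℝ F E] [ContMDiffVectorBundle ∞ F E 𝓘(ℝ, B)]
  (L : LieAlgebroid B F E)

theorem bijOn_coord' (k : ℕ) (x₀ : M) :
    BijOn (Jet.coord k x₀) {A : L.Jet k | A.base ∈ chartDom B F E x₀}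
      (chartRan B F E x₀ ×ˢ univ) :=
  haveI := FiniteDimensional.complete ℝ B
  haveI := FiniteDimensional.complete ℝ F
  bijOn_coord L k x₀

theorem nonempty_jet (k : ℕ) (x₀ : M) : Nonempty (L.Jet k) := by
  obtain ⟨A, -⟩ := (L.bijOn_coord' k x₀).surjOn
    (show (chartAt B x₀ x₀, (0 : Fin k → F)) ∈ chartRan B F E x₀ ×ˢ univ from
      ⟨chartAt_mem_chartRan (mem_chartDom_self x₀), mem_univ _⟩)
  exact ⟨A⟩

/-- The natural chart of `E^k` at `x₀`, with coordinates `(x, y₁, …, y_k)`. -/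
noncomputable def jetChart (k : ℕ) (x₀ : M) : PartialEquiv (L.Jet k) (B × (Fin k → F)) :=
  haveI := L.nonempty_jet k x₀
  (L.bijOn_coord' k x₀).toPartialEquiv _ _ _

theorem jetChart_apply (k : ℕ) (x₀ : M) (A : L.Jet k) : L.jetChart k x₀ A = A.coord k x₀ := rfl

theorem jetChart_source (k : ℕ) (x₀ : M) :
    (L.jetChart k x₀).source = {A : L.Jet k | A.base ∈ chartDom B F E x₀} := rfl

theorem jetChart_target (k : ℕ) (x₀ : M) :
    (L.jetChart k x₀).target = chartRan B F E x₀ ×ˢ univ := rfl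

theorem jetChart_symm_base {k : ℕ} {x₀ : M} {q : B × (Fin k → F)}
    (hq : q.1 ∈ chartRan B F E x₀) :
    ((L.jetChart k x₀).symm q).base = (chartAt B x₀).symm q.1 := by
  have hq' : q ∈ (L.jetChart k x₀).target := ⟨hq, mem_univ _⟩
  have h1 : ((L.jetChart k x₀).symm q).base ∈ chartDom B F E x₀ :=
    (L.jetChart k x₀).map_target hq'
  have h2 : chartAt B x₀ ((L.jetChart k x₀).symm q).base = q.1 :=
    congrArg Prod.fst ((L.jetChart k x₀).right_inv hq')
  rw [← h2, (chartAt B x₀).left_inv h1.1]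

theorem jetChart_trans_source (k : ℕ) (x₀ x₁ : M) :
    ((L.jetChart k x₀).symm.trans (L.jetChart k x₁)).source =
      transDom B F E x₀ x₁ ×ˢ univ := by
  ext q
  rw [PartialEquiv.trans_source, PartialEquiv.symm_source, jetChart_target, jetChart_source]
  constructor
  · rintro ⟨⟨h1, -⟩, h2⟩
    rw [mem_preimage, mem_ofPred_eq, jetChart_symm_base L h1] at h2
    exact ⟨⟨h1, h2⟩, mem_univ _⟩
  · rintro ⟨⟨h1, h2⟩, -⟩
    refine ⟨⟨h1, mem_univ _⟩, ?_⟩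
    rw [mem_preimage, mem_ofPred_eq, jetChart_symm_base L h1]
    exact h2

theorem contDiffOn_jetChart_trans (k : ℕ) (x₀ x₁ : M) :
    ContDiffOn ℝ ∞ ((L.jetChart k x₀).symm.trans (L.jetChart k x₁))
      ((L.jetChart k x₀).symm.trans (L.jetChart k x₁)).source := by
  obtain ⟨Φ, hΦ, h⟩ := exists_coordTransition L k x₀ x₁
  have hs := L.jetChart_trans_source k x₀ x₁
  rw [← hs] at hΦ
  refine hΦ.congr fun q hq => ?_
  have hq' := hq
  rw [hs] at hq'
  have hqt : q ∈ (L.jetChart k x₀).target := ⟨hq'.1.1, mem_univ _⟩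
  have h1 := h ((L.jetChart k x₀).symm q) ((L.jetChart k x₀).map_target hqt)
    (by rw [jetChart_symm_base L hq'.1.1]; exact hq'.1.2)
  have h2 : ((L.jetChart k x₀).symm q).coord k x₀ = q := (L.jetChart k x₀).right_inv hqt
  rw [h2] at h1
  exact h1

/-- The natural charts of `E^k` form an atlas. -/
noncomputable def jetCore (k : ℕ) : ChartedSpaceCore (B × (Fin k → F)) (L.Jet k) where
  atlas := range (L.jetChart k)
  chartAt A := L.jetChart k A.base
  mem_chart_source A := mem_chartDom_self A.base
  chart_mem_atlas A := mem_range_self _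
  open_source := by
    rintro _ _ ⟨x₀, rfl⟩ ⟨x₁, rfl⟩
    rw [jetChart_trans_source]
    exact (isOpen_transDom x₀ x₁).prod isOpen_univ
  continuousOn_toFun := by
    rintro _ _ ⟨x₀, rfl⟩ ⟨x₁, rfl⟩
    exact (L.contDiffOn_jetChart_trans k x₀ x₁).continuousOn

noncomputable instance (k : ℕ) : TopologicalSpace (L.Jet k) := (L.jetCore k).toTopologicalSpace

noncomputable instance (k : ℕ) : ChartedSpace (B × (Fin k → F)) (L.Jet k) :=
  (L.jetCore k).toChartedSpace

/-- `E^k` is a smooth manifold modelled on `B × F^k`. -/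
instance (k : ℕ) : IsManifold 𝓘(ℝ, B × (Fin k → F)) ∞ (L.Jet k) := by
  apply isManifold_of_contDiffOn
  intro e e' he he'
  obtain ⟨_, ⟨x₀, rfl⟩, rfl⟩ : ∃ e₀, ∃ h : e₀ ∈ (L.jetCore k).atlas,
      e = (L.jetCore k).openPartialHomeomorph e₀ h := by
    simpa [atlas, ChartedSpace.atlas] using he
  obtain ⟨_, ⟨x₁, rfl⟩, rfl⟩ : ∃ e₀, ∃ h : e₀ ∈ (L.jetCore k).atlas,
      e' = (L.jetCore k).openPartialHomeomorph e₀ h := by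
    simpa [atlas, ChartedSpace.atlas] using he'
  simp only [modelWithCornersSelf_coe, modelWithCornersSelf_coe_symm, Function.id_comp,
    Function.comp_id, preimage_id, range_id, inter_univ]
  exact L.contDiffOn_jetChart_trans k x₀ x₁

theorem coe_chartAt_jet {k : ℕ} (A : L.Jet k) :
    (chartAt (B × (Fin k → F)) A : L.Jet k → B × (Fin k → F)) = Jet.coord k A.base := rfl

theorem chartAt_jet_source {k : ℕ} (A : L.Jet k) :
    (chartAt (B × (Fin k → F)) A).source = {A' | A'.base ∈ chartDom B F E A.base} := rfl

theorem eventually_base_mem {k : ℕ} (A : L.Jet k) :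
    ∀ᶠ A' in 𝓝 A, A'.base ∈ chartDom B F E A.base :=
  (chartAt (B × (Fin k → F)) A).open_source.mem_nhds (mem_chart_source _ A)

theorem contMDiff_base (k : ℕ) :
    ContMDiff 𝓘(ℝ, B × (Fin k → F)) 𝓘(ℝ, B) ∞ (Jet.base : L.Jet k → M) := by
  intro A
  have h1 : ContMDiffAt 𝓘(ℝ, B × (Fin k → F)) 𝓘(ℝ, B × (Fin k → F)) ∞
      (chartAt (B × (Fin k → F)) A) A := contMDiffAt_extChartAt
  have h2 : ContMDiffAt 𝓘(ℝ, B × (Fin k → F)) 𝓘(ℝ, B) ∞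
      (fun A' : L.Jet k => (chartAt (B × (Fin k → F)) A A').1) A :=
    (contDiff_fst.contMDiff.contMDiffAt).comp A h1
  have h3 : ContMDiffAt 𝓘(ℝ, B) 𝓘(ℝ, B) ∞ (chartAt B A.base).symm (chartAt B A.base A.base) :=
    (contMDiffOn_chart_symm (I := 𝓘(ℝ, B))).contMDiffAt
      ((chartAt B A.base).open_target.mem_nhds (mem_chart_target B A.base))
  refine (h3.comp (g := (chartAt B A.base).symm) A h2).congr_of_eventuallyEq ?_
  filter_upwards [L.eventually_base_mem A] with A' hA'
  exact ((chartAt B A.base).left_inv hA'.1).symm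

theorem coord_truncate {k l : ℕ} (h : l ≤ k) {x₀ : M} {A : L.Jet k}
    (hA : A.base ∈ chartDom B F E x₀) :
    (A.truncate h).coord l x₀ = ((A.coord k x₀).1, fun j => (A.coord k x₀).2 (j.castLE h)) := by
  obtain ⟨x, p⟩ := A
  obtain ⟨a, rfl⟩ := Quotient.exists_rep p
  change (a.toJet l).coord l x₀ = (((a.toJet k).coord k x₀).1,
    fun j => ((a.toJet k).coord k x₀).2 (j.castLE h))
  rw [coord_toJet hA, coord_toJet hA]
  rfl

theorem contMDiff_truncate {k l : ℕ} (h : l ≤ k) :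
    ContMDiff 𝓘(ℝ, B × (Fin k → F)) 𝓘(ℝ, B × (Fin l → F)) ∞
      (Jet.truncate h : L.Jet k → L.Jet l) := by
  intro A
  have h1 : ContMDiffAt 𝓘(ℝ, B × (Fin k → F)) 𝓘(ℝ, B × (Fin k → F)) ∞
      (chartAt (B × (Fin k → F)) A) A := contMDiffAt_extChartAt
  have h2 : ContMDiffAt 𝓘(ℝ, B × (Fin k → F)) 𝓘(ℝ, B × (Fin l → F)) ∞
      (fun A' : L.Jet k => ((chartAt (B × (Fin k → F)) A A').1,
        fun j : Fin l => (chartAt (B × (Fin k → F)) A A').2 (j.castLE h))) A := by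
    have : ContDiff ℝ ∞ (fun q : B × (Fin k → F) => (q.1, fun j : Fin l => q.2 (j.castLE h))) := by
      fun_prop
    exact this.contMDiff.contMDiffAt.comp A h1
  set A₁ : L.Jet l := A.truncate h
  have hev : ∀ A' : L.Jet k, A'.base ∈ chartDom B F E A.base →
      ((chartAt (B × (Fin k → F)) A A').1,
        fun j : Fin l => (chartAt (B × (Fin k → F)) A A').2 (j.castLE h)) =
      chartAt (B × (Fin l → F)) A₁ (A'.truncate h) := fun A' hA' =>
    (L.coord_truncate h hA').symm
  have h3 : ContMDiffAt 𝓘(ℝ, B × (Fin l → F)) 𝓘(ℝ, B × (Fin l → F)) ∞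
      (chartAt (B × (Fin l → F)) A₁).symm (chartAt (B × (Fin l → F)) A₁ A₁) :=
    (contMDiffOn_chart_symm (I := 𝓘(ℝ, B × (Fin l → F)))).contMDiffAt
      ((chartAt _ A₁).open_target.mem_nhds (mem_chart_target _ A₁))
  rw [← hev A (mem_chartDom_self A.base)] at h3
  refine (h3.comp (g := (chartAt (B × (Fin l → F)) A₁).symm) A h2).congr_of_eventuallyEq ?_
  filter_upwards [L.eventually_base_mem A] with A' hA'
  have h4 : A'.truncate h ∈ (chartAt (B × (Fin l → F)) A₁).source := hA'
  rw [Function.comp_apply, hev A' hA', (chartAt _ A₁).left_inv h4]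

/-- The jet prolongation `a^k : t ↦ [s ↦ a(t + s)]^{k-1}` of (a representative of) an admissible
curve germ. It is given by this formula for all `t` in the interval of definition of `a`, and has
a dummy value for the other `t`. -/
noncomputable def AdmissibleCurve.prolong {L : LieAlgebroid B F E} {x : M}
    (a : L.AdmissibleCurve x) (k : ℕ) (t : ℝ) : L.Jet k :=
  open Classical in
  if h : ∃ ε > 0, L.IsAdmissibleOn (fun s => a.toFun (t + s)) (Ioo (-ε) ε) then
    AdmissibleCurve.toJet (x := (a.toFun (t + 0)).proj)
      ⟨fun s => a.toFun (t + s), rfl, h⟩ k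
  else a.toJet k

theorem toJet_eq_of_rel {k : ℕ} {x x' : M} (a : L.AdmissibleCurve x) (b : L.AdmissibleCurve x')
    (hx : x = x') (h : a.toFun = b.toFun) : a.toJet k = b.toJet k := by
  subst hx
  obtain ⟨f, _, _⟩ := a
  obtain ⟨g, _, _⟩ := b
  obtain rfl : f = g := h
  rfl

theorem prolong_zero {x : M} (a : L.AdmissibleCurve x) (k : ℕ) :
    a.prolong k 0 = a.toJet k := by
  unfold AdmissibleCurve.prolong
  split_ifs with h
  · apply toJet_eq_of_rel
    · simp [a.proj_zero]
    · simp
  · rfl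

theorem IsAdmissibleOn.shift {L : LieAlgebroid B F E} {a : ℝ → TotalSpace F E} {ε t : ℝ}
    (h : L.IsAdmissibleOn a (Ioo (-ε) ε)) (ht : t ∈ Ioo (-ε) ε) :
    ∃ δ > 0, L.IsAdmissibleOn (fun s => a (t + s)) (Ioo (-δ) δ) := by
  obtain ⟨h1, h2⟩ := ht
  refine ⟨min (ε - t) (ε + t), lt_min (by linarith) (by linarith), ?_, ?_⟩
  · refine h.1.comp (ContMDiff.contMDiffOn (ContDiff.contMDiff (by fun_prop))) ?_
    rintro s ⟨h3, h4⟩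
    have := min_le_left (ε - t) (ε + t)
    have := min_le_right (ε - t) (ε + t)
    exact ⟨by linarith, by linarith⟩
  · rintro s ⟨h3, h4⟩
    have := min_le_left (ε - t) (ε + t)
    have := min_le_right (ε - t) (ε + t)
    have hs : t + s ∈ Ioo (-ε) ε := ⟨by linarith, by linarith⟩
    rw [← h.2 (t + s) hs]
    have hd : MDifferentiableAt 𝓘(ℝ, ℝ) 𝓘(ℝ, B) (fun u => (a u).proj) (t + s) :=
      ((contMDiffAt_proj E).comp _ ((h.1 _ hs).contMDiffAt
        (isOpen_Ioo.mem_nhds hs))).mdifferentiableAt (n := ∞) (by simp)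
    have hsh : HasMFDerivAt 𝓘(ℝ, ℝ) 𝓘(ℝ, ℝ) (fun s : ℝ => t + s) s
        (ContinuousLinearMap.id ℝ ℝ) :=
      ((hasFDerivAt_id s).const_add t).hasMFDerivAt
    have := (hd.hasMFDerivAt.comp s hsh).mfderiv
    change mfderiv 𝓘(ℝ, ℝ) 𝓘(ℝ, B) ((fun u => (a u).proj) ∘ fun s => t + s) s 1 = _
    rw [this]
    rfl

theorem eventually_prolong {x x₀ : M} (hx : x ∈ chartDom B F E x₀) (a : L.AdmissibleCurve x)
    (k : ℕ) : ∀ᶠ t in 𝓝 (0 : ℝ), (a.prolong k t).base = (a.toFun t).proj ∧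
      (a.prolong k t).base ∈ chartDom B F E x₀ ∧
      ContDiffAt ℝ ∞ (fun t => bundleChart B F E x₀ (a.toFun t)) t ∧
      (a.prolong k t).coord k x₀ = ((bundleChart B F E x₀ (a.toFun t)).1,
        fun j : Fin k =>
          iteratedDeriv j (fun t : ℝ => (bundleChart B F E x₀ (a.toFun t)).2) t) := by
  obtain ⟨ε, hε, hadm⟩ := a.admissible
  have h00 : (0 : ℝ) ∈ Ioo (-ε) ε := ⟨by linarith, hε⟩
  filter_upwards [hadm.eventually_isLocalAdm isOpen_Ioo h00 (by rw [a.proj_zero]; exact hx),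
    isOpen_Ioo.mem_nhds h00] with t ht htI
  have hsh := hadm.shift htI
  have h2 : (a.toFun (t + 0)).proj = (a.toFun t).proj := by rw [add_zero]
  have h3 : (a.toFun (t + 0)).proj ∈ chartDom B F E x₀ := by rw [h2]; exact ht.1
  rw [AdmissibleCurve.prolong, dif_pos hsh]
  refine ⟨h2, h3, ht.2.2.1, ?_⟩
  rw [coord_toJet h3, bundleChart_fst ht.1]
  refine Prod.ext (congrArg (chartAt B x₀) h2) (funext fun j => ?_)
  have := congrFun (iteratedDeriv_comp_const_add j
    (fun t : ℝ => (bundleChart B F E x₀ (a.toFun t)).2) t) 0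
  simp only [add_zero] at this
  exact this

theorem contMDiffAt_prolong {x : M} (a : L.AdmissibleCurve x) (k : ℕ) :
    ContMDiffAt 𝓘(ℝ, ℝ) 𝓘(ℝ, B × (Fin k → F)) ∞ (a.prolong k) 0 := by
  have hx := mem_chartDom_self (B := B) (F := F) (E := E) x
  have hev := L.eventually_prolong hx a k
  set c : ℝ → B × F := fun t => bundleChart B F E x (a.toFun t)
  have hc : ContDiffAt ℝ ∞ c 0 := hev.self_of_nhds.2.2.1
  have hc2 : ContDiffAt ℝ ∞ (fun t => (c t).2) 0 := contDiff_snd.contDiffAt.comp 0 hc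
  have h2 : ContDiffAt ℝ ∞ (fun t => ((c t).1,
      fun j : Fin k => iteratedDeriv j (fun t : ℝ => (c t).2) t)) 0 :=
    (contDiff_fst.contDiffAt.comp 0 hc).prodMk
      (contDiffAt_pi.2 fun j => hc2.iteratedDeriv_infty j)
  set A₁ : L.Jet k := a.toJet k
  have h3 : ContMDiffAt 𝓘(ℝ, B × (Fin k → F)) 𝓘(ℝ, B × (Fin k → F)) ∞
      (chartAt (B × (Fin k → F)) A₁).symm (chartAt (B × (Fin k → F)) A₁ A₁) :=
    (contMDiffOn_chart_symm (I := 𝓘(ℝ, B × (Fin k → F)))).contMDiffAt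
      ((chartAt _ A₁).open_target.mem_nhds (mem_chart_target _ A₁))
  have h4 : chartAt (B × (Fin k → F)) A₁ A₁ = ((c 0).1,
      fun j : Fin k => iteratedDeriv j (fun t : ℝ => (c t).2) 0) := by
    rw [← hev.self_of_nhds.2.2.2, L.prolong_zero]; rfl
  rw [h4] at h3
  refine (h3.comp (g := (chartAt (B × (Fin k → F)) A₁).symm) 0
    h2.contMDiffAt).congr_of_eventuallyEq ?_
  filter_upwards [hev] with t ht
  have h5 : a.prolong k t ∈ (chartAt (B × (Fin k → F)) A₁).source := ht.2.1
  rw [Function.comp_apply, ← ht.2.2.2]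
  exact ((chartAt _ A₁).left_inv h5).symm

/-! ### The `E`-tangent bundle `𝒯^E E^k` -/

/-- The fibre at `A` of the `E`-tangent bundle of `π : E^k → M`:
the pairs `(b, v) ∈ E_{π(A)} × T_A E^k` with `ρ(b) = Tπ(v)`. -/
def ETangent (k : ℕ) (A : L.Jet k) :
    Submodule ℝ (E A.base × TangentSpace 𝓘(ℝ, B × (Fin k → F)) A) where
  carrier := {z | L.anchor A.base z.1 =
    mfderiv 𝓘(ℝ, B × (Fin k → F)) 𝓘(ℝ, B) (Jet.base : L.Jet k → M) A z.2}
  add_mem' := by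
    intro z w hz hw
    have hz' : L.anchor A.base z.1 = _ := hz
    have hw' : L.anchor A.base w.1 = _ := hw
    change L.anchor A.base (z.1 + w.1) = mfderiv _ _ _ A (z.2 + w.2)
    rw [map_add, map_add, hz', hw']
  zero_mem' := by
    change L.anchor A.base 0 = mfderiv _ _ _ A 0
    rw [map_zero, map_zero]
  smul_mem' := by
    intro c z hz
    have hz' : L.anchor A.base z.1 = _ := hz
    change L.anchor A.base (c • z.1) = mfderiv _ _ _ A (c • z.2)
    rw [map_smul, map_smul, hz']

theorem mem_ETangent {k : ℕ} {A : L.Jet k}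
    {z : E A.base × TangentSpace 𝓘(ℝ, B × (Fin k → F)) A} :
    z ∈ L.ETangent k A ↔ L.anchor A.base z.1 =
      mfderiv 𝓘(ℝ, B × (Fin k → F)) 𝓘(ℝ, B) (Jet.base : L.Jet k → M) A z.2 := Iff.rfl

theorem truncate_mem {k l : ℕ} (h : l ≤ k) {A : L.Jet k}
    {z : E A.base × TangentSpace 𝓘(ℝ, B × (Fin k → F)) A} (hz : z ∈ L.ETangent k A) :
    ((z.1, mfderiv 𝓘(ℝ, B × (Fin k → F)) 𝓘(ℝ, B × (Fin l → F))
      (Jet.truncate h : L.Jet k → L.Jet l) A z.2) :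
      E (A.truncate h).base × TangentSpace 𝓘(ℝ, B × (Fin l → F)) (A.truncate h)) ∈
      L.ETangent l (A.truncate h) := by
  rw [mem_ETangent] at hz ⊢
  have h1 := ((L.contMDiff_base l).mdifferentiableAt (x := A.truncate h)
    (by simp)).hasMFDerivAt
  have h2 := ((L.contMDiff_truncate h).mdifferentiableAt (x := A) (by simp)).hasMFDerivAt
  have h3 := (h1.comp A h2).mfderiv
  change L.anchor A.base z.1 = _
  rw [hz]
  exact congrArg (fun T => T z.2) h3

/-- The map `𝒯τ_{k,l} : 𝒯^E E^k → 𝒯^E E^l`, `(b, v) ↦ (b, Tτ_{k,l}(v))`. -/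
noncomputable def ETangent.map {L : LieAlgebroid B F E} {k l : ℕ} (h : l ≤ k) {A : L.Jet k}
    (z : L.ETangent k A) : L.ETangent l (A.truncate h) :=
  ⟨(z.1.1, mfderiv 𝓘(ℝ, B × (Fin k → F)) 𝓘(ℝ, B × (Fin l → F))
    (Jet.truncate h : L.Jet k → L.Jet l) A z.1.2), L.truncate_mem h z.2⟩

/-- The point `a(0) ∈ E_x`. -/
def AdmissibleCurve.initial {L : LieAlgebroid B F E} {x : M} (a : L.AdmissibleCurve x) : E x :=
  a.proj_zero ▸ (a.toFun 0).snd

/-- The velocity at `0` of the prolongation `a^k`, a vector tangent to `E^k` at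
`a^k(0) = [a]^{k-1}` (see `prolong_zero`). -/
noncomputable def AdmissibleCurve.velocity {L : LieAlgebroid B F E} {x : M}
    (a : L.AdmissibleCurve x) (k : ℕ) :
    TangentSpace 𝓘(ℝ, B × (Fin k → F)) (a.toJet k) :=
  L.prolong_zero a k ▸ (mfderiv 𝓘(ℝ, ℝ) 𝓘(ℝ, B × (Fin k → F)) (a.prolong k) 0 (1 : ℝ) :
    TangentSpace 𝓘(ℝ, B × (Fin k → F)) (a.prolong k 0))

theorem anchor_initial {x : M} (a : L.AdmissibleCurve x) :
    L.anchor x a.initial =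
      (a.proj_zero ▸ (mfderiv 𝓘(ℝ, ℝ) 𝓘(ℝ, B) (fun t => (a.toFun t).proj) 0 (1 : ℝ) :
        TangentSpace 𝓘(ℝ, B) (a.toFun 0).proj) : TangentSpace 𝓘(ℝ, B) x) := by
  obtain ⟨f, rfl, ε, hε, hadm⟩ := a
  exact (hadm.2 0 ⟨by linarith, hε⟩).symm

theorem tangent_cast {N : Type*} [TopologicalSpace N] {V : Type*} [NormedAddCommGroup V]
    [NormedSpace ℝ V] [ChartedSpace V N] {x y : N} (p : x = y) (v : TangentSpace 𝓘(ℝ, V) x) :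
    (p ▸ v : TangentSpace 𝓘(ℝ, V) y) = (show V from v) := by
  subst p; rfl

theorem velocity_mem {x : M} (a : L.AdmissibleCurve x) (k : ℕ) :
    ((a.initial, a.velocity k) :
      E (a.toJet k).base × TangentSpace 𝓘(ℝ, B × (Fin k → F)) (a.toJet k)) ∈
      L.ETangent k (a.toJet k) := by
  rw [mem_ETangent]
  change L.anchor x a.initial = _
  rw [anchor_initial, AdmissibleCurve.velocity, tangent_cast]
  simp only [tangent_cast]
  have hg := ((L.contMDiffAt_prolong a k).mdifferentiableAt (by simp)).hasMFDerivAt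
  have hb := ((L.contMDiff_base k).mdifferentiableAt (x := a.prolong k 0) (by simp)).hasMFDerivAt
  have hev : (fun t => (a.toFun t).proj) =ᶠ[𝓝 0] Jet.base ∘ a.prolong k :=
    (L.eventually_prolong (mem_chartDom_self x) a k).mono fun t ht => ht.1.symm
  have h1 := ((hb.comp 0 hg).congr_of_eventuallyEq hev).mfderiv
  have h2 := congrArg (fun T : ℝ →L[ℝ] B => T 1) h1
  refine h2.trans ?_
  rw [← L.prolong_zero a k]
  rfl

theorem toJet_out {k l : ℕ} (h : l ≤ k) (A : L.Jet k) :
    A.jet.out.toJet l = A.truncate h := by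
  obtain ⟨x, p⟩ := A
  have h1 : (Quotient.mk (L.jetSetoid k x) p.out) = p := Quotient.out_eq p
  exact congrArg (fun q => Jet.truncate h (⟨x, q⟩ : L.Jet k)) h1

/-- The canonical section `𝐓` of `𝒯^E E^k` along `τ_{k+1,k}`:
`𝐓([a]^k) = (a^k(0), a(0), (d/dt) a^k (0))`; it does not depend on the representative `a`. -/
noncomputable def sectionT (k : ℕ) (A : L.Jet (k + 1)) :
    L.ETangent k (A.truncate k.le_succ) :=
  L.toJet_out k.le_succ A ▸
    (⟨(A.jet.out.initial, A.jet.out.velocity k), L.velocity_mem _ k⟩ :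
      L.ETangent k (A.jet.out.toJet k))

/-! ### Sections of `(𝒯^E E^k)*` and the exterior differential -/

/-- A real function on the fibres of `𝒯^E E^k`. The sections of `(𝒯^E E^k)*` are those that
satisfy `IsSection`. -/
abbrev Form (k : ℕ) : Type _ := ∀ A : L.Jet k, L.ETangent k A → ℝ

/-- `lam` is a smooth section of `(𝒯^E E^k)*`: it is linear on the fibres, and `lam(Z)` is a smooth
function on `U` for every smooth local section `Z = (b, v)` of `𝒯^E E^k` on an open set `U`
(the values of `Z` off `U` are irrelevant). -/
def IsSection {k : ℕ} (lam : L.Form k) : Prop :=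
  (∀ A, IsLinearMap ℝ (lam A)) ∧
  ∀ (U : Set (L.Jet k)) (Z : ∀ A, L.ETangent k A), IsOpen U →
    ContMDiffOn 𝓘(ℝ, B × (Fin k → F)) (𝓘(ℝ, B).prod 𝓘(ℝ, F)) ∞
      (fun A => (⟨A.base, (Z A).1.1⟩ : TotalSpace F E)) U →
    ContMDiffOn 𝓘(ℝ, B × (Fin k → F)) 𝓘(ℝ, B × (Fin k → F)).tangent ∞
      (fun A => (⟨A, (Z A).1.2⟩ : TangentBundle 𝓘(ℝ, B × (Fin k → F)) (L.Jet k))) U →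
    ContMDiffOn 𝓘(ℝ, B × (Fin k → F)) 𝓘(ℝ, ℝ) ∞ (fun A => lam A (Z A)) U

/-- The pullback `(𝒯τ_{k,l})^⋆ lam` of a form on `E^l` to `E^k`. -/
noncomputable def pull {k l : ℕ} (h : l ≤ k) (lam : L.Form l) : L.Form k :=
  fun A z => lam (A.truncate h) (ETangent.map h z)

/-- A projectable section of `𝒯^E E^k`: a smooth section `(η ∘ π, V)` with `η` a section of `E`
and `V` a vector field on `E^k`. -/
structure ProjectableSection (k : ℕ) where
  /-- The section `η` of `E`. -/
  sec : Cₛ^∞⟮𝓘(ℝ, B); F, E⟯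
  /-- The vector field `V` on `E^k`. -/
  vf : ∀ A : L.Jet k, TangentSpace 𝓘(ℝ, B × (Fin k → F)) A
  contMDiff_vf : ContMDiff 𝓘(ℝ, B × (Fin k → F)) 𝓘(ℝ, B × (Fin k → F)).tangent ∞
    (fun A => (⟨A, vf A⟩ : TangentBundle 𝓘(ℝ, B × (Fin k → F)) (L.Jet k)))
  mem : ∀ A, (sec A.base, vf A) ∈ L.ETangent k A

variable {L} in
/-- The value of a projectable section at a point. -/
noncomputable def ProjectableSection.eval {k : ℕ} (X : L.ProjectableSection k) (A : L.Jet k) :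
    L.ETangent k A :=
  ⟨(X.sec A.base, X.vf A), X.mem A⟩

variable {L} in
/-- The value at `A` of the bracket `[X, Y] = ([η, ζ] ∘ π, [V, W])` of projectable sections
`X = (η ∘ π, V)`, `Y = (ζ ∘ π, W)`, as a pair in `E_{π(A)} × T_A E^k`. -/
noncomputable def ProjectableSection.bracket {k : ℕ} (X Y : L.ProjectableSection k)
    (A : L.Jet k) : E A.base × TangentSpace 𝓘(ℝ, B × (Fin k → F)) A :=
  (L.bracket X.sec Y.sec A.base,
    VectorField.mlieBracket 𝓘(ℝ, B × (Fin k → F)) X.vf Y.vf A)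

/-- `lam(z)` for a pair `z = (b, v)`; the value is `0` if `z` is not in `𝒯^E E^k` (which never
happens for the values of the bracket of projectable sections). -/
noncomputable def Form.onPair {L : LieAlgebroid B F E} {k : ℕ} (lam : L.Form k) (A : L.Jet k)
    (z : E A.base × TangentSpace 𝓘(ℝ, B × (Fin k → F)) A) : ℝ :=
  open Classical in if h : z ∈ L.ETangent k A then lam A ⟨z, h⟩ else 0

/-- `ρ(X)(lam(Y)) - ρ(Y)(lam(X)) - lam([X, Y])` at `A`, for projectable sections `X`, `Y`. -/
noncomputable def koszul {k : ℕ} (lam : L.Form k) (X Y : L.ProjectableSection k) (A : L.Jet k) :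
    ℝ :=
  dirDeriv (fun P => lam P (Y.eval P)) (X.vf A) - dirDeriv (fun P => lam P (X.eval P)) (Y.vf A) -
    lam.onPair A (X.bracket Y A)

/-- The exterior differential `dlam` of a section `lam` of `(𝒯^E E^k)*`, at a point and on two
vectors: `dlam(X, Y) = ρ(X)(lam(Y)) - ρ(Y)(lam(X)) - lam([X, Y])`, computed with arbitrary projectable
sections `X`, `Y` through the two vectors (these exist, and the value does not depend on them). -/
noncomputable def extDeriv {k : ℕ} (lam : L.Form k) (A : L.Jet k) (z w : L.ETangent k A) : ℝ :=
  open Classical in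
  if h : ∃ p : L.ProjectableSection k × L.ProjectableSection k,
      p.1.eval A = z ∧ p.2.eval A = w then
    L.koszul lam h.choose.1 h.choose.2 A
  else 0

/-- The contraction `i_𝐓 lam`, a function on `E^{k+1}`. -/
noncomputable def contractT {k : ℕ} (lam : L.Form k) (A : L.Jet (k + 1)) : ℝ :=
  lam (A.truncate k.le_succ) (L.sectionT k A)

/-- The total derivative `d_𝐓 lam = d (i_𝐓 lam) + i_𝐓 (dlam)` of a section `lam` of `(𝒯^E E^k)*`,
a section of `(𝒯^E E^{k+1})*`. -/
noncomputable def dT {k : ℕ} (lam : L.Form k) : L.Form (k + 1) := fun A z =>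
  dirDeriv (L.contractT lam) z.1.2 +
    L.extDeriv lam (A.truncate k.le_succ) (L.sectionT k A) (ETangent.map k.le_succ z)

/-! ### The vertical endomorphism -/

/-- A smooth section of the dual bundle `E*`, i.e. a smooth function on `E`, linear on the
fibres. -/
structure DualSection where
  /-- The value at a point. -/
  toFun : ∀ x : M, E x →ₗ[ℝ] ℝ
  contMDiff : ContMDiff (𝓘(ℝ, B).prod 𝓘(ℝ, F)) 𝓘(ℝ, ℝ) ∞
    (fun p : TotalSpace F E => toFun p.1 p.2)

/-- A section `θ` of `E*` as a section of `(𝒯^E E^0)*`, under `E^0 = M`, `𝒯^E E^0 = E`. -/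
def basicForm (θ : DualSection (B := B) (F := F) (E := E)) : L.Form 0 :=
  fun A z => θ.toFun A.base z.1.1

/-- The iterated total derivative `d_𝐓^r θ`, a section of `(𝒯^E E^r)*`. -/
noncomputable def iterDT (θ : DualSection (B := B) (F := F) (E := E)) : ∀ r : ℕ, L.Form r
  | 0 => L.basicForm θ
  | r + 1 => L.dT (iterDT θ r)

/-- A fibrewise linear endomorphism of `𝒯^E E^k`. -/
abbrev Endo (k : ℕ) : Type _ := ∀ A : L.Jet k, L.ETangent k A →ₗ[ℝ] L.ETangent k A

/-- The (dual) action `Slam = lam ∘ S` of an endomorphism of `𝒯^E E^k` on forms. -/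
noncomputable def act {k : ℕ} (S : L.Endo k) (lam : L.Form k) : L.Form k := fun A z => lam A (S A z)

/-- `S` is the vertical endomorphism of `𝒯^E E^k`: it is a smooth `(1,1)` tensor field, and
`S θ = 0`, `S (d_𝐓^r θ) = r d_𝐓^{r-1} θ` for `1 ≤ r ≤ k` and every section `θ` of `E*`
(all forms being pulled back to `E^k`). -/
structure IsVerticalEndomorphism {k : ℕ} (S : L.Endo k) : Prop where
  smooth : ∀ lam : L.Form k, L.IsSection lam → L.IsSection (L.act S lam)
  zero : ∀ θ, L.act S (L.pull k.zero_le (L.iterDT θ 0)) = 0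
  succ : ∀ θ (r : ℕ) (h : r + 1 ≤ k),
    L.act S (L.pull h (L.iterDT θ (r + 1))) =
      ((r + 1 : ℕ) : ℝ) • L.pull (r.le_succ.trans h) (L.iterDT θ r)
end Manifold
end LieAlgebroid

/-! The proof reduces everything to natural coordinates. On `E^k` these are (x; y₀, …, y_{k-1}). An
element (b, v) of 𝒯^E E^k satisfies ρ(b) = Tπ(v), so the x-component of v is determined by b, and
the fibre has coordinates (b; w₀, …, w_{k-1}) in F × F^k. Near a point the bracket is [σ, η] =
Dη(ρσ) - Dσ(ρη) + C(σ, η) with smooth bilinear C. Cartan's formula for d_𝐓 then becomes the explicit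
operator `dTloc`: at a jet q, on z = (b; w₀, …, w_k), its value is Λ(w₀; w₁, …, w_k) + (DΛ·vel)(b;
w₀, …, w_{k-1}) - Λ(C(y₀, b); 0), where vel = (ρ(y₀); y₁, …, y_k) is the velocity of the jet
(`IsCoordForm.dT`).

Let ψ_r = d_𝐓^r ψ₀ with ψ₀(b; w) = b, an F-valued form (`psi`). Then ψ_{r+1} is w_r plus terms in b,
w₀, …, w_{r-1}. By this triangularity ψ₀, …, ψ_k separate the points of a fibre. Every ℓ∘ψ_r is
locally some d_𝐓^r θ, so the forms d_𝐓^r θ separate points too (`ETangent.eq_zero_of_iterDT`). This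
gives uniqueness of S. It also allows local constructions of S to be glued, since the defining
equations do not mention a chart.

In coordinates S sends (b; w) to (0; ψ₀, ψ₁ + w₀, …, ψ_j + j w_{j-1}, …) (`vertLoc`). The commutator
identity is the central computation (`dTloc_apply_vertLoc`). The Leibniz rule expresses d_𝐓(Λ∘S)
through d_𝐓 S. As S kills the b-component, the bracket term disappears from (d_𝐓Λ)∘S. What remains
is Λ applied to the difference of (b; ψ_{j+1} + (j+1) w_j) and (0; ψ_{j+1} + j w_j), which is (b;
w_j).

The equations S d_𝐓^{r+1}θ = (r+1) d_𝐓^r θ for an arbitrary θ follow from the commutator by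
induction: S d_𝐓 d_𝐓^r θ = d_𝐓 S d_𝐓^r θ + d_𝐓^r θ (`apply_vertLoc_of_dTloc`).

The rest justifies the coordinate formula for d_𝐓. It needs the anchor to respect brackets, which
Jacobi and Leibniz imply (`localAnchor_bracket`), local structure functions
(`exists_structureFunctions`), and enough projectable sections to compute the exterior differential
(`exists_projectableSection`). -/

namespace LieAlgebroid

/-! ### Total derivatives of forms in coordinates -/

section Coordinates

variable {B : Type*} [NormedAddCommGroup B] [NormedSpace ℝ B]
  {F : Type*} [NormedAddCommGroup F] [NormedSpace ℝ F]
  {G : Type*} [NormedAddCommGroup G] [NormedSpace ℝ G]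
  {G' : Type*} [NormedAddCommGroup G'] [NormedSpace ℝ G']

variable (F) in
/-- Forget the last components of a vector `(x; y₀, …, y_{k-1})`. -/
def truncL (X : Type*) [NormedAddCommGroup X] [NormedSpace ℝ X] {k l : ℕ} (h : l ≤ k) :
    (X × (Fin k → F)) →L[ℝ] (X × (Fin l → F)) :=
  (ContinuousLinearMap.id ℝ X).prodMap
    (ContinuousLinearMap.pi fun j => ContinuousLinearMap.proj (j.castLE h))

variable (F) in
/-- The shift `(x; y₀, …, y_k) ↦ (y₀; y₁, …, y_k)`. -/
def shiftL (X : Type*) [NormedAddCommGroup X] [NormedSpace ℝ X] (k : ℕ) :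
    (X × (Fin (k + 1) → F)) →L[ℝ] (F × (Fin k → F)) :=
  ((ContinuousLinearMap.proj 0).prod
    (ContinuousLinearMap.pi fun j : Fin k => ContinuousLinearMap.proj j.succ)).comp
    (ContinuousLinearMap.snd ℝ X (Fin (k + 1) → F))

section
variable {X : Type*} [NormedAddCommGroup X] [NormedSpace ℝ X]

@[simp] theorem truncL_apply {k l : ℕ} (h : l ≤ k) (q : X × (Fin k → F)) :
    truncL F X h q = (q.1, fun j => q.2 (j.castLE h)) := rfl

@[simp] theorem shiftL_apply {k : ℕ} (q : X × (Fin (k + 1) → F)) :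
    shiftL F X k q = (q.2 0, fun j => q.2 j.succ) := rfl

end

variable (an : B × F → B) (C : B → F →L[ℝ] F →L[ℝ] F)

/-- The velocity of a jet `(x; y₀, …, y_k)`: `(ρ(x) y₀; y₁, …, y_k)`. -/
def totVel {k : ℕ} (q : B × (Fin (k + 1) → F)) : B × (Fin k → F) :=
  (an (q.1, q.2 0), fun j => q.2 j.succ)

/-- The total derivative of a form in coordinates. -/
noncomputable def dTloc {k : ℕ} (Λ : B × (Fin k → F) → (F × (Fin k → F)) →L[ℝ] G)
    (q : B × (Fin (k + 1) → F)) : (F × (Fin (k + 1) → F)) →L[ℝ] G :=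
  (Λ (truncL F B k.le_succ q)).comp (shiftL F F k) +
    (fderiv ℝ Λ (truncL F B k.le_succ q) (totVel an q)).comp (truncL F F k.le_succ) -
    (Λ (truncL F B k.le_succ q)).comp ((ContinuousLinearMap.inl ℝ F (Fin k → F)).comp
      ((C q.1 (q.2 0)).comp (ContinuousLinearMap.fst ℝ F (Fin (k + 1) → F))))

theorem dTloc_apply {k : ℕ} (Λ : B × (Fin k → F) → (F × (Fin k → F)) →L[ℝ] G)
    (q : B × (Fin (k + 1) → F)) (z : F × (Fin (k + 1) → F)) :
    dTloc an C Λ q z = Λ (truncL F B k.le_succ q) (shiftL F F k z) +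
      fderiv ℝ Λ (truncL F B k.le_succ q) (totVel an q) (truncL F F k.le_succ z) -
      Λ (truncL F B k.le_succ q) (C q.1 (q.2 0) z.1, 0) := rfl

/-- The pullback of a form to a higher jet space in coordinates. -/
def pullLoc {k l : ℕ} (h : l ≤ k) (Λ : B × (Fin l → F) → (F × (Fin l → F)) →L[ℝ] G)
    (q : B × (Fin k → F)) : (F × (Fin k → F)) →L[ℝ] G :=
  (Λ (truncL F B h q)).comp (truncL F F h)

theorem pullLoc_apply {k l : ℕ} (h : l ≤ k)
    (Λ : B × (Fin l → F) → (F × (Fin l → F)) →L[ℝ] G) (q : B × (Fin k → F))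
    (z : F × (Fin k → F)) :
    pullLoc h Λ q z = Λ (truncL F B h q) (truncL F F h z) := rfl

variable {an C} {Ω : Set B}

theorem contDiffOn_pullLoc {k l : ℕ} (h : l ≤ k)
    {Λ : B × (Fin l → F) → (F × (Fin l → F)) →L[ℝ] G} (hΛ : ContDiffOn ℝ ∞ Λ (Ω ×ˢ univ)) :
    ContDiffOn ℝ ∞ (pullLoc h Λ) (Ω ×ˢ univ) := by
  refine ContDiffOn.clm_comp ?_ contDiffOn_const
  exact hΛ.comp (truncL F B h).contDiff.contDiffOn fun q hq => ⟨hq.1, mem_univ _⟩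

theorem contDiffOn_dTloc (hΩ : IsOpen Ω) (han : ContDiffOn ℝ ∞ an (Ω ×ˢ univ))
    (hC : ContDiffOn ℝ ∞ C Ω) {k : ℕ} {Λ : B × (Fin k → F) → (F × (Fin k → F)) →L[ℝ] G}
    (hΛ : ContDiffOn ℝ ∞ Λ (Ω ×ˢ univ)) : ContDiffOn ℝ ∞ (dTloc an C Λ) (Ω ×ˢ univ) := by
  have hmaps : MapsTo (truncL F B k.le_succ) (Ω ×ˢ (univ : Set (Fin (k + 1) → F)))
      (Ω ×ˢ univ) := fun q hq => ⟨hq.1, mem_univ _⟩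
  have h1 : ContDiffOn ℝ ∞ (fun q => Λ (truncL F B k.le_succ q)) (Ω ×ˢ univ) :=
    hΛ.comp (truncL F B k.le_succ).contDiff.contDiffOn hmaps
  have h2 : ContDiffOn ℝ ∞ (fun q => fderiv ℝ Λ (truncL F B k.le_succ q)) (Ω ×ˢ univ) :=
    (hΛ.fderiv_of_isOpen (hΩ.prod isOpen_univ) (by simp)).comp
      (truncL F B k.le_succ).contDiff.contDiffOn hmaps
  have h3 : ContDiffOn ℝ ∞ (totVel an : B × (Fin (k + 1) → F) → _) (Ω ×ˢ univ) := by
    refine ContDiffOn.prodMk (han.comp (ContDiff.contDiffOn (by fun_prop)) ?_)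
      (ContDiff.contDiffOn (by fun_prop))
    exact fun q hq => ⟨hq.1, mem_univ _⟩
  have h4 : ContDiffOn ℝ ∞ (fun q : B × (Fin (k + 1) → F) => C q.1 (q.2 0)) (Ω ×ˢ univ) :=
    (hC.comp contDiff_fst.contDiffOn fun q hq => hq.1).clm_apply
      (ContDiff.contDiffOn (by fun_prop))
  exact ((h1.clm_comp contDiffOn_const).add ((h2.clm_apply h3).clm_comp contDiffOn_const)).sub
    (h1.clm_comp (contDiffOn_const.clm_comp (h4.clm_comp contDiffOn_const)))

theorem dTloc_congr (hΩ : IsOpen Ω) {k : ℕ}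
    {Λ Λ' : B × (Fin k → F) → (F × (Fin k → F)) →L[ℝ] G}
    (h : EqOn Λ Λ' (Ω ×ˢ univ)) {q : B × (Fin (k + 1) → F)} (hq : q.1 ∈ Ω) :
    dTloc an C Λ q = dTloc an C Λ' q := by
  have hq' : truncL F B k.le_succ q ∈ Ω ×ˢ (univ : Set (Fin k → F)) := ⟨hq, mem_univ _⟩
  have h1 : Λ =ᶠ[𝓝 (truncL F B k.le_succ q)] Λ' :=
    h.eventuallyEq_of_mem ((hΩ.prod isOpen_univ).mem_nhds hq')
  rw [dTloc, dTloc, h1.fderiv_eq, h hq']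

/-- A constant linear map on the values passes through each of the three terms. This lets
vector-valued forms such as `psi` and `vertLoc` be differentiated componentwise, and turns ψ_r into
scalar forms ℓ∘ψ_r. -/
theorem dTloc_clm_comp (T : G →L[ℝ] G') {k : ℕ}
    {Λ : B × (Fin k → F) → (F × (Fin k → F)) →L[ℝ] G} {q : B × (Fin (k + 1) → F)}
    (hΛ : DifferentiableAt ℝ Λ (truncL F B k.le_succ q)) :
    dTloc an C (fun q => T.comp (Λ q)) q = T.comp (dTloc an C Λ q) := by
  refine ContinuousLinearMap.ext fun z => ?_
  have h1 := ((ContinuousLinearMap.compL ℝ (F × (Fin k → F)) G G' T).hasFDerivAt.comp _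
    hΛ.hasFDerivAt).fderiv
  have h2 : (fun q => T.comp (Λ q)) =
    (ContinuousLinearMap.compL ℝ (F × (Fin k → F)) G G' T) ∘ Λ := rfl
  rw [ContinuousLinearMap.comp_apply, dTloc_apply, dTloc_apply, h2, h1, map_sub, map_add]
  rfl

theorem dTloc_const_smul (c : ℝ) {k : ℕ} {Λ : B × (Fin k → F) → (F × (Fin k → F)) →L[ℝ] G}
    {q : B × (Fin (k + 1) → F)} (hΛ : DifferentiableAt ℝ Λ (truncL F B k.le_succ q)) :
    dTloc an C (fun q => c • Λ q) q = c • dTloc an C Λ q := by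
  have h := dTloc_clm_comp (an := an) (C := C) (c • ContinuousLinearMap.id ℝ G) hΛ
  simpa only [ContinuousLinearMap.smul_comp, ContinuousLinearMap.id_comp] using h

/-- The shift, the velocity of a jet and the bracket term are all compatible with truncation, so
only the chain rule for `truncL` is needed. -/
theorem dTloc_pullLoc {k l : ℕ} (h : l ≤ k)
    {Λ : B × (Fin l → F) → (F × (Fin l → F)) →L[ℝ] G} {q : B × (Fin (k + 1) → F)}
    (hΛ : DifferentiableAt ℝ Λ (truncL F B (h.trans k.le_succ) q)) :
    dTloc an C (pullLoc h Λ) q = pullLoc (Nat.succ_le_succ h) (dTloc an C Λ) q := by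
  refine ContinuousLinearMap.ext fun z => ?_
  have h1 : fderiv ℝ (pullLoc h Λ) (truncL F B k.le_succ q) =
      (((ContinuousLinearMap.compL ℝ (F × (Fin k → F)) (F × (Fin l → F)) G).flip
        (truncL F F h)).comp (fderiv ℝ Λ (truncL F B (h.trans k.le_succ) q))).comp
        (truncL F B h) := by
    have h2 := (((ContinuousLinearMap.compL ℝ (F × (Fin k → F)) (F × (Fin l → F)) G).flip
        (truncL F F h)).hasFDerivAt.comp _ hΛ.hasFDerivAt)
    exact (h2.comp (truncL F B k.le_succ q) (truncL F B h).hasFDerivAt).fderiv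
  rw [pullLoc_apply, dTloc_apply, dTloc_apply, h1]
  rfl

/-! ### The separating forms d_𝐓^r b -/

variable (an C) in
/-- The forms `d_𝐓^r b`, where `b` is the `F`-valued form `(b; w) ↦ b`. -/
noncomputable def psi : ∀ r : ℕ, B × (Fin r → F) → (F × (Fin r → F)) →L[ℝ] F
  | 0 => fun _ => ContinuousLinearMap.fst ℝ F (Fin 0 → F)
  | r + 1 => dTloc an C (psi r)

theorem contDiffOn_psi (hΩ : IsOpen Ω) (han : ContDiffOn ℝ ∞ an (Ω ×ˢ univ))
    (hC : ContDiffOn ℝ ∞ C Ω) (r : ℕ) : ContDiffOn ℝ ∞ (psi an C r) (Ω ×ˢ univ) := by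
  induction r with
  | zero => exact contDiffOn_const
  | succ r ih => exact contDiffOn_dTloc hΩ han hC ih

/-- Leading term of ψ_{r+1}. When the lower components vanish, the derivative and bracket terms of
`dTloc` drop out. The shifted vector again has only its top component, so the induction descends to
ψ_r. -/
theorem psi_last (r : ℕ) (q : B × (Fin (r + 1) → F)) (z : F × (Fin (r + 1) → F))
    (hz : truncL F F r.le_succ z = 0) : psi an C (r + 1) q z = z.2 (Fin.last r) := by
  induction r with
  | zero =>
    rw [psi, dTloc_apply, hz, map_zero]
    have h1 : z.1 = 0 := congrArg Prod.fst hz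
    rw [h1, map_zero]
    simp [psi]
  | succ r ih =>
    rw [psi, dTloc_apply, hz, map_zero]
    have h1 : z.1 = 0 := congrArg Prod.fst hz
    have h2 : truncL F F r.le_succ (shiftL F F (r + 1) z) = 0 := by
      have h3 : ∀ j, z.2 (Fin.castLE (Nat.le_succ (r + 1)) j) = 0 :=
        fun j => congrFun (congrArg Prod.snd hz) j
      exact Prod.ext (h3 0) (funext fun j => h3 j.succ)
    rw [ih _ _ h2, h1, map_zero]
    have h4 : psi an C (r + 1) (truncL F B (r + 1).le_succ q) (0, 0) = 0 := map_zero _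
    rw [h4, add_zero, sub_zero]
    rfl

/-- The forms `d_𝐓^r b`, `r ≤ k`, determine an element of the fibre. -/
theorem eq_zero_of_psi_eq_zero {k : ℕ} (q : B × (Fin k → F)) (z : F × (Fin k → F))
    (h : ∀ (r : ℕ) (hr : r ≤ k), pullLoc hr (psi an C r) q z = 0) : z = 0 := by
  -- Triangularity: ψ₀ gives b = 0, and once the truncation to order r vanishes, ψ_{r+1} reads off
  -- the next component w_r.
  suffices H : ∀ (r : ℕ) (hr : r ≤ k), truncL F F hr z = 0 from H k le_rfl
  intro r
  induction r with
  | zero => exact fun hr => Prod.ext (h 0 hr) (funext fun j => j.elim0)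
  | succ r ih =>
    intro hr
    have h1 := ih (r.le_succ.trans hr)
    have h2 := psi_last (an := an) (C := C) r (truncL F B hr q) (truncL F F hr z) h1
    rw [← pullLoc_apply, h (r + 1) hr] at h2
    refine Prod.ext (congrArg Prod.fst h1 :) (funext fun j => ?_)
    induction j using Fin.lastCases with
    | last => exact h2.symm
    | cast j => exact congrFun (congrArg Prod.snd h1) j

/-! ### The vertical endomorphism in coordinates and its commutator with d_𝐓 -/

variable (an C) in
/-- The vertical endomorphism in coordinates:
`(b; w₀, …, w_{k-1}) ↦ (0; b, d_𝐓 b + w₀, …, d_𝐓^{k-1} b + (k-1) w_{k-2})`. -/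
noncomputable def vertLoc (k : ℕ) (q : B × (Fin k → F)) :
    (F × (Fin k → F)) →L[ℝ] (F × (Fin k → F)) :=
  (ContinuousLinearMap.inr ℝ F (Fin k → F)).comp (ContinuousLinearMap.pi fun j : Fin k =>
    pullLoc j.2.le (psi an C j) q + (j : ℝ) • (ContinuousLinearMap.proj
      (⟨j - 1, (Nat.sub_le _ _).trans_lt j.2⟩ : Fin k)).comp
        (ContinuousLinearMap.snd ℝ F (Fin k → F)))

theorem vertLoc_apply {k : ℕ} (q : B × (Fin k → F)) (z : F × (Fin k → F)) :
    vertLoc an C k q z = (0, fun j : Fin k => pullLoc j.2.le (psi an C j) q z +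
      (j : ℝ) • z.2 ⟨j - 1, (Nat.sub_le _ _).trans_lt j.2⟩) := rfl

/-- Component j involves only ψ_j and w_{j-1}, hence nothing beyond order j; the formulas for
different k therefore agree under truncation. -/
theorem truncL_vertLoc {k l : ℕ} (h : l ≤ k) (q : B × (Fin k → F)) (z : F × (Fin k → F)) :
    truncL F F h (vertLoc an C k q z) = vertLoc an C l (truncL F B h q) (truncL F F h z) := rfl

theorem contDiffOn_vertLoc [FiniteDimensional ℝ F] (hΩ : IsOpen Ω)
    (han : ContDiffOn ℝ ∞ an (Ω ×ˢ univ)) (hC : ContDiffOn ℝ ∞ C Ω) (k : ℕ) :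
    ContDiffOn ℝ ∞ (vertLoc an C k) (Ω ×ˢ univ) := by
  refine contDiffOn_clm_apply.2 fun z => contDiffOn_const.prodMk (contDiffOn_pi.2 fun j => ?_)
  exact ((contDiffOn_pullLoc j.2.le (contDiffOn_psi hΩ han hC j)).clm_apply
    contDiffOn_const).add contDiffOn_const

theorem dTloc_add {k : ℕ} {Λ Λ' : B × (Fin k → F) → (F × (Fin k → F)) →L[ℝ] G}
    {q : B × (Fin (k + 1) → F)} (hΛ : DifferentiableAt ℝ Λ (truncL F B k.le_succ q))
    (hΛ' : DifferentiableAt ℝ Λ' (truncL F B k.le_succ q)) :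
    dTloc an C (fun q => Λ q + Λ' q) q = dTloc an C Λ q + dTloc an C Λ' q := by
  refine ContinuousLinearMap.ext fun z => ?_
  rw [add_apply, dTloc_apply, dTloc_apply, dTloc_apply, fderiv_fun_add hΛ hΛ']
  simp only [add_apply]
  abel

theorem dTloc_const {k : ℕ} (T : (F × (Fin k → F)) →L[ℝ] G) (q : B × (Fin (k + 1) → F))
    (z : F × (Fin (k + 1) → F)) :
    dTloc an C (fun _ => T) q z = T (shiftL F F k z) - T (C q.1 (q.2 0) z.1, 0) := by
  rw [dTloc_apply, fderiv_fun_const]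
  simp

/-- Differentiating componentwise, d_𝐓 raises ψ_j to ψ_{j+1} and the constant form j w_{j-1} to j
w_j. The constant form ignores b, so it has no bracket term. -/
theorem dTloc_vertLoc [FiniteDimensional ℝ F] (hΩ : IsOpen Ω)
    (han : ContDiffOn ℝ ∞ an (Ω ×ˢ univ)) (hC : ContDiffOn ℝ ∞ C Ω) {k : ℕ}
    {q : B × (Fin (k + 1) → F)} (hq : q.1 ∈ Ω) (z : F × (Fin (k + 1) → F)) :
    dTloc an C (vertLoc an C k) q z = (0, fun j : Fin k =>
      pullLoc (Nat.succ_le_succ j.2.le) (psi an C (j + 1)) q z + (j : ℝ) • z.2 j.castSucc) := by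
  have hd : ∀ (l : ℕ) (q' : B × (Fin l → F)), q'.1 ∈ Ω → Ω ×ˢ univ ∈ 𝓝 q' := fun l q' h =>
    (hΩ.prod isOpen_univ).mem_nhds ⟨h, mem_univ _⟩
  have hS : DifferentiableAt ℝ (vertLoc an C k) (truncL F B k.le_succ q) :=
    ((contDiffOn_vertLoc hΩ han hC k).contDiffAt (hd k _ hq)).differentiableAt (by simp)
  refine Prod.ext ?_ (funext fun j => ?_)
  · have h1 := congrArg (fun T => T z)
      (dTloc_clm_comp (an := an) (C := C) (ContinuousLinearMap.fst ℝ F (Fin k → F)) hS)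
    refine h1.symm.trans ?_
    change dTloc an C (fun _ => 0) q z = _
    rw [dTloc_const]
    simp
  · have h1 := congrArg (fun T => T z) (dTloc_clm_comp (an := an) (C := C)
      ((ContinuousLinearMap.proj j).comp (ContinuousLinearMap.snd ℝ F (Fin k → F))) hS)
    refine h1.symm.trans ?_
    have hψ : DifferentiableAt ℝ (psi an C j) (truncL F B (j.2.le.trans k.le_succ) q) :=
      ((contDiffOn_psi hΩ han hC j).contDiffAt (hd j _ hq)).differentiableAt (by simp)
    have hψ' : DifferentiableAt ℝ (pullLoc j.2.le (psi an C j)) (truncL F B k.le_succ q) :=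
      ((contDiffOn_pullLoc j.2.le (contDiffOn_psi hΩ han hC j)).contDiffAt
        (hd k _ hq)).differentiableAt (by simp)
    have h2 : (fun q' => ((ContinuousLinearMap.proj j).comp
        (ContinuousLinearMap.snd ℝ F (Fin k → F))).comp (vertLoc an C k q')) =
        fun q' => pullLoc j.2.le (psi an C j) q' + (j : ℝ) • (ContinuousLinearMap.proj
          (⟨j - 1, (Nat.sub_le _ _).trans_lt j.2⟩ : Fin k)).comp
          (ContinuousLinearMap.snd ℝ F (Fin k → F)) := rfl
    rw [h2, dTloc_add hψ' (differentiableAt_const _), dTloc_pullLoc j.2.le hψ,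
      add_apply, dTloc_const]
    obtain ⟨j, hj⟩ := j
    -- The index `j - 1` is a truncated subtraction; at `j = 0` it is meaningless but is multiplied
    -- by 0.
    cases j with
    | zero => simp [psi]
    | succ j => simp [psi]

/-- The commutator of the vertical endomorphism and the total derivative, in coordinates. -/
theorem dTloc_apply_vertLoc [FiniteDimensional ℝ F] (hΩ : IsOpen Ω)
    (han : ContDiffOn ℝ ∞ an (Ω ×ˢ univ)) (hC : ContDiffOn ℝ ∞ C Ω) {k : ℕ}
    {Λ : B × (Fin k → F) → (F × (Fin k → F)) →L[ℝ] G} {q : B × (Fin (k + 1) → F)}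
    (hq : q.1 ∈ Ω) (hΛ : DifferentiableAt ℝ Λ (truncL F B k.le_succ q))
    (z : F × (Fin (k + 1) → F)) :
    dTloc an C Λ q (vertLoc an C (k + 1) q z) =
      dTloc an C (fun q => (Λ q).comp (vertLoc an C k q)) q z +
        Λ (truncL F B k.le_succ q) (truncL F F k.le_succ z) := by
  have hS : DifferentiableAt ℝ (vertLoc an C k) (truncL F B k.le_succ q) :=
    ((contDiffOn_vertLoc hΩ han hC k).contDiffAt
      ((hΩ.prod isOpen_univ).mem_nhds ⟨hq, mem_univ _⟩)).differentiableAt (by simp)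
  -- Leibniz rule: the shift term, the bracket term and the derivative of S assemble into Λ(d_𝐓 S),
  -- and the derivative of Λ is evaluated on S.
  have h1 : dTloc an C (fun q => (Λ q).comp (vertLoc an C k q)) q z =
      Λ (truncL F B k.le_succ q) (dTloc an C (vertLoc an C k) q z) +
      fderiv ℝ Λ (truncL F B k.le_succ q) (totVel an q)
        (vertLoc an C k (truncL F B k.le_succ q) (truncL F F k.le_succ z)) := by
    rw [dTloc_apply, dTloc_apply, (hΛ.hasFDerivAt.clm_comp hS.hasFDerivAt).fderiv, map_sub,
      map_add]
    simp only [ContinuousLinearMap.comp_apply, add_apply,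
      ContinuousLinearMap.compL_apply, ContinuousLinearMap.flip_apply]
    abel
  rw [h1, dTloc_vertLoc hΩ han hC hq, dTloc_apply, truncL_vertLoc]
  have h2 : (vertLoc an C (k + 1) q z).1 = 0 := rfl
  -- Shifting S z gives components with factor j + 1, against j in d_𝐓 S. The excess w_j, together
  -- with the zeroth component ψ₀ = b of S z, is exactly the truncation of z.
  have h3 : shiftL F F k (vertLoc an C (k + 1) q z) = (0, fun j : Fin k =>
      pullLoc (Nat.succ_le_succ j.2.le) (psi an C (j + 1)) q z + (j : ℝ) • z.2 j.castSucc) +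
      truncL F F k.le_succ z := by
    refine Prod.ext ?_ (funext fun j => ?_)
    · simp [vertLoc_apply, pullLoc_apply, psi]
      rfl
    · simp [vertLoc_apply, add_smul, add_assoc]
      rfl
  rw [h2, h3, map_zero, map_add]
  have h4 : Λ (truncL F B k.le_succ q) (0, 0) = 0 := map_zero _
  rw [h4]
  abel

/-- If `Θ_{r+1} = d_𝐓 Θ_r`, and `Θ₀` is a form on `E^0`, then `S Θ_{r+1} = (r+1) Θ_r`, in
coordinates. -/
theorem apply_vertLoc_of_dTloc [FiniteDimensional ℝ F] (hΩ : IsOpen Ω)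
    (han : ContDiffOn ℝ ∞ an (Ω ×ˢ univ)) (hC : ContDiffOn ℝ ∞ C Ω)
    (Θ : ∀ r : ℕ, B × (Fin r → F) → (F × (Fin r → F)) →L[ℝ] G)
    (hΘ : ∀ r, ContDiffOn ℝ ∞ (Θ r) (Ω ×ˢ univ))
    (hd : ∀ r, ∀ q : B × (Fin (r + 1) → F), q.1 ∈ Ω → Θ (r + 1) q = dTloc an C (Θ r) q)
    (r : ℕ) (q : B × (Fin (r + 1) → F)) (hq : q.1 ∈ Ω) :
    (Θ (r + 1) q).comp (vertLoc an C (r + 1) q) =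
      ((r + 1 : ℕ) : ℝ) • pullLoc r.le_succ (Θ r) q := by
  have hdiff : ∀ (l : ℕ) (q' : B × (Fin l → F)), q'.1 ∈ Ω → DifferentiableAt ℝ (Θ l) q' :=
    fun l q' h => ((hΘ l).contDiffAt ((hΩ.prod isOpen_univ).mem_nhds
      ⟨h, mem_univ _⟩)).differentiableAt (by simp)
  induction r with
  | zero =>
    refine ContinuousLinearMap.ext fun z => ?_
    rw [ContinuousLinearMap.comp_apply, hd 0 q hq,
      dTloc_apply_vertLoc hΩ han hC hq (hdiff 0 _ hq)]
    -- Over E^0 the endomorphism is zero, so the commutator leaves Θ₀ alone.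
    have h1 : (fun q => (Θ 0 q).comp (vertLoc an C 0 q)) = fun _ => 0 := by
      funext q'
      refine ContinuousLinearMap.ext fun z' => ?_
      have h2 : vertLoc an C 0 q' z' = 0 := Prod.ext rfl (funext fun j => j.elim0)
      rw [ContinuousLinearMap.comp_apply, h2, map_zero]
      rfl
    rw [h1, dTloc_const]
    simp [pullLoc_apply]
  | succ r ih =>
    refine ContinuousLinearMap.ext fun z => ?_
    rw [ContinuousLinearMap.comp_apply, hd (r + 1) q hq,
      dTloc_apply_vertLoc hΩ han hC hq (hdiff (r + 1) _ hq)]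
    -- The induction hypothesis is needed on the whole open set because it is going to be
    -- differentiated: d_𝐓 of (r+1)Θ_r is (r+1)Θ_{r+1}, and the commutator adds one more Θ_{r+1}.
    have h1 : EqOn (fun q => (Θ (r + 1) q).comp (vertLoc an C (r + 1) q))
        (fun q => ((r + 1 : ℕ) : ℝ) • pullLoc r.le_succ (Θ r) q) (Ω ×ˢ univ) :=
      fun q' hq' => ih q' hq'.1
    have h3 : DifferentiableAt ℝ (pullLoc r.le_succ (Θ r)) (truncL F B (r + 1).le_succ q) :=
      ((contDiffOn_pullLoc r.le_succ (hΘ r)).contDiffAt ((hΩ.prod isOpen_univ).mem_nhds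
        ⟨hq, mem_univ _⟩)).differentiableAt (by simp)
    rw [dTloc_congr hΩ h1 hq, dTloc_const_smul _ h3,
      dTloc_pullLoc r.le_succ (hdiff r (truncL F B (r.le_succ.trans (r + 1).le_succ) q) hq)]
    have h2 : pullLoc (Nat.succ_le_succ r.le_succ) (dTloc an C (Θ r)) q =
        pullLoc (r + 1).le_succ (Θ (r + 1)) q := by
      rw [pullLoc, pullLoc, hd r _ hq]
    rw [h2, smul_apply, smul_apply, pullLoc_apply]
    push_cast
    module

end Coordinates
end LieAlgebroid

/-! ### Derivatives in charts and bump functions -/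

/-- Derivatives of functions along tangent vectors, in a chart. -/
theorem dirDeriv_eq_fderiv {V : Type*} [NormedAddCommGroup V] [NormedSpace ℝ V] {N : Type*}
    [TopologicalSpace N] [ChartedSpace V N] [IsManifold 𝓘(ℝ, V) ∞ N] {x₀ x : N}
    (h : x ∈ (chartAt V x₀).source) {f : N → ℝ} (hf : MDifferentiableAt 𝓘(ℝ, V) 𝓘(ℝ, ℝ) f x)
    (v : TangentSpace 𝓘(ℝ, V) x) :
    dirDeriv f v = fderiv ℝ (f ∘ (chartAt V x₀).symm) (chartAt V x₀ x)
      (mfderiv 𝓘(ℝ, V) 𝓘(ℝ, V) (chartAt V x₀) x v) := by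
  have h1 : MDifferentiableAt 𝓘(ℝ, V) 𝓘(ℝ, V) (chartAt V x₀) x :=
    mdifferentiableAt_atlas (chart_mem_atlas V x₀) h
  have h2 : MDifferentiableAt 𝓘(ℝ, V) 𝓘(ℝ, V) (chartAt V x₀).symm (chartAt V x₀ x) :=
    mdifferentiableAt_atlas_symm (chart_mem_atlas V x₀) ((chartAt V x₀).map_source h)
  have h3 : MDifferentiableAt 𝓘(ℝ, V) 𝓘(ℝ, ℝ) (f ∘ (chartAt V x₀).symm) (chartAt V x₀ x) := by
    refine MDifferentiableAt.comp _ ?_ h2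
    rwa [(chartAt V x₀).left_inv h]
  have h4 : f =ᶠ[𝓝 x] (f ∘ (chartAt V x₀).symm) ∘ chartAt V x₀ := by
    filter_upwards [(chartAt V x₀).open_source.mem_nhds h] with y hy
    simp [(chartAt V x₀).left_inv hy]
  rw [dirDeriv, h4.mfderiv_eq, mfderiv_comp x h3 h1, mfderiv_eq_fderiv]
  rfl

/-- A smooth bump function around a point. -/
theorem exists_smooth_bump {B : Type*} [NormedAddCommGroup B] [NormedSpace ℝ B]
    [FiniteDimensional ℝ B] {M : Type*} [TopologicalSpace M] [T2Space M] [ChartedSpace B M]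
    [IsManifold 𝓘(ℝ, B) ∞ M] {x : M} {U : Set M} (hU : U ∈ 𝓝 x) :
    ∃ χ : M → ℝ, ContMDiff 𝓘(ℝ, B) 𝓘(ℝ, ℝ) ∞ χ ∧ tsupport χ ⊆ U ∧ χ =ᶠ[𝓝 x] 1 := by
  obtain ⟨f, -, hf⟩ := (SmoothBumpFunction.nhds_basis_tsupport (I := 𝓘(ℝ, B)) x).mem_iff.1 hU
  exact ⟨f, f.contMDiff, hf, f.eventuallyEq_one⟩

namespace LieAlgebroid

section Sections

variable {B : Type*} [NormedAddCommGroup B] [NormedSpace ℝ B] [FiniteDimensional ℝ B]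
  {M : Type*} [TopologicalSpace M] [ChartedSpace B M] [IsManifold 𝓘(ℝ, B) ∞ M]
  {F : Type*} [NormedAddCommGroup F] [NormedSpace ℝ F] [FiniteDimensional ℝ F]
  {E : M → Type*} [∀ x, AddCommGroup (E x)] [∀ x, Module ℝ (E x)]
  [∀ x, TopologicalSpace (E x)] [TopologicalSpace (TotalSpace F E)]
  [FiberBundle F E] [VectorBundle ℝ F E] [ContMDiffVectorBundle ∞ F E 𝓘(ℝ, B)]
  (L : LieAlgebroid B F E)

/-! ### Sections in a local trivialization -/

variable (F E) in
/-- The fibre coordinate in the preferred trivialization at `x₀`. -/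
noncomputable def fibCoord (x₀ x : M) : E x →ₗ[ℝ] F :=
  (trivializationAt F E x₀).linearMapAt ℝ x

variable (F E) in
/-- The vector with given fibre coordinate in the preferred trivialization at `x₀`. -/
noncomputable def fibSymm (x₀ x : M) : F →ₗ[ℝ] E x :=
  (trivializationAt F E x₀).symmₗ ℝ x

theorem fibSymm_fibCoord {x₀ x : M} (h : x ∈ chartDom B F E x₀) (b : E x) :
    fibSymm F E x₀ x (fibCoord F E x₀ x b) = b :=
  (trivializationAt F E x₀).symmₗ_linearMapAt h.2 b

theorem fibCoord_fibSymm {x₀ x : M} (h : x ∈ chartDom B F E x₀) (b : F) :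
    fibCoord F E x₀ x (fibSymm F E x₀ x b) = b :=
  (trivializationAt F E x₀).linearMapAt_symmₗ h.2 b

theorem fibCoord_apply {x₀ x : M} (h : x ∈ chartDom B F E x₀) (b : E x) :
    fibCoord F E x₀ x b = (trivializationAt F E x₀ ⟨x, b⟩).2 := by
  rw [fibCoord, Trivialization.coe_linearMapAt_of_mem _ h.2]

theorem bundleChart_mk {x₀ x : M} (h : x ∈ chartDom B F E x₀) (b : E x) :
    bundleChart B F E x₀ ⟨x, b⟩ = (chartAt B x₀ x, fibCoord F E x₀ x b) := by
  refine Prod.ext (bundleChart_fst (p := (⟨x, b⟩ : TotalSpace F E)) h) ?_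
  rw [fibCoord_apply h, bundleChart, FiberBundle.extChartAt]
  rfl

theorem localAnchor_fibCoord {x₀ x : M} (h : x ∈ chartDom B F E x₀) (b : E x) :
    localAnchor L x₀ (chartAt B x₀ x, fibCoord F E x₀ x b) =
      mfderiv 𝓘(ℝ, B) 𝓘(ℝ, B) (chartAt B x₀) x (L.anchor x b) := by
  rw [← bundleChart_mk h, localAnchor_bundleChart (p := (⟨x, b⟩ : TotalSpace F E)) h]

/-- The anchor in natural coordinates is linear on the fibres. -/
theorem isLinearMap_localAnchor {x₀ : M} {u : B} (hu : u ∈ chartRan B F E x₀) :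
    IsLinearMap ℝ (fun b : F => localAnchor L x₀ (u, b)) := by
  have hx := symm_mem_chartDom hu
  have h : ∀ b, localAnchor L x₀ (u, b) = mfderiv 𝓘(ℝ, B) 𝓘(ℝ, B) (chartAt B x₀)
      ((chartAt B x₀).symm u) (L.anchor _ (fibSymm F E x₀ ((chartAt B x₀).symm u) b)) := by
    intro b
    rw [← localAnchor_fibCoord L hx, fibCoord_fibSymm hx, (chartAt B x₀).right_inv hu.1]
  constructor
  · intro a b
    rw [h, h, h, map_add, map_add, map_add]; rfl
  · intro c b
    rw [h, h, map_smul, map_smul, map_smul]; rfl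

variable (B F) in
/-- The fibre coordinates of a section of `E`, as a function on the range of the chart. -/
noncomputable def secLoc (x₀ : M) (η : ∀ x, E x) (u : B) : F :=
  fibCoord F E x₀ ((chartAt B x₀).symm u) (η ((chartAt B x₀).symm u))

theorem secLoc_chartAt {x₀ x : M} (h : x ∈ chartDom B F E x₀) (η : ∀ x, E x) :
    secLoc B F x₀ η (chartAt B x₀ x) = fibCoord F E x₀ x (η x) := by
  rw [secLoc, (chartAt B x₀).left_inv h.1]

theorem contMDiffOn_fibCoord (x₀ : M) (η : Cₛ^∞⟮𝓘(ℝ, B); F, E⟯) :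
    ContMDiffOn 𝓘(ℝ, B) 𝓘(ℝ, F) ∞ (fun x => fibCoord F E x₀ x (η x)) (chartDom B F E x₀) := by
  have h := ((trivializationAt F E x₀).contMDiffOn_section_iff (IB := 𝓘(ℝ, B))
    (isOpen_chartDom (B := B) x₀) inter_subset_right).1 (η.contMDiff.contMDiffOn)
  exact h.congr fun x hx => fibCoord_apply hx _

theorem contMDiffOn_chart_symm_chartRan (x₀ : M) :
    ContMDiffOn 𝓘(ℝ, B) 𝓘(ℝ, B) ∞ (chartAt B x₀).symm (chartRan B F E x₀) :=
  (contMDiffOn_chart_symm (I := 𝓘(ℝ, B))).mono inter_subset_left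

theorem contDiffOn_secLoc (x₀ : M) (η : Cₛ^∞⟮𝓘(ℝ, B); F, E⟯) :
    ContDiffOn ℝ ∞ (secLoc B F x₀ η) (chartRan B F E x₀) :=
  (ContMDiffOn.comp (contMDiffOn_fibCoord x₀ η) (contMDiffOn_chart_symm_chartRan x₀)
    fun _ hu => symm_mem_chartDom hu).contDiffOn

/-- Sections of `E` with prescribed fibre coordinates, cut off by a function with support in the
domain of the trivialization. -/
theorem exists_section {x₀ : M} {χ : M → ℝ} (hχ : ContMDiff 𝓘(ℝ, B) 𝓘(ℝ, ℝ) ∞ χ)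
    (ht : tsupport χ ⊆ chartDom B F E x₀) (b : F) :
    ∃ η : Cₛ^∞⟮𝓘(ℝ, B); F, E⟯, ∀ x, η x = χ x • fibSymm F E x₀ x b := by
  have h : ContMDiffOn 𝓘(ℝ, B) (𝓘(ℝ, B).prod 𝓘(ℝ, F)) ∞
      (fun x => TotalSpace.mk' F x (fibSymm F E x₀ x b)) (chartDom B F E x₀) := by
    rw [(trivializationAt F E x₀).contMDiffOn_section_iff (isOpen_chartDom x₀)
      inter_subset_right]
    refine (contMDiffOn_const (c := b)).congr fun x hx => ?_
    rw [← fibCoord_apply hx, fibCoord_fibSymm hx]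
  exact ⟨⟨_, ContMDiffOn.smul_section_of_tsupport hχ.contMDiffOn (isOpen_chartDom x₀) ht h⟩,
    fun x => rfl⟩

/-- The product of a smooth function and a section. -/
noncomputable def smulSection {f : M → ℝ} (hf : ContMDiff 𝓘(ℝ, B) 𝓘(ℝ, ℝ) ∞ f)
    (η : Cₛ^∞⟮𝓘(ℝ, B); F, E⟯) : Cₛ^∞⟮𝓘(ℝ, B); F, E⟯ :=
  ⟨fun x => f x • η x, hf.smul_section η.contMDiff⟩

/-! ### The bracket -/

theorem bracket_sum {ι : Type*} (s : Finset ι) (σ : Cₛ^∞⟮𝓘(ℝ, B); F, E⟯)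
    (η : ι → Cₛ^∞⟮𝓘(ℝ, B); F, E⟯) :
    L.bracket σ (∑ i ∈ s, η i) = ∑ i ∈ s, L.bracket σ (η i) :=
  map_sum (AddMonoidHom.mk' (L.bracket σ) (L.bracket_add σ)) η s

theorem sum_section_apply {ι : Type*} (s : Finset ι) (η : ι → Cₛ^∞⟮𝓘(ℝ, B); F, E⟯) (x : M) :
    (∑ i ∈ s, η i) x = ∑ i ∈ s, η i x := by
  have h := map_sum (ContMDiffSection.coeAddHom 𝓘(ℝ, B) F ∞ E) η s
  refine (congrFun h x).trans ?_
  rw [Finset.sum_apply]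
  rfl

/-- Locality of the bracket. With a bump function χ supported where η vanishes, η = (1 - χ)η; in the
Leibniz rule at x one term contains η x = 0 and the other 1 - χ x = 0. -/
theorem bracket_eq_zero_of_eventuallyEq [T2Space M] {x : M} (σ η : Cₛ^∞⟮𝓘(ℝ, B); F, E⟯)
    (h : ∀ᶠ y in 𝓝 x, η y = 0) : L.bracket σ η x = 0 := by
  obtain ⟨χ, hχ, ht, h1⟩ := exists_smooth_bump (B := B) h
  have hf : ContMDiff 𝓘(ℝ, B) 𝓘(ℝ, ℝ) ∞ (fun y => 1 - χ y) := contMDiff_const.sub hχ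
  have h2 : ∀ y, η y = (1 - χ y) • η y := by
    intro y
    by_cases hy : y ∈ tsupport χ
    · have h3 : η y = 0 := ht hy
      rw [h3, smul_zero]
    · rw [image_eq_zero_of_notMem_tsupport hy, sub_zero, one_smul]
  have h4 : η x = 0 := h.self_of_nhds
  have h5 : χ x = 1 := h1.self_of_nhds
  rw [L.leibniz _ hf σ η η h2 x, h4, h5, smul_zero, sub_self, zero_smul, add_zero]

theorem bracket_congr [T2Space M] {x : M} (σ : Cₛ^∞⟮𝓘(ℝ, B); F, E⟯)
    {η η' : Cₛ^∞⟮𝓘(ℝ, B); F, E⟯} (h : ∀ᶠ y in 𝓝 x, η y = η' y) :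
    L.bracket σ η x = L.bracket σ η' x := by
  have h1 : L.bracket σ (η - η') x = 0 :=
    L.bracket_eq_zero_of_eventuallyEq σ (η - η') (h.mono fun y hy => by
      rw [ContMDiffSection.coe_sub, Pi.sub_apply, hy, sub_self])
  have h2 : η = η' + (η - η') := by abel
  rw [h2, L.bracket_add, ContMDiffSection.coe_add, Pi.add_apply, h1, add_zero]

/-- The derivative of a function along the anchor of a section. -/
noncomputable def derivAlong (σ : Cₛ^∞⟮𝓘(ℝ, B); F, E⟯) (f : M → ℝ) (x : M) : ℝ :=
  dirDeriv f (L.anchor x (σ x))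

theorem derivAlong_eq {x₀ x : M} (h : x ∈ chartDom B F E x₀) (σ : Cₛ^∞⟮𝓘(ℝ, B); F, E⟯)
    {f : M → ℝ} (hf : MDifferentiableAt 𝓘(ℝ, B) 𝓘(ℝ, ℝ) f x) :
    L.derivAlong σ f x = fderiv ℝ (f ∘ (chartAt B x₀).symm) (chartAt B x₀ x)
      (localAnchor L x₀ (chartAt B x₀ x, secLoc B F x₀ σ (chartAt B x₀ x))) := by
  rw [secLoc_chartAt h, localAnchor_fibCoord L h]
  exact dirDeriv_eq_fderiv h.1 hf _

theorem contDiffOn_localAnchor_secLoc (x₀ : M) (σ : Cₛ^∞⟮𝓘(ℝ, B); F, E⟯) :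
    ContDiffOn ℝ ∞ (fun u => localAnchor L x₀ (u, secLoc B F x₀ σ u)) (chartRan B F E x₀) :=
  (contDiffOn_localAnchor x₀).comp (contDiffOn_id.prodMk (contDiffOn_secLoc x₀ σ))
    fun _ hu => ⟨hu, mem_univ _⟩

theorem contMDiff_derivAlong (σ : Cₛ^∞⟮𝓘(ℝ, B); F, E⟯) {f : M → ℝ}
    (hf : ContMDiff 𝓘(ℝ, B) 𝓘(ℝ, ℝ) ∞ f) :
    ContMDiff 𝓘(ℝ, B) 𝓘(ℝ, ℝ) ∞ (L.derivAlong σ f) := by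
  intro x
  have h1 : ContDiffOn ℝ ∞ (f ∘ (chartAt B x).symm) (chartRan B F E x) :=
    (hf.comp_contMDiffOn (contMDiffOn_chart_symm_chartRan x)).contDiffOn
  have h2 : ContDiffOn ℝ ∞ (fun u => fderiv ℝ (f ∘ (chartAt B x).symm) u
      (localAnchor L x (u, secLoc B F x σ u))) (chartRan B F E x) :=
    (h1.fderiv_of_isOpen (isOpen_chartRan x) (by simp)).clm_apply
      (L.contDiffOn_localAnchor_secLoc x σ)
  have hx := mem_chartDom_self (B := B) (F := F) (E := E) x
  have h3 := (h2.contDiffAt ((isOpen_chartRan x).mem_nhds (chartAt_mem_chartRan hx))).contMDiffAt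
  have h4 : ContMDiffAt 𝓘(ℝ, B) 𝓘(ℝ, B) ∞ (chartAt B x) x := contMDiffAt_extChartAt
  refine (h3.comp x h4).congr_of_eventuallyEq ?_
  filter_upwards [(isOpen_chartDom x).mem_nhds hx] with y hy
  exact L.derivAlong_eq hy σ (hf.mdifferentiableAt (by simp))

theorem bracket_smulSection {f : M → ℝ} (hf : ContMDiff 𝓘(ℝ, B) 𝓘(ℝ, ℝ) ∞ f)
    (σ η : Cₛ^∞⟮𝓘(ℝ, B); F, E⟯) :
    L.bracket σ (smulSection hf η) =
      smulSection (L.contMDiff_derivAlong σ hf) η + smulSection hf (L.bracket σ η) :=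
  ContMDiffSection.ext fun x => L.leibniz f hf σ η (smulSection hf η) (fun _ => rfl) x

/-- The anchor is a morphism of Lie algebras, tested on a function. -/
theorem derivAlong_bracket {f : M → ℝ} (hf : ContMDiff 𝓘(ℝ, B) 𝓘(ℝ, ℝ) ∞ f)
    (σ η : Cₛ^∞⟮𝓘(ℝ, B); F, E⟯) {x : M} {ζ : Cₛ^∞⟮𝓘(ℝ, B); F, E⟯} (hζ : ζ x ≠ 0) :
    L.derivAlong (L.bracket σ η) f x =
      L.derivAlong σ (L.derivAlong η f) x - L.derivAlong η (L.derivAlong σ f) x := by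
  -- Jacobi for σ, η, fζ is expanded by Leibniz. The mixed first-order terms cancel in pairs, and
  -- the terms with f undifferentiated cancel by Jacobi for σ, η, ζ. A scalar multiple of ζ x
  -- remains, whose scalar is the defect of the identity.
  have h := congrArg (fun s : Cₛ^∞⟮𝓘(ℝ, B); F, E⟯ => s x) (L.jacobi σ η (smulSection hf ζ))
  have h0 := congrArg (fun s : Cₛ^∞⟮𝓘(ℝ, B); F, E⟯ => s x) (L.jacobi σ η ζ)
  simp only [bracket_smulSection, L.bracket_add, ContMDiffSection.coe_add, Pi.add_apply] at h h0
  simp only [smulSection, ContMDiffSection.coeFn_mk] at h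
  rw [h0] at h
  have h1 : (L.derivAlong (L.bracket σ η) f x - (L.derivAlong σ (L.derivAlong η f) x -
      L.derivAlong η (L.derivAlong σ f) x)) • ζ x = 0 := by
    have h2 := sub_eq_zero.2 h
    rw [← neg_eq_zero, ← h2]
    module
  exact sub_eq_zero.1 ((smul_eq_zero.1 h1).resolve_right hζ)

/-- The anchor is a morphism of Lie algebras, in natural coordinates. -/
theorem localAnchor_bracket [T2Space M] {x₀ x : M} (hx : x ∈ chartDom B F E x₀)
    (σ η : Cₛ^∞⟮𝓘(ℝ, B); F, E⟯) :
    localAnchor L x₀ (chartAt B x₀ x, secLoc B F x₀ (L.bracket σ η) (chartAt B x₀ x)) =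
      fderiv ℝ (fun u => localAnchor L x₀ (u, secLoc B F x₀ η u)) (chartAt B x₀ x)
        (localAnchor L x₀ (chartAt B x₀ x, secLoc B F x₀ σ (chartAt B x₀ x))) -
      fderiv ℝ (fun u => localAnchor L x₀ (u, secLoc B F x₀ σ u)) (chartAt B x₀ x)
        (localAnchor L x₀ (chartAt B x₀ x, secLoc B F x₀ η (chartAt B x₀ x))) := by
  have hu := chartAt_mem_chartRan hx
  -- `derivAlong_bracket` needs a section that does not vanish at x. None exists when the fibre is
  -- zero, but then the anchor vanishes.
  rcases subsingleton_or_nontrivial F with hF | hF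
  · have h0 : ∀ u ∈ chartRan B F E x₀, ∀ b : F, localAnchor L x₀ (u, b) = 0 := by
      intro u hu b
      rw [Subsingleton.elim b 0]
      exact (L.isLinearMap_localAnchor hu).map_zero
    rw [h0 _ hu, h0 _ hu, h0 _ hu, map_zero, map_zero, sub_zero]
  obtain ⟨χ, hχ, ht, h1⟩ := exists_smooth_bump (B := B) ((isOpen_chartDom (F := F) (E := E) x₀).mem_nhds hx)
  obtain ⟨b, hb⟩ := exists_ne (0 : F)
  obtain ⟨ζ, hζ⟩ := exists_section hχ ht b
  have hζx : ζ x ≠ 0 := by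
    intro h
    rw [hζ, show χ x = 1 from h1.self_of_nhds, one_smul] at h
    rw [← fibCoord_fibSymm hx b, h, map_zero] at hb
    exact hb rfl
  have hopen := isOpen_chartDom (B := B) (F := F) (E := E) x₀
  refine (SeparatingDual.eq_iff_forall_dual_eq (R := ℝ)).2 fun ℓ => ?_
  -- The test function is a linear coordinate ℓ, cut off to be globally smooth. Near x its
  -- derivative along ρ(τ) is ℓ of the coordinates of ρ(τ), so second derivatives of f along
  -- sections involve only the derivative of the anchor coordinates.
  have hf : ContMDiff 𝓘(ℝ, B) 𝓘(ℝ, ℝ) ∞ (fun y => χ y * ℓ (chartAt B x₀ y)) := by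
    refine contMDiff_of_tsupport fun y hy => ?_
    have hy' := ht (closure_mono (Function.support_mul_subset_left _ _) hy)
    have h3 : ContMDiffAt 𝓘(ℝ, B) 𝓘(ℝ, B) ∞ (chartAt B x₀) y :=
      contMDiffAt_extChartAt' (by simpa using hy'.1)
    exact hχ.contMDiffAt.mul (ℓ.contDiff.contMDiff.contMDiffAt.comp y h3)
  set f : M → ℝ := fun y => χ y * ℓ (chartAt B x₀ y)
  have key : ∀ τ : Cₛ^∞⟮𝓘(ℝ, B); F, E⟯, L.derivAlong τ f =ᶠ[𝓝 x]
      fun y => ℓ (localAnchor L x₀ (chartAt B x₀ y, secLoc B F x₀ τ (chartAt B x₀ y))) := by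
    intro τ
    filter_upwards [h1.eventually_nhds, hopen.mem_nhds hx] with y hy1 hy
    rw [L.derivAlong_eq hy τ (hf.mdifferentiableAt (by simp))]
    have h5 : f ∘ (chartAt B x₀).symm =ᶠ[𝓝 (chartAt B x₀ y)] ℓ := by
      have hc : Tendsto (chartAt B x₀).symm (𝓝 (chartAt B x₀ y)) (𝓝 y) := by
        have := (chartAt B x₀).continuousAt_symm ((chartAt B x₀).map_source hy.1)
        rwa [ContinuousAt, (chartAt B x₀).left_inv hy.1] at this
      filter_upwards [hc.eventually hy1, (chartAt B x₀).open_target.mem_nhds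
        ((chartAt B x₀).map_source hy.1)] with u hu hu'
      simp only [f, Function.comp_apply, hu, Pi.one_apply, one_mul, (chartAt B x₀).right_inv hu']
    rw [h5.fderiv_eq, ContinuousLinearMap.fderiv]
  have key2 : ∀ σ τ : Cₛ^∞⟮𝓘(ℝ, B); F, E⟯, L.derivAlong σ (L.derivAlong τ f) x =
      ℓ (fderiv ℝ (fun u => localAnchor L x₀ (u, secLoc B F x₀ τ u)) (chartAt B x₀ x)
        (localAnchor L x₀ (chartAt B x₀ x, secLoc B F x₀ σ (chartAt B x₀ x)))) := by
    intro σ τ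
    rw [L.derivAlong_eq hx σ ((L.contMDiff_derivAlong τ hf).mdifferentiableAt (by simp))]
    have hc : Tendsto (chartAt B x₀).symm (𝓝 (chartAt B x₀ x)) (𝓝 x) := by
      have := (chartAt B x₀).continuousAt_symm ((chartAt B x₀).map_source hx.1)
      rwa [ContinuousAt, (chartAt B x₀).left_inv hx.1] at this
    have h5 : L.derivAlong τ f ∘ (chartAt B x₀).symm =ᶠ[𝓝 (chartAt B x₀ x)]
        ℓ ∘ fun u => localAnchor L x₀ (u, secLoc B F x₀ τ u) := by
      filter_upwards [hc.eventually (key τ), (chartAt B x₀).open_target.mem_nhds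
        ((chartAt B x₀).map_source hx.1)] with u hu hu'
      rw [Function.comp_apply, hu, (chartAt B x₀).right_inv hu']
      rfl
    have hd : DifferentiableAt ℝ (fun u => localAnchor L x₀ (u, secLoc B F x₀ τ u))
        (chartAt B x₀ x) :=
      ((L.contDiffOn_localAnchor_secLoc x₀ τ).contDiffAt
        ((isOpen_chartRan x₀).mem_nhds hu)).differentiableAt (by simp)
    rw [h5.fderiv_eq, (ℓ.hasFDerivAt.comp _ hd.hasFDerivAt).fderiv]
    rfl
  have h6 := L.derivAlong_bracket hf σ η hζx
  rw [key2, key2, (key _).self_of_nhds] at h6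
  rw [map_sub]
  exact h6

/-! ### Structure functions -/

/-- Structure functions of `L` near `x₀`: on an open subset `dom` of the range of the natural
chart, the bracket is the commutator in coordinates plus the bilinear term `C`. -/
structure StructureFunctions (x₀ : M) where
  /-- The domain. -/
  dom : Set B
  isOpen_dom : IsOpen dom
  dom_subset : dom ⊆ chartRan B F E x₀
  mem_dom : chartAt B x₀ x₀ ∈ dom
  /-- The structure functions. -/
  C : B → F →L[ℝ] F →L[ℝ] F
  contDiffOn_C : ContDiffOn ℝ ∞ C dom
  secLoc_bracket : ∀ (σ η : Cₛ^∞⟮𝓘(ℝ, B); F, E⟯), ∀ u ∈ dom,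
    secLoc B F x₀ (L.bracket σ η) u =
      fderiv ℝ (secLoc B F x₀ η) u (localAnchor L x₀ (u, secLoc B F x₀ σ u)) -
        fderiv ℝ (secLoc B F x₀ σ) u (localAnchor L x₀ (u, secLoc B F x₀ η u)) +
        C u (secLoc B F x₀ σ u) (secLoc B F x₀ η u)

theorem bracket_skew_apply (σ η : Cₛ^∞⟮𝓘(ℝ, B); F, E⟯) (x : M) :
    L.bracket σ η x = - L.bracket η σ x := by
  rw [L.bracket_skew σ η]
  rfl

/-- The bracket with a section, given by its coefficients in a frame near a point. -/
theorem bracket_apply_of_eventuallyEq_sum [T2Space M] {ι : Type*} [Fintype ι]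
    (σ η : Cₛ^∞⟮𝓘(ℝ, B); F, E⟯) (ε : ι → Cₛ^∞⟮𝓘(ℝ, B); F, E⟯) {g : ι → M → ℝ}
    (hg : ∀ i, ContMDiff 𝓘(ℝ, B) 𝓘(ℝ, ℝ) ∞ (g i)) {x : M}
    (h : ∀ᶠ y in 𝓝 x, η y = ∑ i, g i y • ε i y) :
    L.bracket σ η x = ∑ i, (L.derivAlong σ (g i) x • ε i x + g i x • L.bracket σ (ε i) x) := by
  have h1 : ∀ᶠ y in 𝓝 x, η y = (∑ i, smulSection (hg i) (ε i)) y := by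
    filter_upwards [h] with y hy
    rw [hy, sum_section_apply]
    rfl
  rw [L.bracket_congr σ h1, L.bracket_sum, sum_section_apply]
  refine Finset.sum_congr rfl fun i _ => ?_
  rw [bracket_smulSection]
  rfl

/-- By locality and Leibniz, the bracket near x₀ is determined by the brackets of a local frame `ε
i`; the coordinates of [ε_i, ε_j] are the coefficients of `C`. As the bracket acts on global
sections, both the frame and the coefficients of a section in it are cut off by χ. -/
theorem exists_structureFunctions [T2Space M] (x₀ : M) : Nonempty (L.StructureFunctions x₀) := by
  have hopen := isOpen_chartDom (B := B) (F := F) (E := E) x₀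
  obtain ⟨χ, hχ, ht, h1⟩ := exists_smooth_bump (B := B)
    (hopen.mem_nhds (mem_chartDom_self x₀))
  let e := Module.finBasis ℝ F
  choose ε hε using fun i => exists_section (B := B) hχ ht (e i)
  -- The interior makes the identities below hold on an open set, which is what locality and
  -- differentiation require.
  let O : Set M := interior {y | χ y = 1} ∩ chartDom B F E x₀
  have hO : IsOpen O := isOpen_interior.inter hopen
  have hO1 : ∀ y ∈ O, χ y = 1 := fun y hy => interior_subset (s := {y | χ y = 1}) hy.1
  have hεO : ∀ i, ∀ y ∈ O, fibCoord F E x₀ y (ε i y) = e i := by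
    intro i y hy
    rw [hε, hO1 y hy, one_smul, fibCoord_fibSymm hy.2]
  let Ω : Set B := chartRan B F E x₀ ∩ (chartAt B x₀).symm ⁻¹' O
  have hΩ : IsOpen Ω := by
    refine ContinuousOn.isOpen_inter_preimage ?_ (isOpen_chartRan x₀) hO
    exact (chartAt B x₀).continuousOn_symm.mono inter_subset_left
  let T : Fin (Module.finrank ℝ F) → F →L[ℝ] ℝ := fun i => LinearMap.toContinuousLinearMap (e.coord i)
  have hT : ∀ b, ∑ i, T i b • e i = b := fun b => e.sum_repr b
  let g : Cₛ^∞⟮𝓘(ℝ, B); F, E⟯ → Fin (Module.finrank ℝ F) → M → ℝ :=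
    fun η i y => χ y * T i (fibCoord F E x₀ y (η y))
  have hg : ∀ η i, ContMDiff 𝓘(ℝ, B) 𝓘(ℝ, ℝ) ∞ (g η i) := by
    intro η i
    refine contMDiff_of_tsupport fun y hy => ?_
    have hy' := ht (closure_mono (Function.support_mul_subset_left _ _) hy)
    exact hχ.contMDiffAt.mul ((T i).contDiff.contMDiff.contMDiffAt.comp y
      ((contMDiffOn_fibCoord x₀ η).contMDiffAt (hopen.mem_nhds hy')))
  have hsum : ∀ η : Cₛ^∞⟮𝓘(ℝ, B); F, E⟯, ∀ y ∈ O, η y = ∑ i, g η i y • ε i y := by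
    intro η y hy
    rw [← fibSymm_fibCoord hy.2 (η y), ← fibSymm_fibCoord hy.2 (∑ i, g η i y • ε i y), map_sum]
    congr 1
    simp only [map_smul, hεO _ y hy, g, hO1 y hy, one_mul, hT]
  have hder : ∀ (σ η : Cₛ^∞⟮𝓘(ℝ, B); F, E⟯) (i), ∀ u ∈ Ω,
      L.derivAlong σ (g η i) ((chartAt B x₀).symm u) = T i (fderiv ℝ (secLoc B F x₀ η) u
        (localAnchor L x₀ (u, secLoc B F x₀ σ u))) := by
    intro σ η i u hu
    have hux : chartAt B x₀ ((chartAt B x₀).symm u) = u := (chartAt B x₀).right_inv hu.1.1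
    rw [L.derivAlong_eq hu.2.2 σ ((hg η i).mdifferentiableAt (by simp)), hux]
    have h2 : g η i ∘ (chartAt B x₀).symm =ᶠ[𝓝 u] T i ∘ secLoc B F x₀ η := by
      filter_upwards [hΩ.mem_nhds hu] with v hv
      simp only [Function.comp_apply, g, hO1 _ hv.2, one_mul, secLoc]
    have h3 : DifferentiableAt ℝ (secLoc B F x₀ η) u := ((contDiffOn_secLoc x₀ η).contDiffAt
      ((isOpen_chartRan x₀).mem_nhds hu.1)).differentiableAt (by simp)
    rw [h2.fderiv_eq, ((T i).hasFDerivAt.comp u h3.hasFDerivAt).fderiv]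
    rfl
  -- Half of the formula: only the second argument is expanded in the frame.
  have key : ∀ (σ η : Cₛ^∞⟮𝓘(ℝ, B); F, E⟯), ∀ u ∈ Ω, secLoc B F x₀ (L.bracket σ η) u =
      fderiv ℝ (secLoc B F x₀ η) u (localAnchor L x₀ (u, secLoc B F x₀ σ u)) +
        ∑ i, T i (secLoc B F x₀ η u) • secLoc B F x₀ (L.bracket σ (ε i)) u := by
    intro σ η u hu
    rw [secLoc, L.bracket_apply_of_eventuallyEq_sum σ η ε (hg η)
      (Filter.mem_of_superset (hO.mem_nhds hu.2) (hsum η)), map_sum]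
    simp only [map_add, map_smul, hεO _ _ hu.2, hder σ η _ u hu, Finset.sum_add_distrib, hT]
    simp only [g, hO1 _ hu.2, one_mul]
    rfl
  have hsec : ∀ i, ∀ u ∈ Ω, secLoc B F x₀ (ε i) u = e i := fun i u hu => hεO i _ hu.2
  refine ⟨{
    dom := Ω
    isOpen_dom := hΩ
    dom_subset := inter_subset_left
    mem_dom := ?_
    C := fun u => ∑ i, ∑ j, (T i).smulRight ((T j).smulRight
      (secLoc B F x₀ (L.bracket (ε i) (ε j)) u))
    contDiffOn_C := ?_
    secLoc_bracket := ?_ }⟩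
  · refine ⟨chartAt_mem_chartRan (mem_chartDom_self x₀), ?_⟩
    rw [mem_preimage, (chartAt B x₀).left_inv (mem_chart_source B x₀)]
    exact ⟨mem_interior_iff_mem_nhds.2 h1, mem_chartDom_self x₀⟩
  · refine contDiffOn_clm_apply.2 fun a => contDiffOn_clm_apply.2 fun b => ?_
    simp only [sum_apply, ContinuousLinearMap.smulRight_apply,
      smul_apply]
    refine ContDiffOn.sum fun i _ => ContDiffOn.sum fun j _ => ?_
    exact contDiffOn_const.smul (contDiffOn_const.smul
      ((contDiffOn_secLoc x₀ _).mono inter_subset_left))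
  · intro σ η u hu
    -- Skew-symmetry brings σ into the second slot, where `key` applies again. The frame has
    -- constant coordinates e_i, so no derivative of it appears.
    have h2 : ∀ i, secLoc B F x₀ (L.bracket σ (ε i)) u =
        - fderiv ℝ (secLoc B F x₀ σ) u (localAnchor L x₀ (u, e i)) +
          ∑ j, T j (secLoc B F x₀ σ u) • secLoc B F x₀ (L.bracket (ε j) (ε i)) u := by
      intro i
      have h3 : ∀ σ η, secLoc B F x₀ (L.bracket σ η) u = - secLoc B F x₀ (L.bracket η σ) u := by
        intro σ η
        rw [secLoc, L.bracket_skew_apply, map_neg]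
        rfl
      rw [h3, key (ε i) σ u hu, hsec i u hu, neg_add, ← Finset.sum_neg_distrib]
      congr 1
      refine Finset.sum_congr rfl fun j _ => ?_
      rw [h3 (ε i), smul_neg, neg_neg]
    rw [key σ η u hu]
    simp only [h2, smul_add, Finset.sum_add_distrib, smul_neg, Finset.sum_neg_distrib]
    have h4 : ∑ i, T i (secLoc B F x₀ η u) •
        fderiv ℝ (secLoc B F x₀ σ) u (localAnchor L x₀ (u, e i)) =
        fderiv ℝ (secLoc B F x₀ σ) u (localAnchor L x₀ (u, secLoc B F x₀ η u)) := by
      conv_rhs => rw [← hT (secLoc B F x₀ η u)]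
      let A : F →ₗ[ℝ] B := (L.isLinearMap_localAnchor hu.1).mk' _
      change ∑ i, T i (secLoc B F x₀ η u) • fderiv ℝ (secLoc B F x₀ σ) u (A (e i)) =
        fderiv ℝ (secLoc B F x₀ σ) u (A (∑ i, T i (secLoc B F x₀ η u) • e i))
      simp only [map_sum, map_smul]
    rw [h4, ← add_assoc, ← sub_eq_add_neg]
    congr 1
    simp only [sum_apply, ContinuousLinearMap.smulRight_apply,
      smul_apply, Finset.smul_sum]
    rw [Finset.sum_comm]
    refine Finset.sum_congr rfl fun i _ => Finset.sum_congr rfl fun j _ => ?_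
    rw [smul_comm]

end Sections
end LieAlgebroid

/-! ### Tangent vectors and vector fields in preferred charts -/

section Charts

variable {V : Type*} [NormedAddCommGroup V] [NormedSpace ℝ V] {N : Type*}
    [TopologicalSpace N] [ChartedSpace V N] [IsManifold 𝓘(ℝ, V) ∞ N]

/-- The trivialization of the tangent bundle at `x₀` is the derivative of the chart at `x₀`. -/
theorem trivializationAt_tangent_snd {x₀ x : N} (h : x ∈ (chartAt V x₀).source)
    (v : TangentSpace 𝓘(ℝ, V) x) :
    (trivializationAt V (TangentSpace 𝓘(ℝ, V)) x₀ ⟨x, v⟩).2 =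
      mfderiv 𝓘(ℝ, V) 𝓘(ℝ, V) (chartAt V x₀) x v := by
  have h1 := congrArg (fun T : V →L[ℝ] V => T v)
    (TangentBundle.continuousLinearMapAt_trivializationAt (I := 𝓘(ℝ, V)) h)
  have h2 : (chartAt V x₀ : N → V) = extChartAt 𝓘(ℝ, V) x₀ := by simp
  rw [h2]
  refine Eq.trans ?_ h1
  refine Eq.trans ?_ (congrFun (Trivialization.continuousLinearMapAt_apply ℝ
    (trivializationAt V (TangentSpace 𝓘(ℝ, V)) x₀) x) v).symm
  rw [Trivialization.coe_linearMapAt_of_mem _ h]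

theorem mfderiv_chart_surjective {x₀ x : N} (h : x ∈ (chartAt V x₀).source) (w : V) :
    ∃ v : TangentSpace 𝓘(ℝ, V) x, mfderiv 𝓘(ℝ, V) 𝓘(ℝ, V) (chartAt V x₀) x v = w := by
  have h2 : (chartAt V x₀ : N → V) = extChartAt 𝓘(ℝ, V) x₀ := by simp
  rw [h2]
  exact (isInvertible_mfderiv_extChartAt (I := 𝓘(ℝ, V)) (by simpa using h)).bijective.2 w

/-- A vector field is smooth if and only if its image under the derivative of a chart is. -/
theorem contMDiffOn_vectorField_iff {x₀ : N} {v : ∀ x : N, TangentSpace 𝓘(ℝ, V) x} {U : Set N}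
    (hU : U ⊆ (chartAt V x₀).source) :
    ContMDiffOn 𝓘(ℝ, V) 𝓘(ℝ, V).tangent ∞ (fun x => (⟨x, v x⟩ : TangentBundle 𝓘(ℝ, V) N)) U ↔
      ContMDiffOn 𝓘(ℝ, V) 𝓘(ℝ, V) ∞
        (fun x => (show V from mfderiv 𝓘(ℝ, V) 𝓘(ℝ, V) (chartAt V x₀) x (v x))) U := by
  have h1 : MapsTo (fun x => (⟨x, v x⟩ : TangentBundle 𝓘(ℝ, V) N)) U
      (trivializationAt V (TangentSpace 𝓘(ℝ, V)) x₀).source := by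
    intro x hx
    rw [Trivialization.mem_source]
    exact hU hx
  refine ((trivializationAt V (TangentSpace 𝓘(ℝ, V)) x₀).contMDiffOn_iff h1).trans ?_
  constructor
  · intro h
    exact h.2.congr fun x hx => (trivializationAt_tangent_snd (hU hx) (v x)).symm
  · intro h
    exact ⟨contMDiffOn_id, h.congr fun x hx => trivializationAt_tangent_snd (hU hx) (v x)⟩

end Charts

namespace LieAlgebroid

section TangentCoordinates

variable {B : Type*} [NormedAddCommGroup B] [NormedSpace ℝ B] [FiniteDimensional ℝ B]
  {M : Type*} [TopologicalSpace M] [ChartedSpace B M] [IsManifold 𝓘(ℝ, B) ∞ M]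
  {F : Type*} [NormedAddCommGroup F] [NormedSpace ℝ F] [FiniteDimensional ℝ F]
  {E : M → Type*} [∀ x, AddCommGroup (E x)] [∀ x, Module ℝ (E x)]
  [∀ x, TopologicalSpace (E x)] [TopologicalSpace (TotalSpace F E)]
  [FiberBundle F E] [VectorBundle ℝ F E] [ContMDiffVectorBundle ∞ F E 𝓘(ℝ, B)]
  (L : LieAlgebroid B F E)

/-! ### Natural coordinates on `𝒯^E E^k` -/

/-- Preferred charts of `E^k` are indexed by points of `E^k`, natural coordinates by points of `M`.
A jet A₀ over x₀ identifies `Jet.coord k x₀` with the preferred chart at A₀, so general results on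
charts apply to it. -/
theorem exists_jet_base (k : ℕ) (x₀ : M) : ∃ A : L.Jet k, A.base = x₀ := by
  obtain ⟨A, hA, hA'⟩ := (L.bijOn_coord' k x₀).surjOn
    (show (chartAt B x₀ x₀, (0 : Fin k → F)) ∈ chartRan B F E x₀ ×ˢ univ from
      ⟨chartAt_mem_chartRan (mem_chartDom_self x₀), mem_univ _⟩)
  exact ⟨A, (chartAt B x₀).injOn hA.1 (mem_chart_source B x₀) (congrArg Prod.fst hA')⟩

variable {L}

theorem isOpen_base_mem_chartDom (k : ℕ) (x₀ : M) :
    IsOpen {A : L.Jet k | A.base ∈ chartDom B F E x₀} := by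
  obtain ⟨A₀, rfl⟩ := L.exists_jet_base k x₀
  exact (chartAt (B × (Fin k → F)) A₀).open_source

theorem contMDiffOn_coord (k : ℕ) (x₀ : M) :
    ContMDiffOn 𝓘(ℝ, B × (Fin k → F)) 𝓘(ℝ, B × (Fin k → F)) ∞
      (Jet.coord k x₀ : L.Jet k → _) {A : L.Jet k | A.base ∈ chartDom B F E x₀} := by
  obtain ⟨A₀, rfl⟩ := L.exists_jet_base k x₀
  exact contMDiffOn_chart (I := 𝓘(ℝ, B × (Fin k → F))) (x := A₀)

theorem mdifferentiableAt_coord {k : ℕ} {x₀ : M} {A : L.Jet k}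
    (h : A.base ∈ chartDom B F E x₀) :
    MDifferentiableAt 𝓘(ℝ, B × (Fin k → F)) 𝓘(ℝ, B × (Fin k → F))
      (Jet.coord k x₀ : L.Jet k → _) A :=
  ((contMDiffOn_coord k x₀).contMDiffAt
    ((isOpen_base_mem_chartDom k x₀).mem_nhds h)).mdifferentiableAt (by simp)

/-- The coordinates of a tangent vector to `E^k`. -/
noncomputable def velCoord {k : ℕ} (x₀ : M) (A : L.Jet k) :
    TangentSpace 𝓘(ℝ, B × (Fin k → F)) A →L[ℝ] (B × (Fin k → F)) :=
  mfderiv 𝓘(ℝ, B × (Fin k → F)) 𝓘(ℝ, B × (Fin k → F)) (Jet.coord k x₀ : L.Jet k → _) A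

theorem velCoord_injective {k : ℕ} {x₀ : M} {A : L.Jet k} (h : A.base ∈ chartDom B F E x₀) :
    Function.Injective (velCoord x₀ A) := by
  obtain ⟨A₀, rfl⟩ := L.exists_jet_base k x₀
  intro v w hvw
  exact mfderiv_chart_injective (x₀ := A₀) h hvw

theorem velCoord_surjective {k : ℕ} {x₀ : M} {A : L.Jet k} (h : A.base ∈ chartDom B F E x₀) :
    Function.Surjective (velCoord x₀ A) := by
  obtain ⟨A₀, rfl⟩ := L.exists_jet_base k x₀
  intro w
  exact mfderiv_chart_surjective (x₀ := A₀) h w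

theorem velCoord_fst {k : ℕ} {x₀ : M} {A : L.Jet k} (h : A.base ∈ chartDom B F E x₀)
    (v : TangentSpace 𝓘(ℝ, B × (Fin k → F)) A) :
    (velCoord x₀ A v).1 = mfderiv 𝓘(ℝ, B) 𝓘(ℝ, B) (chartAt B x₀) A.base
      (mfderiv 𝓘(ℝ, B × (Fin k → F)) 𝓘(ℝ, B) (Jet.base : L.Jet k → M) A v) := by
  have h1 : HasMFDerivAt 𝓘(ℝ, B) 𝓘(ℝ, B) (chartAt B x₀) A.base _ :=
    (mdifferentiableAt_atlas (chart_mem_atlas B x₀) h.1).hasMFDerivAt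
  have h2 := h1.comp A (((L.contMDiff_base k).mdifferentiableAt (x := A)
    (by simp)).hasMFDerivAt)
  have h3 : HasMFDerivAt 𝓘(ℝ, B × (Fin k → F)) 𝓘(ℝ, B)
      (Prod.fst : B × (Fin k → F) → B) (A.coord k x₀) (ContinuousLinearMap.fst ℝ B (Fin k → F)) :=
    (ContinuousLinearMap.fst ℝ B (Fin k → F)).hasMFDerivAt
  have h4 := h3.comp A (mdifferentiableAt_coord h).hasMFDerivAt
  have h5 := h4.mfderiv.symm.trans h2.mfderiv
  exact congrArg (fun T : TangentSpace 𝓘(ℝ, B × (Fin k → F)) A →L[ℝ] B => T v) h5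

/-- The derivative of the chart of `M` is injective, so the condition ρ(b) = Tπ(v) can be tested in
coordinates. It says that the base component of v is a function of b; this is why (b; w) suffice as
fibre coordinates. -/
theorem mem_ETangent_iff_velCoord {k : ℕ} {x₀ : M} {A : L.Jet k}
    (h : A.base ∈ chartDom B F E x₀)
    (z : E A.base × TangentSpace 𝓘(ℝ, B × (Fin k → F)) A) :
    z ∈ L.ETangent k A ↔ (velCoord x₀ A z.2).1 =
      localAnchor L x₀ (chartAt B x₀ A.base, fibCoord F E x₀ A.base z.1) := by
  rw [mem_ETangent, localAnchor_fibCoord L h, velCoord_fst h]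
  exact ⟨fun h1 => by rw [h1], fun h1 => (mfderiv_chart_injective h.1 h1).symm⟩

/-- The coordinates `(b; w)` of an element of `𝒯^E E^k`. -/
noncomputable def ETangent.coord {k : ℕ} (x₀ : M) (A : L.Jet k) :
    L.ETangent k A →ₗ[ℝ] F × (Fin k → F) :=
  ((fibCoord F E x₀ A.base ∘ₗ LinearMap.fst ℝ _ _).prod
    (LinearMap.snd ℝ B (Fin k → F) ∘ₗ (velCoord x₀ A).toLinearMap ∘ₗ LinearMap.snd ℝ _ _)) ∘ₗ
    (L.ETangent k A).subtype

theorem ETangent.coord_apply {k : ℕ} (x₀ : M) {A : L.Jet k} (z : L.ETangent k A) :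
    ETangent.coord x₀ A z = (fibCoord F E x₀ A.base z.1.1, (velCoord x₀ A z.1.2).2) := rfl

/-- The coordinates of the vector part of an element of `𝒯^E E^k`. -/
theorem velCoord_eq {k : ℕ} {x₀ : M} {A : L.Jet k} (h : A.base ∈ chartDom B F E x₀)
    (z : L.ETangent k A) :
    velCoord x₀ A z.1.2 = (localAnchor L x₀ ((A.coord k x₀).1, (ETangent.coord x₀ A z).1),
      (ETangent.coord x₀ A z).2) :=
  Prod.ext ((mem_ETangent_iff_velCoord h z.1).1 z.2) rfl

theorem ETangent.coord_bijective {k : ℕ} {x₀ : M} {A : L.Jet k}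
    (h : A.base ∈ chartDom B F E x₀) : Function.Bijective (ETangent.coord x₀ A) := by
  constructor
  · refine (injective_iff_map_eq_zero _).2 fun z hz => ?_
    have h1 : fibCoord F E x₀ A.base z.1.1 = 0 := congrArg Prod.fst hz
    have h2 : velCoord x₀ A z.1.2 = 0 := by
      rw [velCoord_eq h, hz]
      exact Prod.ext (L.isLinearMap_localAnchor (chartAt_mem_chartRan h)).map_zero rfl
    have h3 : z.1.1 = 0 := by rw [← fibSymm_fibCoord h z.1.1, h1, map_zero]
    have h4 : z.1.2 = 0 := velCoord_injective h (h2.trans (map_zero _).symm)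
    exact Subtype.ext (Prod.ext h3 h4)
  · rintro ⟨b, w⟩
    obtain ⟨v, hv⟩ := velCoord_surjective h (localAnchor L x₀ (chartAt B x₀ A.base, b), w)
    have hb := fibCoord_fibSymm h b
    refine ⟨⟨(fibSymm F E x₀ A.base b, v), ?_⟩, ?_⟩
    · rw [mem_ETangent_iff_velCoord h, hv, hb]
    · exact Prod.ext hb (congrArg (Prod.snd (α := B)) hv)

/-- The fibres of `𝒯^E E^k` in coordinates. -/
noncomputable def ETangent.coordEquiv {k : ℕ} {x₀ : M} {A : L.Jet k}
    (h : A.base ∈ chartDom B F E x₀) : L.ETangent k A ≃ₗ[ℝ] F × (Fin k → F) :=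
  LinearEquiv.ofBijective (ETangent.coord x₀ A) (ETangent.coord_bijective h)

open Classical in
/-- The element of `𝒯^E E^k` with given coordinates (zero outside of the domain of the chart). -/
noncomputable def ETangent.ofCoord {k : ℕ} (x₀ : M) (A : L.Jet k) (z : F × (Fin k → F)) :
    L.ETangent k A :=
  if h : A.base ∈ chartDom B F E x₀ then (ETangent.coordEquiv h).symm z else 0

theorem ETangent.coord_ofCoord {k : ℕ} {x₀ : M} {A : L.Jet k}
    (h : A.base ∈ chartDom B F E x₀) (z : F × (Fin k → F)) :
    ETangent.coord x₀ A (ETangent.ofCoord x₀ A z) = z := by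
  rw [ETangent.ofCoord, dif_pos h]
  exact (ETangent.coordEquiv h).apply_symm_apply z

theorem ETangent.ofCoord_coord {k : ℕ} {x₀ : M} {A : L.Jet k}
    (h : A.base ∈ chartDom B F E x₀) (z : L.ETangent k A) :
    ETangent.ofCoord x₀ A (ETangent.coord x₀ A z) = z := by
  rw [ETangent.ofCoord, dif_pos h]
  exact (ETangent.coordEquiv h).symm_apply_apply z

theorem ETangent.coord_map {k l : ℕ} (hl : l ≤ k) {x₀ : M} {A : L.Jet k}
    (h : A.base ∈ chartDom B F E x₀) (z : L.ETangent k A) :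
    ETangent.coord x₀ (A.truncate hl) (ETangent.map hl z) =
      truncL F F hl (ETangent.coord x₀ A z) := by
  have h1 : HasMFDerivAt 𝓘(ℝ, B × (Fin l → F)) 𝓘(ℝ, B × (Fin l → F))
      (Jet.coord l x₀ : L.Jet l → _) (A.truncate hl) (velCoord x₀ (A.truncate hl)) :=
    (mdifferentiableAt_coord (A := A.truncate hl) h).hasMFDerivAt
  have h2 := h1.comp A (((L.contMDiff_truncate hl).mdifferentiableAt (x := A)
    (by simp)).hasMFDerivAt)
  have h3 : HasMFDerivAt 𝓘(ℝ, B × (Fin k → F)) 𝓘(ℝ, B × (Fin l → F))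
      (truncL F B hl) (A.coord k x₀) (truncL F B hl) := (truncL F B hl).hasMFDerivAt
  have h4 := h3.comp A (mdifferentiableAt_coord h).hasMFDerivAt
  have h5 : Jet.coord l x₀ ∘ Jet.truncate hl =ᶠ[𝓝 A] truncL F B hl ∘ Jet.coord k x₀ := by
    filter_upwards [(isOpen_base_mem_chartDom k x₀).mem_nhds h] with A' hA'
    exact L.coord_truncate hl hA'
  have h6 := (h4.congr_of_eventuallyEq h5).mfderiv.symm.trans h2.mfderiv
  have h7 := congrArg (fun T : TangentSpace 𝓘(ℝ, B × (Fin k → F)) A →L[ℝ]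
    B × (Fin l → F) => (T z.1.2).2) h6
  exact Prod.ext rfl h7.symm

/-! ### Smooth sections in coordinates -/

/-- Smooth local sections of `𝒯^E E^k` have smooth coordinates, and conversely. -/
theorem contMDiffOn_coord_iff {k : ℕ} {x₀ : M} {U : Set (L.Jet k)}
    (hU : U ⊆ {A : L.Jet k | A.base ∈ chartDom B F E x₀}) (Z : ∀ A, L.ETangent k A) :
    (ContMDiffOn 𝓘(ℝ, B × (Fin k → F)) (𝓘(ℝ, B).prod 𝓘(ℝ, F)) ∞
      (fun A => (⟨A.base, (Z A).1.1⟩ : TotalSpace F E)) U ∧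
    ContMDiffOn 𝓘(ℝ, B × (Fin k → F)) 𝓘(ℝ, B × (Fin k → F)).tangent ∞
      (fun A => (⟨A, (Z A).1.2⟩ : TangentBundle 𝓘(ℝ, B × (Fin k → F)) (L.Jet k))) U) ↔
    ContMDiffOn 𝓘(ℝ, B × (Fin k → F)) 𝓘(ℝ, F × (Fin k → F)) ∞
      (fun A => ETangent.coord x₀ A (Z A)) U := by
  have h1 : MapsTo (fun A : L.Jet k => (⟨A.base, (Z A).1.1⟩ : TotalSpace F E)) U
      (trivializationAt F E x₀).source := by
    intro A hA
    rw [Trivialization.mem_source]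
    exact (hU hA).2
  have h2 : ContMDiffOn 𝓘(ℝ, B × (Fin k → F)) 𝓘(ℝ, F) ∞
      (fun A => (trivializationAt F E x₀ ⟨A.base, (Z A).1.1⟩).2) U ↔
      ContMDiffOn 𝓘(ℝ, B × (Fin k → F)) 𝓘(ℝ, F) ∞ (fun A => (ETangent.coord x₀ A (Z A)).1) U :=
    contMDiffOn_congr fun A hA => (fibCoord_apply (hU hA) _).symm
  have h3 : ContMDiffOn 𝓘(ℝ, B × (Fin k → F)) 𝓘(ℝ, B × (Fin k → F)).tangent ∞
      (fun A => (⟨A, (Z A).1.2⟩ : TangentBundle 𝓘(ℝ, B × (Fin k → F)) (L.Jet k))) U ↔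
      ContMDiffOn 𝓘(ℝ, B × (Fin k → F)) 𝓘(ℝ, B × (Fin k → F)) ∞
        (fun A => velCoord x₀ A (Z A).1.2) U := by
    obtain ⟨A₀, rfl⟩ := L.exists_jet_base k x₀
    exact contMDiffOn_vectorField_iff (x₀ := A₀) hU
  rw [(trivializationAt F E x₀).contMDiffOn_iff h1, h3]
  have h4 : ContMDiffOn 𝓘(ℝ, B × (Fin k → F)) 𝓘(ℝ, B) ∞ (fun A : L.Jet k => A.base) U :=
    (L.contMDiff_base k).contMDiffOn
  constructor
  · rintro ⟨⟨-, h5⟩, h6⟩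
    exact (h2.1 h5).prodMk_space (contDiff_snd.contMDiff.comp_contMDiffOn h6)
  · intro h5
    have h6 : ContMDiffOn 𝓘(ℝ, B × (Fin k → F)) 𝓘(ℝ, F) ∞
        (fun A => (ETangent.coord x₀ A (Z A)).1) U :=
      contDiff_fst.contMDiff.comp_contMDiffOn h5
    have h7 : ContMDiffOn 𝓘(ℝ, B × (Fin k → F)) 𝓘(ℝ, Fin k → F) ∞
        (fun A => (ETangent.coord x₀ A (Z A)).2) U :=
      contDiff_snd.contMDiff.comp_contMDiffOn h5
    refine ⟨⟨h4, h2.2 h6⟩, ?_⟩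
    have h8 : ContMDiffOn 𝓘(ℝ, B × (Fin k → F)) 𝓘(ℝ, B) ∞
        (fun A : L.Jet k => (A.coord k x₀).1) U :=
      contDiff_fst.contMDiff.comp_contMDiffOn ((contMDiffOn_coord k x₀).mono hU)
    -- The base component of the vector part is not among the coordinates; its smoothness is
    -- recovered from that of b through the anchor.
    have h9 : ContMDiffOn 𝓘(ℝ, B × (Fin k → F)) 𝓘(ℝ, B) ∞ (fun A : L.Jet k =>
        localAnchor L x₀ ((A.coord k x₀).1, (ETangent.coord x₀ A (Z A)).1)) U := by
      refine (contDiffOn_localAnchor (L := L) x₀).contMDiffOn.comp (h8.prodMk_space h6) ?_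
      exact fun A hA => ⟨chartAt_mem_chartRan (hU hA), mem_univ _⟩
    exact (h9.prodMk_space h7).congr fun A hA => velCoord_eq (hU hA) (Z A)

/-- The form `lam` is given by `Λ` in the natural coordinates at `x₀`, over `Ω`. -/
structure IsCoordForm {k : ℕ} (lam : L.Form k) (x₀ : M) (Ω : Set B)
    (Λ : B × (Fin k → F) → (F × (Fin k → F)) →L[ℝ] ℝ) : Prop where
  contDiffOn : ContDiffOn ℝ ∞ Λ (Ω ×ˢ univ)
  apply_eq : ∀ A : L.Jet k, A.base ∈ chartDom B F E x₀ → chartAt B x₀ A.base ∈ Ω →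
    ∀ z, lam A z = Λ (A.coord k x₀) (ETangent.coord x₀ A z)

/-- The sections with constant coordinates are the smooth local frames on which forms are tested. -/
theorem contMDiffOn_ofCoord {k : ℕ} (x₀ : M) (z : F × (Fin k → F)) :
    ContMDiffOn 𝓘(ℝ, B × (Fin k → F)) 𝓘(ℝ, F × (Fin k → F)) ∞
      (fun A : L.Jet k => ETangent.coord x₀ A (ETangent.ofCoord x₀ A z))
      {A : L.Jet k | A.base ∈ chartDom B F E x₀} :=
  (contMDiffOn_const (c := z)).congr fun _ hA => ETangent.coord_ofCoord hA z

theorem contMDiffOn_jetChart_symm (k : ℕ) (x₀ : M) :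
    ContMDiffOn 𝓘(ℝ, B × (Fin k → F)) 𝓘(ℝ, B × (Fin k → F)) ∞
      (L.jetChart k x₀).symm (chartRan B F E x₀ ×ˢ univ) := by
  obtain ⟨A₀, rfl⟩ := L.exists_jet_base k x₀
  exact contMDiffOn_chart_symm (I := 𝓘(ℝ, B × (Fin k → F))) (x := A₀)

theorem jetChart_symm_mem {k : ℕ} {x₀ : M} {q : B × (Fin k → F)}
    (hq : q.1 ∈ chartRan B F E x₀) :
    ((L.jetChart k x₀).symm q).base ∈ chartDom B F E x₀ :=
  (L.jetChart k x₀).map_target (x := q) ⟨hq, mem_univ _⟩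

theorem coord_jetChart_symm {k : ℕ} {x₀ : M} {q : B × (Fin k → F)}
    (hq : q.1 ∈ chartRan B F E x₀) : ((L.jetChart k x₀).symm q).coord k x₀ = q :=
  (L.jetChart k x₀).right_inv (x := q) ⟨hq, mem_univ _⟩

theorem jetChart_symm_coord {k : ℕ} {x₀ : M} {A : L.Jet k} (h : A.base ∈ chartDom B F E x₀) :
    (L.jetChart k x₀).symm (A.coord k x₀) = A :=
  (L.jetChart k x₀).left_inv h

/-- A section of `(𝒯^E E^k)*` in coordinates. -/
theorem IsSection.exists_isCoordForm {k : ℕ} {lam : L.Form k} (h : L.IsSection lam) (x₀ : M)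
    {Ω : Set B} (hΩ : Ω ⊆ chartRan B F E x₀) :
    ∃ Λ, IsCoordForm lam x₀ Ω Λ := by
  -- Λ has to be a linear map at every q, also off the chart range; if the jet obtained there lies
  -- outside the chart domain, `ofCoord` has the default value 0.
  have hlin : ∀ q : B × (Fin k → F), IsLinearMap ℝ fun z : F × (Fin k → F) =>
      lam ((L.jetChart k x₀).symm q) (ETangent.ofCoord x₀ _ z) := by
    intro q
    by_cases hq : ((L.jetChart k x₀).symm q).base ∈ chartDom B F E x₀
    · have h1 : ∀ z, ETangent.ofCoord x₀ ((L.jetChart k x₀).symm q) z =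
          (ETangent.coordEquiv hq).symm z := fun z => by rw [ETangent.ofCoord, dif_pos hq]
      simp only [h1]
      exact (((h.1 _).mk' _).comp (ETangent.coordEquiv hq).symm.toLinearMap).isLinear
    · have h1 : ∀ z, ETangent.ofCoord x₀ ((L.jetChart k x₀).symm q) z = 0 :=
        fun z => by rw [ETangent.ofCoord, dif_neg hq]
      simp only [h1, (h.1 _).map_zero]
      exact (0 : F × (Fin k → F) →ₗ[ℝ] ℝ).isLinear
  refine ⟨fun q => LinearMap.toContinuousLinearMap ((hlin q).mk' _), ?_, ?_⟩
  · refine contDiffOn_clm_apply.2 fun z => ?_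
    have h1 := (contMDiffOn_coord_iff subset_rfl (fun A : L.Jet k => ETangent.ofCoord x₀ A z)).2
      (contMDiffOn_ofCoord x₀ z)
    have h2 := h.2 _ _ (isOpen_base_mem_chartDom k x₀) h1.1 h1.2
    have h3 := h2.comp (contMDiffOn_jetChart_symm k x₀) fun q hq => jetChart_symm_mem hq.1
    exact h3.contDiffOn.mono (prod_mono hΩ subset_rfl)
  · intro A hA _ z
    change lam A z = lam _ _
    rw [jetChart_symm_coord hA, ETangent.ofCoord_coord hA]

/-- A form which is smooth in coordinates near every point is a section of `(𝒯^E E^k)*`. -/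
theorem isSection_of_isCoordForm {k : ℕ} {lam : L.Form k}
    (h : ∀ x₀ : M, ∃ Ω Λ, IsOpen Ω ∧ chartAt B x₀ x₀ ∈ Ω ∧ IsCoordForm lam x₀ Ω Λ) :
    L.IsSection lam := by
  constructor
  · intro A
    obtain ⟨Ω, Λ, -, hx, hΛ⟩ := h A.base
    have h1 := hΛ.apply_eq A (mem_chartDom_self _) hx
    have h2 : lam A = fun z => Λ (A.coord k A.base) (ETangent.coord A.base A z) := funext h1
    rw [h2]
    exact ((Λ (A.coord k A.base)).toLinearMap ∘ₗ ETangent.coord A.base A).isLinear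
  · intro U Z hU hZ1 hZ2 A hA
    obtain ⟨Ω, Λ, hΩ, hx, hΛ⟩ := h A.base
    set D : Set (L.Jet k) := {A' | A'.base ∈ chartDom B F E A.base}
    have hD : IsOpen D := isOpen_base_mem_chartDom k A.base
    have hAD : A ∈ D := mem_chartDom_self A.base
    have h1 := ((contMDiffOn_coord_iff (x₀ := A.base) (U := U ∩ D) inter_subset_right Z).1
      ⟨hZ1.mono inter_subset_left, hZ2.mono inter_subset_left⟩).contMDiffAt
      ((hU.inter hD).mem_nhds ⟨hA, hAD⟩)
    have h2 : ContMDiffAt 𝓘(ℝ, B × (Fin k → F)) 𝓘(ℝ, B × (Fin k → F)) ∞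
        (Jet.coord k A.base : L.Jet k → _) A := (contMDiffOn_coord k A.base).contMDiffAt
      (hD.mem_nhds hAD)
    have h3 : ContDiffAt ℝ ∞ Λ (A.coord k A.base) :=
      hΛ.contDiffOn.contDiffAt ((hΩ.prod isOpen_univ).mem_nhds ⟨hx, mem_univ _⟩)
    have h4 : ContMDiffAt 𝓘(ℝ, B × (Fin k → F)) 𝓘(ℝ, ℝ) ∞
        (fun A' : L.Jet k => Λ (A'.coord k A.base) (ETangent.coord A.base A' (Z A'))) A :=
      (h3.contMDiffAt.comp A h2).clm_apply h1
    refine (h4.congr_of_eventuallyEq ?_).contMDiffWithinAt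
    have h5 : ∀ᶠ A' : L.Jet k in 𝓝 A, (A'.coord k A.base).1 ∈ Ω :=
      (continuous_fst.continuousAt.comp h2.continuousAt).eventually (hΩ.mem_nhds hx)
    filter_upwards [hD.mem_nhds hAD, h5] with A' hA' hA''
    exact hΛ.apply_eq A' hA' hA'' _

end TangentCoordinates
end LieAlgebroid

/-- The Lie bracket of vector fields in a chart. -/
theorem mfderiv_chart_mlieBracket {V : Type*} [NormedAddCommGroup V] [NormedSpace ℝ V]
    [CompleteSpace V] {N : Type*} [TopologicalSpace N] [ChartedSpace V N]
    [IsManifold 𝓘(ℝ, V) ∞ N] {x₀ x : N} (h : x ∈ (chartAt V x₀).source)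
    {v w : ∀ x : N, TangentSpace 𝓘(ℝ, V) x}
    (hv : ContMDiff 𝓘(ℝ, V) 𝓘(ℝ, V).tangent ∞ (fun x => (⟨x, v x⟩ : TangentBundle 𝓘(ℝ, V) N)))
    (hw : ContMDiff 𝓘(ℝ, V) 𝓘(ℝ, V).tangent ∞
      (fun x => (⟨x, w x⟩ : TangentBundle 𝓘(ℝ, V) N))) {v' w' : V → V}
    (hv' : ∀ u ∈ (chartAt V x₀).target, mfderiv 𝓘(ℝ, V) 𝓘(ℝ, V) (chartAt V x₀)
      ((chartAt V x₀).symm u) (v ((chartAt V x₀).symm u)) = v' u)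
    (hw' : ∀ u ∈ (chartAt V x₀).target, mfderiv 𝓘(ℝ, V) 𝓘(ℝ, V) (chartAt V x₀)
      ((chartAt V x₀).symm u) (w ((chartAt V x₀).symm u)) = w' u) :
    mfderiv 𝓘(ℝ, V) 𝓘(ℝ, V) (chartAt V x₀) x (VectorField.mlieBracket 𝓘(ℝ, V) v w x) =
      VectorField.lieBracket ℝ v' w' (chartAt V x₀ x) := by
  have : IsManifold 𝓘(ℝ, V) (minSmoothness ℝ 2) N := by
    rw [minSmoothness_of_isRCLikeNormedField]
    exact IsManifold.of_le (n := ∞) (WithTop.coe_le_coe.2 le_top)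
  obtain ⟨u, hu, rfl⟩ : ∃ u ∈ (chartAt V x₀).target, (chartAt V x₀).symm u = x :=
    ⟨_, (chartAt V x₀).map_source h, (chartAt V x₀).left_inv h⟩
  rw [(chartAt V x₀).right_inv hu]
  have he : (chartAt V x₀).MDifferentiable 𝓘(ℝ, V) 𝓘(ℝ, V) :=
    mdifferentiable_of_mem_atlas (chart_mem_atlas V x₀)
  have hinv : ∀ u ∈ (chartAt V x₀).target,
      (mfderiv 𝓘(ℝ, V) 𝓘(ℝ, V) (chartAt V x₀).symm u).inverse =
        mfderiv 𝓘(ℝ, V) 𝓘(ℝ, V) (chartAt V x₀) ((chartAt V x₀).symm u) := by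
    intro u hu
    have h1 := he.symm_comp_deriv ((chartAt V x₀).map_target hu)
    rw [(chartAt V x₀).right_inv hu] at h1
    exact ContinuousLinearMap.inverse_eq h1 (he.comp_symm_deriv hu)
  have hev : ∀ (v : ∀ x : N, TangentSpace 𝓘(ℝ, V) x) (v' : V → V),
      (∀ u ∈ (chartAt V x₀).target, mfderiv 𝓘(ℝ, V) 𝓘(ℝ, V) (chartAt V x₀)
        ((chartAt V x₀).symm u) (v ((chartAt V x₀).symm u)) = v' u) →
      VectorField.mpullback 𝓘(ℝ, V) 𝓘(ℝ, V) (chartAt V x₀).symm v =ᶠ[𝓝 u] v' := by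
    intro v v' hv
    filter_upwards [(chartAt V x₀).open_target.mem_nhds hu] with y hy
    rw [VectorField.mpullback_apply, hinv y hy]
    exact hv y hy
  have hf : ContMDiffAt 𝓘(ℝ, V) 𝓘(ℝ, V) ∞ (chartAt V x₀).symm u :=
    (contMDiffOn_chart_symm (I := 𝓘(ℝ, V))).contMDiffAt
      ((chartAt V x₀).open_target.mem_nhds hu)
  -- The bracket is natural under pullback by the inverse chart, and that pullback applies the
  -- derivative of the chart, so v and w become v' and w'.
  have h1 := VectorField.mpullback_mlieBracket (I := 𝓘(ℝ, V)) (I' := 𝓘(ℝ, V))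
    (f := (chartAt V x₀).symm) (x₀ := u) (V := v) (W := w) (n := ∞)
    (hv.mdifferentiableAt (by simp)) (hw.mdifferentiableAt (by simp)) hf
    (by rw [minSmoothness_of_isRCLikeNormedField]; exact WithTop.coe_le_coe.2 le_top)
  rw [VectorField.mpullback_apply, hinv u hu] at h1
  refine h1.trans (((hev v v' hv').mlieBracket_vectorField_eq (hev w w' hw')).trans ?_)
  have h2 := congrFun (VectorField.mlieBracketWithin_eq_lieBracketWithin (𝕜 := ℝ) (V := v') (W := w')
    (s := univ)) u
  rwa [VectorField.lieBracketWithin_univ] at h2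

namespace LieAlgebroid

section Differential

variable {B : Type*} [NormedAddCommGroup B] [NormedSpace ℝ B] [FiniteDimensional ℝ B]
  {M : Type*} [TopologicalSpace M] [ChartedSpace B M] [IsManifold 𝓘(ℝ, B) ∞ M]
  {F : Type*} [NormedAddCommGroup F] [NormedSpace ℝ F] [FiniteDimensional ℝ F]
  {E : M → Type*} [∀ x, AddCommGroup (E x)] [∀ x, Module ℝ (E x)]
  [∀ x, TopologicalSpace (E x)] [TopologicalSpace (TotalSpace F E)]
  [FiberBundle F E] [VectorBundle ℝ F E] [ContMDiffVectorBundle ∞ F E 𝓘(ℝ, B)]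
  {L : LieAlgebroid B F E}

/-! ### The canonical section `𝐓` in coordinates -/

theorem ETangent.coord_cast {k : ℕ} {x₀ : M} {A A' : L.Jet k} (p : A = A')
    (z : L.ETangent k A) :
    ETangent.coord x₀ A' (p ▸ z : L.ETangent k A') = ETangent.coord x₀ A z := by
  subst p; rfl

theorem velCoord_cast {k : ℕ} {x₀ : M} {A A' : L.Jet k} (p : A = A')
    (v : TangentSpace 𝓘(ℝ, B × (Fin k → F)) A) :
    velCoord x₀ A' (p ▸ v : TangentSpace 𝓘(ℝ, B × (Fin k → F)) A') = velCoord x₀ A v := by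
  subst p; rfl

theorem fibCoord_initial {x x₀ : M} (hx : x ∈ chartDom B F E x₀) (a : L.AdmissibleCurve x) :
    fibCoord F E x₀ x a.initial = (bundleChart B F E x₀ (a.toFun 0)).2 := by
  obtain ⟨f, rfl, h⟩ := a
  exact (congrArg Prod.snd (bundleChart_mk hx (f 0).snd)).symm

/-- In coordinates the prolongation is the curve of successive derivatives of the fibre coordinate,
so its velocity contains the derivatives of one order higher. -/
theorem velCoord_velocity_snd {x x₀ : M} (hx : x ∈ chartDom B F E x₀)
    (a : L.AdmissibleCurve x) (k : ℕ) (j : Fin k) :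
    (velCoord x₀ (a.toJet k) (a.velocity k)).2 j =
      iteratedDeriv (j + 1) (fun t : ℝ => (bundleChart B F E x₀ (a.toFun t)).2) 0 := by
  rw [AdmissibleCurve.velocity, velCoord_cast]
  have hb : (a.prolong k 0).base ∈ chartDom B F E x₀ := by rw [L.prolong_zero]; exact hx
  have h1 : HasMFDerivAt 𝓘(ℝ, B × (Fin k → F)) 𝓘(ℝ, B × (Fin k → F))
      (Jet.coord k x₀ : L.Jet k → _) (a.prolong k 0) (velCoord x₀ (a.prolong k 0)) :=
    (mdifferentiableAt_coord hb).hasMFDerivAt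
  have h2 := h1.comp (0 : ℝ)
    ((L.contMDiffAt_prolong a k).mdifferentiableAt (by simp)).hasMFDerivAt
  obtain ⟨T, hT⟩ : ∃ T : ℝ →L[ℝ] B × (Fin k → F), T = (velCoord x₀ (a.prolong k 0)).comp
    (mfderiv 𝓘(ℝ, ℝ) 𝓘(ℝ, B × (Fin k → F)) (a.prolong k) 0) := ⟨_, rfl⟩
  have h3 : HasFDerivAt (Jet.coord k x₀ ∘ a.prolong k) T 0 := by
    rw [hT]; exact hasMFDerivAt_iff_hasFDerivAt.1 h2
  have h4 := (L.eventually_prolong hx a k).mono fun t ht => ht.2.2.2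
  have h5 := (h3.congr_of_eventuallyEq (h4.mono fun t ht => ht.symm)).hasDerivAt
  have h6 : HasDerivAt (fun t => iteratedDeriv j
      (fun t : ℝ => (bundleChart B F E x₀ (a.toFun t)).2) t) ((T 1).2 j) 0 :=
    hasDerivAt_pi.1 ((ContinuousLinearMap.snd ℝ B (Fin k → F)).hasFDerivAt.comp_hasDerivAt 0 h5) j
  rw [iteratedDeriv_succ, h6.deriv, hT]
  rfl

/-- 𝐓 has as fibre coordinates the jet coordinates themselves, shifted: (y₀; y₁, …, y_k). Both
`sectionT` and `Jet.coord` use the representative `A.jet.out`, so the components match directly. -/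
theorem coord_sectionT {k : ℕ} {x₀ : M} {A : L.Jet (k + 1)} (h : A.base ∈ chartDom B F E x₀) :
    ETangent.coord x₀ (A.truncate k.le_succ) (L.sectionT k A) =
      shiftL F B k (A.coord (k + 1) x₀) := by
  rw [sectionT, ETangent.coord_cast]
  refine Prod.ext ?_ (funext fun j => velCoord_velocity_snd h A.jet.out k j)
  exact fibCoord_initial h A.jet.out

/-! ### The exterior differential in coordinates -/

/-- Derivatives of functions on `E^k` in natural coordinates. -/
theorem dirDeriv_of_coord {k : ℕ} {x₀ : M} {A : L.Jet k} (h : A.base ∈ chartDom B F E x₀)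
    {f : L.Jet k → ℝ} {Φ : B × (Fin k → F) → ℝ} (hf : f =ᶠ[𝓝 A] Φ ∘ Jet.coord k x₀)
    (hΦ : DifferentiableAt ℝ Φ (A.coord k x₀))
    (v : TangentSpace 𝓘(ℝ, B × (Fin k → F)) A) :
    dirDeriv f v = fderiv ℝ Φ (A.coord k x₀) (velCoord x₀ A v) := by
  rw [dirDeriv, hf.mfderiv_eq, mfderiv_comp A hΦ.mdifferentiableAt (mdifferentiableAt_coord h),
    mfderiv_eq_fderiv]
  rfl

theorem eventually_coord_mem {k : ℕ} {x₀ : M} {Ω : Set B} (hΩ : IsOpen Ω) {A : L.Jet k}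
    (h : A.base ∈ chartDom B F E x₀) (hu : chartAt B x₀ A.base ∈ Ω) :
    ∀ᶠ A' : L.Jet k in 𝓝 A, A'.base ∈ chartDom B F E x₀ ∧ chartAt B x₀ A'.base ∈ Ω := by
  have h1 := (isOpen_base_mem_chartDom (L := L) k x₀).mem_nhds h
  have h2 := ((contMDiffOn_coord k x₀).contMDiffAt h1).continuousAt
  filter_upwards [h1, (continuous_fst.continuousAt.comp h2).eventually (hΩ.mem_nhds hu)]
    with A' h3 h4 using ⟨h3, h4⟩

/-! ### Projectable sections and their bracket in coordinates -/

/-- The coordinates of a projectable section. -/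
noncomputable def ProjectableSection.coord {k : ℕ} (x₀ : M) (X : L.ProjectableSection k)
    (q : B × (Fin k → F)) : F × (Fin k → F) :=
  ETangent.coord x₀ ((L.jetChart k x₀).symm q) (X.eval ((L.jetChart k x₀).symm q))

theorem ProjectableSection.coord_coord {k : ℕ} {x₀ : M} (X : L.ProjectableSection k)
    {A : L.Jet k} (h : A.base ∈ chartDom B F E x₀) :
    X.coord x₀ (A.coord k x₀) = ETangent.coord x₀ A (X.eval A) := by
  rw [ProjectableSection.coord, jetChart_symm_coord h]

theorem ProjectableSection.contDiffOn_coord {k : ℕ} (x₀ : M) (X : L.ProjectableSection k) :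
    ContDiffOn ℝ ∞ (X.coord x₀) (chartRan B F E x₀ ×ˢ univ) := by
  have h1 := (contMDiffOn_coord_iff (x₀ := x₀) subset_rfl X.eval).1
    ⟨(X.sec.contMDiff.comp (L.contMDiff_base k)).contMDiffOn, X.contMDiff_vf.contMDiffOn⟩
  exact (h1.comp (contMDiffOn_jetChart_symm k x₀) fun q hq => jetChart_symm_mem hq.1).contDiffOn

theorem ProjectableSection.coord_fst {k : ℕ} {x₀ : M} (X : L.ProjectableSection k)
    {q : B × (Fin k → F)} (hq : q.1 ∈ chartRan B F E x₀) :
    (X.coord x₀ q).1 = secLoc B F x₀ X.sec q.1 := by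
  have h1 := jetChart_symm_base L hq
  rw [secLoc, ← h1]
  rfl

/-- Projectability: the b-coordinate depends on the base point only, so its derivative does not see
the jet directions. -/
theorem ProjectableSection.fderiv_coord_fst {k : ℕ} {x₀ : M} (X : L.ProjectableSection k)
    {q : B × (Fin k → F)} (hq : q.1 ∈ chartRan B F E x₀) (v : B × (Fin k → F)) :
    (fderiv ℝ (X.coord x₀) q v).1 = fderiv ℝ (secLoc B F x₀ X.sec) q.1 v.1 := by
  have hopen := (isOpen_chartRan (B := B) (F := F) (E := E) x₀)
  have hn : chartRan B F E x₀ ×ˢ univ ∈ 𝓝 q :=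
    (hopen.prod isOpen_univ).mem_nhds ⟨hq, mem_univ _⟩
  have h1 : DifferentiableAt ℝ (X.coord x₀) q :=
    ((X.contDiffOn_coord x₀).contDiffAt hn).differentiableAt (by simp)
  have h2 : DifferentiableAt ℝ (secLoc B F x₀ X.sec) q.1 :=
    ((contDiffOn_secLoc x₀ X.sec).contDiffAt (hopen.mem_nhds hq)).differentiableAt (by simp)
  have h3 := ((ContinuousLinearMap.fst ℝ F (Fin k → F)).hasFDerivAt.comp q h1.hasFDerivAt)
  have h4 := h2.hasFDerivAt.comp q (ContinuousLinearMap.fst ℝ B (Fin k → F)).hasFDerivAt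
  have h5 : (ContinuousLinearMap.fst ℝ F (Fin k → F)) ∘ X.coord x₀ =ᶠ[𝓝 q]
      secLoc B F x₀ X.sec ∘ ContinuousLinearMap.fst ℝ B (Fin k → F) := by
    filter_upwards [hn] with q' hq' using X.coord_fst hq'.1
  exact congrArg (fun T : B × (Fin k → F) →L[ℝ] F => T v)
    (h3.unique (h4.congr_of_eventuallyEq h5))

/-- The vector field of a projectable section in coordinates. -/
theorem ProjectableSection.velCoord_vf {k : ℕ} {x₀ : M} (X : L.ProjectableSection k)
    {q : B × (Fin k → F)} (hq : q.1 ∈ chartRan B F E x₀) :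
    velCoord x₀ ((L.jetChart k x₀).symm q) (X.vf ((L.jetChart k x₀).symm q)) =
      (localAnchor L x₀ (q.1, secLoc B F x₀ X.sec q.1), (X.coord x₀ q).2) := by
  refine (velCoord_eq (jetChart_symm_mem hq) (X.eval _)).trans ?_
  rw [coord_jetChart_symm hq, ← X.coord_fst hq]
  rfl

/-- The Lie bracket of vector fields is computed in the chart. Each field has base part the anchor
of its section of E and fibre part the w-coordinates, and its derivative splits accordingly. -/
theorem ProjectableSection.velCoord_bracket {k : ℕ} {x₀ : M} (X Y : L.ProjectableSection k)
    {A : L.Jet k} (h : A.base ∈ chartDom B F E x₀) :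
    velCoord x₀ A (X.bracket Y A).2 =
      (fderiv ℝ (fun u => localAnchor L x₀ (u, secLoc B F x₀ Y.sec u)) (A.coord k x₀).1
          (velCoord x₀ A (X.vf A)).1 -
        fderiv ℝ (fun u => localAnchor L x₀ (u, secLoc B F x₀ X.sec u)) (A.coord k x₀).1
          (velCoord x₀ A (Y.vf A)).1,
      (fderiv ℝ (Y.coord x₀) (A.coord k x₀) (velCoord x₀ A (X.vf A)) -
        fderiv ℝ (X.coord x₀) (A.coord k x₀) (velCoord x₀ A (Y.vf A))).2) := by
  have hu : (A.coord k x₀).1 ∈ chartRan B F E x₀ := chartAt_mem_chartRan h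
  have hopen := (isOpen_chartRan (B := B) (F := F) (E := E) x₀)
  have hn : chartRan B F E x₀ ×ˢ univ ∈ 𝓝 (A.coord k x₀) :=
    (hopen.prod isOpen_univ).mem_nhds ⟨hu, mem_univ _⟩
  have h1 : velCoord x₀ A (X.bracket Y A).2 = VectorField.lieBracket ℝ
      (fun q => velCoord x₀ ((L.jetChart k x₀).symm q) (X.vf ((L.jetChart k x₀).symm q)))
      (fun q => velCoord x₀ ((L.jetChart k x₀).symm q) (Y.vf ((L.jetChart k x₀).symm q)))
      (A.coord k x₀) := by
    have := FiniteDimensional.complete ℝ (B × (Fin k → F))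
    obtain ⟨A₀, rfl⟩ := L.exists_jet_base k x₀
    exact mfderiv_chart_mlieBracket (x₀ := A₀) h X.contMDiff_vf Y.contMDiff_vf
      (fun _ _ => rfl) (fun _ _ => rfl)
  have h2 : ∀ X : L.ProjectableSection k, HasFDerivAt
      (fun q => velCoord x₀ ((L.jetChart k x₀).symm q) (X.vf ((L.jetChart k x₀).symm q)))
      (((fderiv ℝ (fun u => localAnchor L x₀ (u, secLoc B F x₀ X.sec u)) (A.coord k x₀).1).comp
        (ContinuousLinearMap.fst ℝ B (Fin k → F))).prod
        ((ContinuousLinearMap.snd ℝ F (Fin k → F)).comp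
          (fderiv ℝ (X.coord x₀) (A.coord k x₀)))) (A.coord k x₀) := by
    intro X
    have h3 : DifferentiableAt ℝ (fun u => localAnchor L x₀ (u, secLoc B F x₀ X.sec u))
        (A.coord k x₀).1 := ((L.contDiffOn_localAnchor_secLoc x₀ X.sec).contDiffAt
      (hopen.mem_nhds hu)).differentiableAt (by simp)
    have h4 : DifferentiableAt ℝ (X.coord x₀) (A.coord k x₀) :=
      ((X.contDiffOn_coord x₀).contDiffAt hn).differentiableAt (by simp)
    have h5 := (h3.hasFDerivAt.comp _
      (ContinuousLinearMap.fst ℝ B (Fin k → F)).hasFDerivAt).prodMk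
      ((ContinuousLinearMap.snd ℝ F (Fin k → F)).hasFDerivAt.comp _ h4.hasFDerivAt)
    refine h5.congr_of_eventuallyEq ?_
    filter_upwards [hn] with q hq using X.velCoord_vf hq.1
  rw [h1, VectorField.lieBracket, (h2 X).fderiv, (h2 Y).fderiv, jetChart_symm_coord h]
  rfl

/-- This is where the compatibility of the anchor with brackets enters. It ensures that
`Form.onPair` never takes its default value on such a bracket. -/
theorem ProjectableSection.bracket_mem [T2Space M] {k : ℕ} (X Y : L.ProjectableSection k)
    (A : L.Jet k) : X.bracket Y A ∈ L.ETangent k A := by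
  have h : A.base ∈ chartDom B F E A.base := mem_chartDom_self _
  have h1 : ∀ X : L.ProjectableSection k, (velCoord A.base A (X.vf A)).1 =
      localAnchor L A.base (chartAt B A.base A.base, secLoc B F A.base X.sec
        (chartAt B A.base A.base)) := by
    intro X
    rw [secLoc_chartAt h]
    exact (mem_ETangent_iff_velCoord h _).1 (X.mem A)
  rw [mem_ETangent_iff_velCoord h, X.velCoord_bracket Y h, h1, h1]
  have h2 := L.localAnchor_bracket h X.sec Y.sec
  rw [secLoc_chartAt h] at h2
  exact h2.symm

/-- The b-part is the bracket in E, which contributes C; the w-part is a bracket of vector fields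
and has no structure term. -/
theorem ProjectableSection.coord_bracket [T2Space M] {k : ℕ} {x₀ : M}
    (S : L.StructureFunctions x₀) (X Y : L.ProjectableSection k) {A : L.Jet k}
    (h : A.base ∈ chartDom B F E x₀) (hA : chartAt B x₀ A.base ∈ S.dom) :
    ETangent.coord x₀ A ⟨X.bracket Y A, X.bracket_mem Y A⟩ =
      fderiv ℝ (Y.coord x₀) (A.coord k x₀) (velCoord x₀ A (X.vf A)) -
        fderiv ℝ (X.coord x₀) (A.coord k x₀) (velCoord x₀ A (Y.vf A)) +
        (S.C (A.coord k x₀).1 (ETangent.coord x₀ A (X.eval A)).1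
          (ETangent.coord x₀ A (Y.eval A)).1, 0) := by
  have hu : (A.coord k x₀).1 ∈ chartRan B F E x₀ := chartAt_mem_chartRan h
  have h1 : ∀ X : L.ProjectableSection k, (velCoord x₀ A (X.vf A)).1 =
      localAnchor L x₀ (chartAt B x₀ A.base, secLoc B F x₀ X.sec (chartAt B x₀ A.base)) := by
    intro X
    rw [secLoc_chartAt h]
    exact (mem_ETangent_iff_velCoord h _).1 (X.mem A)
  have h2 : ∀ X : L.ProjectableSection k, (ETangent.coord x₀ A (X.eval A)).1 =
      secLoc B F x₀ X.sec (chartAt B x₀ A.base) := by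
    intro X
    rw [secLoc_chartAt h]
    rfl
  refine Prod.ext ?_ ?_
  · rw [Prod.fst_add, Prod.fst_sub, X.fderiv_coord_fst hu, Y.fderiv_coord_fst hu, h1, h1, h2, h2]
    refine Eq.trans ?_ (S.secLoc_bracket X.sec Y.sec _ hA)
    exact (secLoc_chartAt h _).symm
  · rw [ETangent.coord_apply, Prod.snd_add, X.velCoord_bracket Y h, add_zero]

theorem dirDeriv_apply_eval {k : ℕ} {x₀ : M} {Ω : Set B} (hΩ : IsOpen Ω)
    {lam : L.Form k} {Λ : B × (Fin k → F) → (F × (Fin k → F)) →L[ℝ] ℝ}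
    (hΛ : IsCoordForm lam x₀ Ω Λ) (Y : L.ProjectableSection k) {A : L.Jet k}
    (h : A.base ∈ chartDom B F E x₀) (hA : chartAt B x₀ A.base ∈ Ω)
    (v : TangentSpace 𝓘(ℝ, B × (Fin k → F)) A) :
    dirDeriv (fun P => lam P (Y.eval P)) v =
      fderiv ℝ Λ (A.coord k x₀) (velCoord x₀ A v) (ETangent.coord x₀ A (Y.eval A)) +
        Λ (A.coord k x₀) (fderiv ℝ (Y.coord x₀) (A.coord k x₀) (velCoord x₀ A v)) := by
  have hu : (A.coord k x₀).1 ∈ chartRan B F E x₀ := chartAt_mem_chartRan h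
  have h1 : DifferentiableAt ℝ (Y.coord x₀) (A.coord k x₀) :=
    ((Y.contDiffOn_coord x₀).contDiffAt (((isOpen_chartRan x₀).prod isOpen_univ).mem_nhds
      ⟨hu, mem_univ _⟩)).differentiableAt (by simp)
  have h2 : DifferentiableAt ℝ Λ (A.coord k x₀) :=
    (hΛ.contDiffOn.contDiffAt ((hΩ.prod isOpen_univ).mem_nhds
      ⟨hA, mem_univ _⟩)).differentiableAt (by simp)
  rw [dirDeriv_of_coord (Φ := fun q => Λ q (Y.coord x₀ q)) h ?_ (h2.clm_apply h1),
    (h2.hasFDerivAt.clm_apply h1.hasFDerivAt).fderiv, Y.coord_coord h]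
  · exact add_comm _ _
  · filter_upwards [eventually_coord_mem hΩ h hA] with A' hA'
    rw [hΛ.apply_eq A' hA'.1 hA'.2, Function.comp_apply, Y.coord_coord hA'.1]

/-- The derivatives of the coordinates of X and Y given by the product rule cancel those in the
bracket. What remains depends only on the values of X and Y at A, so the choice made in `extDeriv`
is immaterial. -/
theorem koszul_eq [T2Space M] {k : ℕ} {x₀ : M} (S : L.StructureFunctions x₀)
    {lam : L.Form k} {Λ : B × (Fin k → F) → (F × (Fin k → F)) →L[ℝ] ℝ}
    (hΛ : IsCoordForm lam x₀ S.dom Λ) (X Y : L.ProjectableSection k) {A : L.Jet k}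
    (h : A.base ∈ chartDom B F E x₀) (hA : chartAt B x₀ A.base ∈ S.dom) :
    L.koszul lam X Y A =
      fderiv ℝ Λ (A.coord k x₀) (velCoord x₀ A (X.vf A)) (ETangent.coord x₀ A (Y.eval A)) -
      fderiv ℝ Λ (A.coord k x₀) (velCoord x₀ A (Y.vf A)) (ETangent.coord x₀ A (X.eval A)) -
      Λ (A.coord k x₀) (S.C (A.coord k x₀).1 (ETangent.coord x₀ A (X.eval A)).1
        (ETangent.coord x₀ A (Y.eval A)).1, 0) := by
  rw [koszul, dirDeriv_apply_eval S.isOpen_dom hΛ Y h hA,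
    dirDeriv_apply_eval S.isOpen_dom hΛ X h hA, Form.onPair, dif_pos (X.bracket_mem Y A),
    hΛ.apply_eq A h hA, X.coord_bracket S Y h hA, map_add, map_sub]
  ring

/-- Every element of `𝒯^E E^k` is the value of a projectable section. -/
theorem exists_projectableSection [T2Space M] {k : ℕ} {A : L.Jet k} (z : L.ETangent k A) :
    ∃ X : L.ProjectableSection k, X.eval A = z := by
  have hA : A.base ∈ chartDom B F E A.base := mem_chartDom_self _
  obtain ⟨χ, hχ, ht, h1⟩ := exists_smooth_bump (B := B)
    ((isOpen_chartDom (F := F) (E := E) A.base).mem_nhds hA)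
  have h1' : χ A.base = 1 := h1.self_of_nhds
  set c := ETangent.coord A.base A z
  obtain ⟨η, hη⟩ := exists_section (B := B) hχ ht c.1
  have hsm := ((contMDiffOn_coord_iff (L := L) (k := k) (x₀ := A.base) subset_rfl _).2
    (contMDiffOn_ofCoord A.base c)).2
  have hχ' : ContMDiff 𝓘(ℝ, B × (Fin k → F)) 𝓘(ℝ, ℝ) ∞ (fun A' : L.Jet k => χ A'.base) :=
    hχ.comp (L.contMDiff_base k)
  have ht' : tsupport (fun A' : L.Jet k => χ A'.base) ⊆
      {A' | A'.base ∈ chartDom B F E A.base} :=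
    (tsupport_comp_subset_preimage χ (L.contMDiff_base k).continuous).trans (preimage_mono ht)
  -- The candidate is the section with constant coordinates c multiplied by the cut-off pulled back
  -- from M. The b-coordinate is constant and χ descends to M, so the E-part is the pullback of a
  -- section of E; outside the chart both sides vanish with χ.
  have hmem : ∀ A' : L.Jet k, (η A'.base, χ A'.base • (ETangent.ofCoord A.base A' c).1.2) =
      χ A'.base • (ETangent.ofCoord A.base A' c).1 := by
    intro A'
    rw [hη]
    refine Prod.ext ?_ rfl
    by_cases hA' : A'.base ∈ chartDom B F E A.base
    · have h2 := congrArg Prod.fst (ETangent.coord_ofCoord hA' c)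
      have h3 : fibCoord F E A.base A'.base (ETangent.ofCoord A.base A' c).1.1 = c.1 := h2
      rw [← h3, fibSymm_fibCoord hA']
      rfl
    · have h2 : χ A'.base = 0 := image_eq_zero_of_notMem_tsupport fun h => hA' (ht h)
      rw [h2, zero_smul, zero_smul, zero_smul]
      rfl
  refine ⟨⟨η, fun A' => χ A'.base • (ETangent.ofCoord A.base A' c).1.2, ?_, ?_⟩, ?_⟩
  · exact ContMDiffOn.smul_section_of_tsupport hχ'.contMDiffOn
      (isOpen_base_mem_chartDom k A.base) ht' hsm
  · intro A'
    rw [hmem A']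
    exact (L.ETangent k A').smul_mem _ (ETangent.ofCoord A.base A' c).2
  · refine Subtype.ext ((hmem A).trans ?_)
    rw [h1', one_smul, ETangent.ofCoord_coord hA]

/-- The exterior differential in coordinates. -/
theorem extDeriv_eq [T2Space M] {k : ℕ} {x₀ : M} (S : L.StructureFunctions x₀)
    {lam : L.Form k} {Λ : B × (Fin k → F) → (F × (Fin k → F)) →L[ℝ] ℝ}
    (hΛ : IsCoordForm lam x₀ S.dom Λ) {A : L.Jet k} (h : A.base ∈ chartDom B F E x₀)
    (hA : chartAt B x₀ A.base ∈ S.dom) (z w : L.ETangent k A) :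
    L.extDeriv lam A z w =
      fderiv ℝ Λ (A.coord k x₀) (velCoord x₀ A z.1.2) (ETangent.coord x₀ A w) -
      fderiv ℝ Λ (A.coord k x₀) (velCoord x₀ A w.1.2) (ETangent.coord x₀ A z) -
      Λ (A.coord k x₀) (S.C (A.coord k x₀).1 (ETangent.coord x₀ A z).1
        (ETangent.coord x₀ A w).1, 0) := by
  -- This excludes the default value 0 of `extDeriv`.
  have hex : ∃ p : L.ProjectableSection k × L.ProjectableSection k,
      p.1.eval A = z ∧ p.2.eval A = w := by
    obtain ⟨X, hX⟩ := exists_projectableSection z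
    obtain ⟨Y, hY⟩ := exists_projectableSection w
    exact ⟨(X, Y), hX, hY⟩
  rw [extDeriv, dif_pos hex, koszul_eq S hΛ _ _ h hA]
  obtain ⟨h1, h2⟩ := hex.choose_spec
  set X := hex.choose.1
  set Y := hex.choose.2
  rw [← h1, ← h2]
  rfl

/-- The total derivative in coordinates. -/
theorem IsCoordForm.dT [T2Space M] {k : ℕ} {x₀ : M} (S : L.StructureFunctions x₀)
    {lam : L.Form k} {Λ : B × (Fin k → F) → (F × (Fin k → F)) →L[ℝ] ℝ}
    (hΛ : IsCoordForm lam x₀ S.dom Λ) :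
    IsCoordForm (L.dT lam) x₀ S.dom (dTloc (localAnchor L x₀) S.C Λ) := by
  refine ⟨contDiffOn_dTloc S.isOpen_dom ((contDiffOn_localAnchor x₀).mono
    (prod_mono S.dom_subset subset_rfl)) S.contDiffOn_C hΛ.contDiffOn, fun A h hA z => ?_⟩
  have h1 : (A.truncate k.le_succ).coord k x₀ = truncL F B k.le_succ (A.coord (k + 1) x₀) :=
    L.coord_truncate k.le_succ h
  have h2 : DifferentiableAt ℝ Λ (truncL F B k.le_succ (A.coord (k + 1) x₀)) :=
    (hΛ.contDiffOn.contDiffAt ((S.isOpen_dom.prod isOpen_univ).mem_nhds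
      ⟨hA, mem_univ _⟩)).differentiableAt (by simp)
  have h3 : HasFDerivAt (fun q => Λ (truncL F B k.le_succ q) (shiftL F B k q)) _
      (A.coord (k + 1) x₀) := (h2.hasFDerivAt.comp (A.coord (k + 1) x₀)
    (truncL F B k.le_succ).hasFDerivAt).clm_apply (shiftL F B k).hasFDerivAt
  have h4 : L.contractT lam =ᶠ[𝓝 A] (fun q => Λ (truncL F B k.le_succ q) (shiftL F B k q)) ∘
      Jet.coord (k + 1) x₀ := by
    filter_upwards [eventually_coord_mem S.isOpen_dom h hA] with A' hA'
    rw [contractT, hΛ.apply_eq (A'.truncate k.le_succ) hA'.1 hA'.2, coord_sectionT hA'.1,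
      L.coord_truncate k.le_succ hA'.1]
    rfl
  -- The vector part of 𝐓 is the velocity of the jet; its base component ρ(y₀) comes from the anchor
  -- condition.
  have h5 : velCoord x₀ (A.truncate k.le_succ) (L.sectionT k A).1.2 =
      totVel (localAnchor L x₀) (A.coord (k + 1) x₀) := by
    rw [velCoord_eq (A := A.truncate k.le_succ) h, coord_sectionT h, h1]
    rfl
  have h6 : velCoord x₀ (A.truncate k.le_succ) (ETangent.map k.le_succ z).1.2 =
      truncL F B k.le_succ (velCoord x₀ A z.1.2) := by
    rw [velCoord_eq (A := A.truncate k.le_succ) h, ETangent.coord_map k.le_succ h, h1,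
      velCoord_eq h]
    rfl
  have h7 : shiftL F B k (velCoord x₀ A z.1.2) = shiftL F F k (ETangent.coord x₀ A z) := by
    rw [velCoord_eq h]
    rfl
  -- Both d(i_𝐓 lam) and i_𝐓 d lam contain the derivative of Λ along the truncation of z evaluated
  -- on 𝐓, with opposite signs. After this cancellation the three terms of `dTloc` are left.
  rw [LieAlgebroid.dT, dirDeriv_of_coord h h4 h3.differentiableAt, h3.fderiv,
    extDeriv_eq (A := A.truncate k.le_succ) S hΛ h hA, h5, h6, coord_sectionT h,
    ETangent.coord_map k.le_succ h, h1, dTloc_apply]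
  simp only [add_apply, ContinuousLinearMap.comp_apply,
    ContinuousLinearMap.flip_apply, h7, Function.comp_apply]
  simp only [truncL_apply, shiftL_apply]
  ring

end Differential
end LieAlgebroid

namespace LieAlgebroid

section Vertical

variable {B : Type*} [NormedAddCommGroup B] [NormedSpace ℝ B] [FiniteDimensional ℝ B]
  {M : Type*} [TopologicalSpace M] [ChartedSpace B M] [IsManifold 𝓘(ℝ, B) ∞ M]
  {F : Type*} [NormedAddCommGroup F] [NormedSpace ℝ F] [FiniteDimensional ℝ F]
  {E : M → Type*} [∀ x, AddCommGroup (E x)] [∀ x, Module ℝ (E x)]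
  [∀ x, TopologicalSpace (E x)] [TopologicalSpace (TotalSpace F E)]
  [FiberBundle F E] [VectorBundle ℝ F E] [ContMDiffVectorBundle ∞ F E 𝓘(ℝ, B)]
  {L : LieAlgebroid B F E}

/-! ### Operations on forms in coordinates -/

theorem IsCoordForm.congr {k : ℕ} {x₀ : M} {Ω : Set B} {lam : L.Form k}
    {Λ Λ' : B × (Fin k → F) → (F × (Fin k → F)) →L[ℝ] ℝ} (hΛ : IsCoordForm lam x₀ Ω Λ)
    (h : EqOn Λ' Λ (Ω ×ˢ univ)) : IsCoordForm lam x₀ Ω Λ' :=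
  ⟨hΛ.contDiffOn.congr h, fun A hA hA' z => by
    rw [hΛ.apply_eq A hA hA', h (show A.coord k x₀ ∈ Ω ×ˢ univ from ⟨hA', mem_univ _⟩)]⟩

theorem IsCoordForm.pull {k l : ℕ} (hl : l ≤ k) {x₀ : M} {Ω : Set B} {lam : L.Form l}
    {Λ : B × (Fin l → F) → (F × (Fin l → F)) →L[ℝ] ℝ} (hΛ : IsCoordForm lam x₀ Ω Λ) :
    IsCoordForm (L.pull hl lam) x₀ Ω (pullLoc hl Λ) := by
  refine ⟨contDiffOn_pullLoc hl hΛ.contDiffOn, fun A hA hA' z => ?_⟩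
  rw [LieAlgebroid.pull, hΛ.apply_eq (A.truncate hl) hA hA', L.coord_truncate hl hA,
    ETangent.coord_map hl hA]
  rfl

theorem isSection_basicForm (θ : DualSection (B := B) (F := F) (E := E)) :
    L.IsSection (L.basicForm θ) :=
  ⟨fun A => ⟨fun z w => map_add (θ.toFun A.base) z.1.1 w.1.1,
    fun c z => map_smul (θ.toFun A.base) c z.1.1⟩,
    fun _ _ _ h _ => θ.contMDiff.comp_contMDiffOn h⟩

namespace StructureFunctions

variable {x₀ : M} (S : L.StructureFunctions x₀)

theorem contDiffOn_localAnchor : ContDiffOn ℝ ∞ (localAnchor L x₀) (S.dom ×ˢ univ) :=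
  (LieAlgebroid.contDiffOn_localAnchor x₀).mono (prod_mono S.dom_subset subset_rfl)

theorem prod_mem_nhds {k : ℕ} {q : B × (Fin k → F)} (hq : q.1 ∈ S.dom) :
    S.dom ×ˢ (univ : Set (Fin k → F)) ∈ 𝓝 q :=
  (S.isOpen_dom.prod isOpen_univ).mem_nhds ⟨hq, mem_univ _⟩

/-- Structure functions on a smaller domain. -/
def restrict {Ω : Set B} (hΩ : IsOpen Ω) (h : chartAt B x₀ x₀ ∈ Ω) :
    L.StructureFunctions x₀ where
  dom := S.dom ∩ Ω
  isOpen_dom := S.isOpen_dom.inter hΩ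
  dom_subset := inter_subset_left.trans S.dom_subset
  mem_dom := ⟨S.mem_dom, h⟩
  C := S.C
  contDiffOn_C := S.contDiffOn_C.mono inter_subset_left
  secLoc_bracket σ η u hu := S.secLoc_bracket σ η u hu.1

end StructureFunctions

theorem isSection_dT [T2Space M] {k : ℕ} {lam : L.Form k} (h : L.IsSection lam) :
    L.IsSection (L.dT lam) := by
  refine isSection_of_isCoordForm fun x₀ => ?_
  obtain ⟨S⟩ := L.exists_structureFunctions x₀
  obtain ⟨Λ, hΛ⟩ := h.exists_isCoordForm x₀ S.dom_subset
  exact ⟨S.dom, _, S.isOpen_dom, S.mem_dom, hΛ.dT S⟩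

/-- The forms `d_𝐓^r θ` in coordinates. -/
theorem exists_isCoordForm_iterDT [T2Space M] {x₀ : M} (S : L.StructureFunctions x₀)
    (θ : DualSection (B := B) (F := F) (E := E)) :
    ∃ Θ : ∀ r : ℕ, B × (Fin r → F) → (F × (Fin r → F)) →L[ℝ] ℝ,
      (∀ r, IsCoordForm (L.iterDT θ r) x₀ S.dom (Θ r)) ∧
      ∀ r, Θ (r + 1) = dTloc (localAnchor L x₀) S.C (Θ r) := by
  obtain ⟨Λ, hΛ⟩ := (isSection_basicForm (L := L) θ).exists_isCoordForm x₀ S.dom_subset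
  refine ⟨fun r => Nat.rec Λ (fun _ Θ => dTloc (localAnchor L x₀) S.C Θ) r, fun r => ?_,
    fun r => rfl⟩
  induction r with
  | zero => exact hΛ
  | succ r ih => exact ih.dT S

/-! ### Separation of points by the forms `d_𝐓^r θ` -/

theorem contMDiffOn_fibCoord_totalSpace (x₀ : M) :
    ContMDiffOn (𝓘(ℝ, B).prod 𝓘(ℝ, F)) 𝓘(ℝ, F) ∞
      (fun p : TotalSpace F E => fibCoord F E x₀ p.1 p.2)
      (TotalSpace.proj ⁻¹' chartDom B F E x₀) := by
  have h1 : ContMDiffOn (𝓘(ℝ, B).prod 𝓘(ℝ, F)) 𝓘(ℝ, B × F) ∞ (bundleChart B F E x₀)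
      (TotalSpace.proj ⁻¹' chartDom B F E x₀) := by
    intro p hp
    exact (contMDiffAt_extChartAt' (by
      rw [← bundleChart_source, bundleChart, extChartAt_source] at hp
      exact hp)).contMDiffWithinAt
  refine (contDiff_snd.contMDiff.comp_contMDiffOn h1).congr fun p hp => ?_
  exact (congrArg Prod.snd (bundleChart_mk hp p.2)).symm

/-- A linear form on the typical fibre is, near a given point, the coordinate expression of a
section of the dual bundle. -/
theorem exists_dualSection [T2Space M] (x₀ : M) (ℓ : F →L[ℝ] ℝ) :
    ∃ θ : DualSection (B := B) (F := F) (E := E),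
      ∀ᶠ x in 𝓝 x₀, ∀ b, θ.toFun x b = ℓ (fibCoord F E x₀ x b) := by
  obtain ⟨χ, hχ, ht, h1⟩ := exists_smooth_bump (B := B)
    ((isOpen_chartDom (B := B) (F := F) (E := E) x₀).mem_nhds (mem_chartDom_self x₀))
  refine ⟨⟨fun x => χ x • ((ℓ : F →ₗ[ℝ] ℝ) ∘ₗ fibCoord F E x₀ x), ?_⟩, ?_⟩
  · refine contMDiff_of_tsupport fun p hp => ?_
    have hp' : p.1 ∈ chartDom B F E x₀ := by
      refine ht (tsupport_comp_subset_preimage χ (FiberBundle.continuous_proj F E) ?_)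
      refine closure_mono (fun q hq => ?_) hp
      intro h0
      exact hq (show χ q.1 • ℓ (fibCoord F E x₀ q.1 q.2) = 0 by
        rw [show χ q.1 = 0 from h0, zero_smul])
    have hopen : IsOpen ((TotalSpace.proj : TotalSpace F E → M) ⁻¹' chartDom B F E x₀) :=
      (isOpen_chartDom x₀).preimage (FiberBundle.continuous_proj F E)
    exact ((hχ.comp (contMDiff_proj E)).contMDiffAt).smul
      (ℓ.contMDiff.contMDiffAt.comp p ((contMDiffOn_fibCoord_totalSpace x₀).contMDiffAt
        (hopen.mem_nhds hp')))
  · filter_upwards [h1] with x hx b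
    change χ x • ℓ (fibCoord F E x₀ x b) = _
    rw [hx, Pi.one_apply, one_smul]

/-- The forms `d_𝐓^r θ` separate the points of the fibres of `𝒯^E E^k`. -/
theorem ETangent.eq_zero_of_iterDT [T2Space M] {k : ℕ} {A : L.Jet k} (z : L.ETangent k A)
    (h : ∀ θ (r : ℕ) (hr : r ≤ k), L.pull hr (L.iterDT θ r) A z = 0) : z = 0 := by
  have hA := mem_chartDom_self (B := B) (F := F) (E := E) A.base
  obtain ⟨S⟩ := L.exists_structureFunctions A.base
  refine (ETangent.coord_bijective hA).1 ?_
  rw [map_zero]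
  refine eq_zero_of_psi_eq_zero (an := localAnchor L A.base) (C := S.C) (A.coord k A.base) _
    fun r hr => ?_
  refine SeparatingDual.eq_zero_of_forall_dual_eq_zero (R := ℝ) fun ℓ => ?_
  obtain ⟨θ, hθ⟩ := exists_dualSection (B := B) (E := E) A.base ℓ
  obtain ⟨U, hU, hUo, hAU⟩ := eventually_nhds_iff.1 hθ
  have hΩ : IsOpen ((chartAt B A.base).target ∩ (chartAt B A.base).symm ⁻¹' U) :=
    (chartAt B A.base).isOpen_inter_preimage_symm hUo
  -- The domain is shrunk so that θ equals ℓ in coordinates throughout it: total derivatives require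
  -- the equality on an open set.
  let S' := S.restrict hΩ ⟨mem_chart_target B A.base, by
    rwa [mem_preimage, (chartAt B A.base).left_inv (mem_chart_source B A.base)]⟩
  -- Since ℓ is constant it commutes with d_𝐓, so d_𝐓^r θ is represented by ℓ∘ψ_r, and the ψ_r
  -- separate points.
  have hcoord : ∀ r, IsCoordForm (L.iterDT θ r) A.base S'.dom
      (fun q => ℓ.comp (psi (localAnchor L A.base) S'.C r q)) := by
    intro r
    induction r with
    | zero =>
      refine ⟨contDiffOn_const (c := ℓ.comp (ContinuousLinearMap.fst ℝ F (Fin 0 → F))),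
        fun A' hA' hA'' z => ?_⟩
      have h1 : (chartAt B A.base).symm (chartAt B A.base A'.base) ∈ U := hA''.2.2
      rw [(chartAt B A.base).left_inv hA'.1] at h1
      exact hU _ h1 _
    | succ r ih =>
      refine (ih.dT S').congr fun q hq => (dTloc_clm_comp ℓ ?_).symm
      exact ((contDiffOn_psi S'.isOpen_dom S'.contDiffOn_localAnchor S'.contDiffOn_C
        r).contDiffAt (S'.prod_mem_nhds hq.1)).differentiableAt (by simp)
  have h2 := ((hcoord r).pull hr).apply_eq A hA S'.mem_dom z
  rw [h θ r hr] at h2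
  exact h2.symm

/-! ### The vertical endomorphism in coordinates -/

/-- The vertical endomorphism at a point, defined by coordinates. -/
noncomputable def StructureFunctions.vert {x₀ : M} (S : L.StructureFunctions x₀) {k : ℕ}
    {A : L.Jet k} (h : A.base ∈ chartDom B F E x₀) : L.ETangent k A →ₗ[ℝ] L.ETangent k A :=
  (ETangent.coordEquiv h).symm.toLinearMap ∘ₗ
    (vertLoc (localAnchor L x₀) S.C k (A.coord k x₀)).toLinearMap ∘ₗ ETangent.coord x₀ A

theorem StructureFunctions.coord_vert {x₀ : M} (S : L.StructureFunctions x₀) {k : ℕ}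
    {A : L.Jet k} (h : A.base ∈ chartDom B F E x₀) (z : L.ETangent k A) :
    ETangent.coord x₀ A (S.vert h z) =
      vertLoc (localAnchor L x₀) S.C k (A.coord k x₀) (ETangent.coord x₀ A z) :=
  (ETangent.coordEquiv h).apply_symm_apply _

theorem StructureFunctions.pull_iterDT_zero_vert [T2Space M] {x₀ : M}
    (S : L.StructureFunctions x₀) {k : ℕ} {A : L.Jet k} (h : A.base ∈ chartDom B F E x₀)
    (hA : chartAt B x₀ A.base ∈ S.dom) (θ : DualSection (B := B) (F := F) (E := E))
    (z : L.ETangent k A) : L.pull k.zero_le (L.iterDT θ 0) A (S.vert h z) = 0 := by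
  obtain ⟨Θ, hΘ, -⟩ := exists_isCoordForm_iterDT S θ
  rw [((hΘ 0).pull k.zero_le).apply_eq A h hA, S.coord_vert, pullLoc_apply]
  have h1 : truncL F F k.zero_le (vertLoc (localAnchor L x₀) S.C k (A.coord k x₀)
      (ETangent.coord x₀ A z)) = 0 := Prod.ext rfl (funext fun j => j.elim0)
  rw [h1, map_zero]

/-- Because S commutes with truncation, the identity on `E^k` is the one for order r + 1, evaluated
on truncations. -/
theorem StructureFunctions.pull_iterDT_succ_vert [T2Space M] {x₀ : M}
    (S : L.StructureFunctions x₀) {k : ℕ} {A : L.Jet k} (h : A.base ∈ chartDom B F E x₀)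
    (hA : chartAt B x₀ A.base ∈ S.dom) (θ : DualSection (B := B) (F := F) (E := E))
    (r : ℕ) (hr : r + 1 ≤ k) (z : L.ETangent k A) :
    L.pull hr (L.iterDT θ (r + 1)) A (S.vert h z) =
      ((r + 1 : ℕ) : ℝ) * L.pull (r.le_succ.trans hr) (L.iterDT θ r) A z := by
  obtain ⟨Θ, hΘ, hd⟩ := exists_isCoordForm_iterDT S θ
  rw [((hΘ (r + 1)).pull hr).apply_eq A h hA, S.coord_vert, pullLoc_apply, truncL_vertLoc,
    ((hΘ r).pull (r.le_succ.trans hr)).apply_eq A h hA]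
  exact congrArg (fun T => T (truncL F F hr (ETangent.coord x₀ A z)))
    (apply_vertLoc_of_dTloc S.isOpen_dom S.contDiffOn_localAnchor S.contDiffOn_C Θ
      (fun r => (hΘ r).contDiffOn) (fun r q _ => congrFun (hd r) q) r
      (truncL F B hr (A.coord k x₀)) hA)

/-- The separation property applied to z - w; the forms are seen to be linear on the fibre through
their coordinate expressions. -/
theorem ETangent.ext_iterDT [T2Space M] {k : ℕ} {A : L.Jet k} {z w : L.ETangent k A}
    (h : ∀ θ (r : ℕ) (hr : r ≤ k),
      L.pull hr (L.iterDT θ r) A z = L.pull hr (L.iterDT θ r) A w) : z = w := by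
  have hA := mem_chartDom_self (B := B) (F := F) (E := E) A.base
  obtain ⟨S⟩ := L.exists_structureFunctions A.base
  refine sub_eq_zero.1 (ETangent.eq_zero_of_iterDT (z - w) fun θ r hr => ?_)
  obtain ⟨Θ, hΘ, -⟩ := exists_isCoordForm_iterDT S θ
  have h1 := ((hΘ r).pull hr).apply_eq A hA S.mem_dom
  rw [h1, map_sub, map_sub, ← h1, ← h1, h θ r hr, sub_self]

/-- A vertical endomorphism in coordinates. -/
theorem IsVerticalEndomorphism.coord_apply [T2Space M] {k : ℕ} {V : L.Endo k}
    (hV : L.IsVerticalEndomorphism V) {x₀ : M} (S : L.StructureFunctions x₀) {A : L.Jet k}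
    (h : A.base ∈ chartDom B F E x₀) (hA : chartAt B x₀ A.base ∈ S.dom) (z : L.ETangent k A) :
    ETangent.coord x₀ A (V A z) =
      vertLoc (localAnchor L x₀) S.C k (A.coord k x₀) (ETangent.coord x₀ A z) := by
  rw [← S.coord_vert h]
  -- V and the coordinate model satisfy the same equations on a separating family of forms.
  refine congrArg _ (ETangent.ext_iterDT fun θ r hr => ?_)
  cases r with
  | zero =>
    rw [S.pull_iterDT_zero_vert h hA]
    exact congrFun (congrFun (hV.zero θ) A) z
  | succ r =>
    rw [S.pull_iterDT_succ_vert h hA]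
    exact congrFun (congrFun (hV.succ θ r hr) A) z

/-- Only the coordinate expression of V is assumed: the existence proof uses this lemma to establish
smoothness, before V is known to be a vertical endomorphism. -/
theorem IsCoordForm.act {k : ℕ} {V : L.Endo k} {x₀ : M} (S : L.StructureFunctions x₀)
    (hV : ∀ (A : L.Jet k), A.base ∈ chartDom B F E x₀ → chartAt B x₀ A.base ∈ S.dom →
      ∀ z, ETangent.coord x₀ A (V A z) =
        vertLoc (localAnchor L x₀) S.C k (A.coord k x₀) (ETangent.coord x₀ A z))
    {lam : L.Form k} {Λ : B × (Fin k → F) → (F × (Fin k → F)) →L[ℝ] ℝ}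
    (hΛ : IsCoordForm lam x₀ S.dom Λ) :
    IsCoordForm (L.act V lam) x₀ S.dom
      (fun q => (Λ q).comp (vertLoc (localAnchor L x₀) S.C k q)) := by
  refine ⟨hΛ.contDiffOn.clm_comp
    (contDiffOn_vertLoc S.isOpen_dom S.contDiffOn_localAnchor S.contDiffOn_C k),
    fun A h hA z => ?_⟩
  rw [LieAlgebroid.act, hΛ.apply_eq A h hA, hV A h hA]
  rfl

/-- V is defined at each point by the chart centred at its base point. The algebraic equations hold
pointwise and do not depend on a chart, so by separation V is also given by the model of any single
chart over its whole domain; this yields smoothness. -/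
theorem exists_isVerticalEndomorphism [T2Space M] (L : LieAlgebroid B F E) (k : ℕ) :
    ∃ V : L.Endo k, L.IsVerticalEndomorphism V := by
  let S : ∀ x₀, L.StructureFunctions x₀ := fun x₀ => (L.exists_structureFunctions x₀).some
  have hself : ∀ A : L.Jet k, A.base ∈ chartDom B F E A.base := fun A => mem_chartDom_self _
  let V : L.Endo k := fun A => (S A.base).vert (hself A)
  have hzero : ∀ θ (A : L.Jet k) z, L.pull k.zero_le (L.iterDT θ 0) A (V A z) = 0 :=
    fun θ A z => (S A.base).pull_iterDT_zero_vert (hself A) (S A.base).mem_dom θ z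
  have hsucc : ∀ θ (r : ℕ) (hr : r + 1 ≤ k) (A : L.Jet k) (z),
      L.pull hr (L.iterDT θ (r + 1)) A (V A z) =
        ((r + 1 : ℕ) : ℝ) * L.pull (r.le_succ.trans hr) (L.iterDT θ r) A z :=
    fun θ r hr A z => (S A.base).pull_iterDT_succ_vert (hself A) (S A.base).mem_dom θ r hr z
  refine ⟨V, fun lam hlam => isSection_of_isCoordForm fun x₀ => ?_,
    fun θ => funext fun A => funext fun z => hzero θ A z,
    fun θ r hr => funext fun A => funext fun z => hsucc θ r hr A z⟩
  obtain ⟨Λ, hΛ⟩ := hlam.exists_isCoordForm x₀ (S x₀).dom_subset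
  refine ⟨(S x₀).dom, _, (S x₀).isOpen_dom, (S x₀).mem_dom, hΛ.act (S x₀) fun A h hA z => ?_⟩
  -- Comparison of two models at A: the one at x₀ and the one at A.base used to define V.
  rw [← (S x₀).coord_vert h]
  refine congrArg _ (ETangent.ext_iterDT fun θ r hr => ?_)
  cases r with
  | zero => rw [(S x₀).pull_iterDT_zero_vert h hA, hzero]
  | succ r => rw [(S x₀).pull_iterDT_succ_vert h hA, hsucc]

theorem IsVerticalEndomorphism.unique [T2Space M] {k : ℕ} {V W : L.Endo k}
    (hV : L.IsVerticalEndomorphism V) (hW : L.IsVerticalEndomorphism W) : V = W := by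
  refine funext fun A => LinearMap.ext fun z => ?_
  have hA := mem_chartDom_self (B := B) (F := F) (E := E) A.base
  obtain ⟨S⟩ := L.exists_structureFunctions A.base
  refine (ETangent.coord_bijective hA).1 ?_
  rw [hV.coord_apply S hA S.mem_dom, hW.coord_apply S hA S.mem_dom]

/-- The commutator of the vertical endomorphism and the total derivative. -/
theorem IsVerticalEndomorphism.act_dT_sub [T2Space M] {k : ℕ} {V : L.Endo k}
    {V' : L.Endo (k + 1)} (hV : L.IsVerticalEndomorphism V) (hV' : L.IsVerticalEndomorphism V')
    {lam : L.Form k} (hlam : L.IsSection lam) :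
    L.act V' (L.dT lam) - L.dT (L.act V lam) = L.pull k.le_succ lam := by
  refine funext fun A => funext fun z => ?_
  have hA := mem_chartDom_self (B := B) (F := F) (E := E) A.base
  obtain ⟨S⟩ := L.exists_structureFunctions A.base
  obtain ⟨Λ, hΛ⟩ := hlam.exists_isCoordForm A.base S.dom_subset
  -- All forms involved acquire coordinate expressions over the one domain `S.dom`, so the identity
  -- becomes `dTloc_apply_vertLoc`.
  have hV := hΛ.act S fun A h hA z => hV.coord_apply S h hA z
  have hV' := (hΛ.dT S).act S fun A h hA z => hV'.coord_apply S h hA z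
  have hd : DifferentiableAt ℝ Λ (truncL F B k.le_succ (A.coord (k + 1) A.base)) :=
    (hΛ.contDiffOn.contDiffAt (S.prod_mem_nhds S.mem_dom)).differentiableAt (by simp)
  rw [Pi.sub_apply, Pi.sub_apply, hV'.apply_eq A hA S.mem_dom,
    (hV.dT S).apply_eq A hA S.mem_dom, (hΛ.pull k.le_succ).apply_eq A hA S.mem_dom,
    ContinuousLinearMap.comp_apply, dTloc_apply_vertLoc S.isOpen_dom S.contDiffOn_localAnchor
      S.contDiffOn_C S.mem_dom hd, add_sub_cancel_left, pullLoc_apply]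

end Vertical
end LieAlgebroid

/-! ### The theorem -/

theorem mainTheorem10
    {B : Type*} [NormedAddCommGroup B] [NormedSpace ℝ B] [FiniteDimensional ℝ B]
    {M : Type*} [TopologicalSpace M] [T2Space M] [ChartedSpace B M] [IsManifold 𝓘(ℝ, B) ∞ M]
    {F : Type*} [NormedAddCommGroup F] [NormedSpace ℝ F] [FiniteDimensional ℝ F]
    {E : M → Type*} [∀ x, AddCommGroup (E x)] [∀ x, Module ℝ (E x)]
    [∀ x, TopologicalSpace (E x)] [TopologicalSpace (TotalSpace F E)]
    [FiberBundle F E] [VectorBundle ℝ F E] [ContMDiffVectorBundle ∞ F E 𝓘(ℝ, B)]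
    (L : LieAlgebroid B F E) :
    (∀ k : ℕ, ∃! S : L.Endo k, L.IsVerticalEndomorphism S) ∧
    ∀ (k : ℕ) (S : L.Endo k) (S' : L.Endo (k + 1)),
      L.IsVerticalEndomorphism S → L.IsVerticalEndomorphism S' →
      ∀ lam : L.Form k, L.IsSection lam →
        L.IsSection (L.dT lam) ∧
        L.act S' (L.dT lam) - L.dT (L.act S lam) = L.pull k.le_succ lam := by
  refine ⟨fun k => ?_, fun k S S' hS hS' lam hlam => ⟨LieAlgebroid.isSection_dT hlam,
    hS.act_dT_sub hS' hlam⟩⟩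
  obtain ⟨S, hS⟩ := LieAlgebroid.exists_isVerticalEndomorphism L k
  exact ⟨S, hS, fun S' hS' => hS'.unique hS⟩
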